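/- **Theorem (Existence principle).** Let $\mathscr Z_0$ be a separable complex Hilbert space and $A$ a self-adjoint operator on it with $A\ge c\,1$ for some $c>0$. For $\tau\in\mathbb R$ let $\mathscr Z_\tau$ be the completion of $D(A^{\tau/2})$ for the inner product $\langle A^{\tau/2}x,A^{\tau/2}y\rangle_{\mathscr Z_0}$, so that $\mathscr Z_s\hookrightarrow\mathscr Z_0\hookrightarrow\mathscr Z_{-\sigma}$ for $s,\sigma\ge0$. Let $0\le s\le\sigma$, and let $v:\mathbb R\times\mathscr Z_s\to\mathscr Z_{-\sigma}$ be Borel, bounded on bounded sets, and such that $v(t,e^{i\theta}x)=e^{i\theta}v(t,x)$ for all $t,\theta\in\mathbb R$, $x\in\mathscr Z_s$. Let $I$ be a bounded open interval and $t_0\in I$. *Weak solutions.* A weak solution over $I$ of $\dot u=v(t,u)$, $u(t_0)=x$, is a function $u\in L^\infty(I,\mathscr Z_s)\cap W^{1,\infty}(I,\mathscr Z_{-\sigma})$ (identified with its representative that is continuous into $\mathscr Z_{-\sigma}$) with $\dot u(t)=v(t,u(t))$ for a.e. $t\in I$ and $u(t_0)=x$. *Symmetric hierarchies.* Let $\vee^k\mathscr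 Z_0$ be the symmetric tensor power and $\mathscr L^1$ the trace class. A normal state on $\vee^n\mathscr Z_0$ is a non-negative $\varrho_n\in\mathscr L^1(\vee^n\mathscr Z_0)$ of trace $1$; for $k\le n$ its reduced density matrix $\varrho_n^{(k)}\in\mathscr L^1(\vee^k\mathscr Z_0)$ is the non-negative operator given by $\mathrm{Tr}[\varrho_n\,(B\otimes1^{\otimes(n-k)})]=\mathrm{Tr}[\varrho_n^{(k)}B]$ for all bounded $B$. The set $\mathscr H(\mathscr Z_0)$ of symmetric hierarchies consists of the sequences $(\gamma^{(k)})_{k\in\mathbb N}$, $\gamma^{(k)}\in\mathscr L^1(\vee^k\mathscr Z_0)$, for which there are normal states $\varrho_n$ on $\vee^n\mathscr Z_0$ and a subsequence $(n_i)$ with $\varrho_{n_i}^{(k)}\to\gamma^{(k)}$ weak-$*$ for every $k$. The de Finetti measure of $\gamma\in\mathscr H(\mathscr Z_0)$ is the Borel probability measure $\mu$ on the closed unit ball $X_1$ of $\mathscr Z_0$, invariant under $x\mapsto e^{i\theta}x$ for all $\theta$, with $\gamma^{(k)}=\int_{X_1}|x^{\otimes k}\rangle\langle x^{\otimes k}|\,d\mu(x)$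 for all $k$. *Hierarchy equation.* A curve $t\in I\mapsto\gamma_t\in\mathscr H(\mathscr Z_0)$ with de Finetti measures $\mu_t$ solves the hierarchy equation if for all $t\in I$ and $k\in\mathbb N$ $$\gamma_t^{(k)}=\gamma_{t_0}^{(k)}+\int_{t_0}^t\sum_{j=1}^k\big(C^+_{j,k}\gamma_\tau+C^-_{j,k}\gamma_\tau\big)\,d\tau,$$ $$C^+_{j,k}\gamma_\tau=\int_{\mathscr Z_s\cap X_1}|x^{\otimes k}\rangle\langle x^{\otimes (j-1)}\otimes v(\tau,x)\otimes x^{\otimes(k-j)}|\,d\mu_\tau(x),\qquad C^-_{j,k}\gamma_\tau=\int_{\mathscr Z_s\cap X_1}|x^{\otimes (j-1)}\otimes v(\tau,x)\otimes x^{\otimes(k-j)}\rangle\langle x^{\otimes k}|\,d\mu_\tau(x),$$ all integrals existing as Bochner integrals for the norm $\|T\|_{-\sigma}=\|(A^{-\sigma/2})^{\otimes k}\,T\,(A^{-\sigma/2})^{\otimes k}\|_{\mathscr L^1}$. The curve satisfies (A1) if $\gamma_t\in\mathscr H(\mathscr Z_0)$ for all $t\in I$; there is $R'>0$ with $\|(A^{s/2})^{\otimes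 k}\gamma_t^{(k)}(A^{s/2})^{\otimes k}\|_{\mathscr L^1}\le R'^{2k}$ for all $k\in\mathbb N$, $t\in I$; and $t\mapsto(A^{-\sigma/2})^{\otimes k}\gamma_t^{(k)}(A^{-\sigma/2})^{\otimes k}$ is weak-$*$ continuous on $I$ in $\mathscr L^1$ for every $k$. *Hypotheses.* Let $\mathcal A\subset\mathscr Z_s$ be a Borel set with $e^{i\theta}\mathcal A\subset\mathcal A$ for all $\theta\in\mathbb R$, and let $\phi:\bar I\times\mathcal A\to\mathscr Z_s$ be a Borel map, bounded on bounded sets, such that for every $x\in\mathcal A$ the curve $t\in I\mapsto\phi(t,x)$ is a weak solution with $\phi(t_0,x)=x$, and such that $\|\phi(t,x)\|_{\mathscr Z_0}=\|x\|_{\mathscr Z_0}$ and $\phi(t,e^{i\theta}x)=e^{i\theta}\phi(t,x)$ for all $x\in\mathcal A$, $t\in\bar I$, $\theta\in\mathbb R$. *Conclusion.* Let $\gamma=(\gamma^{(k)})_{k\in\mathbb N}\in\mathscr H(\mathscr Z_0)$ be such that $\gamma^{(k)}=\int_{\mathscr Z_s}|x^{\otimes k}\rangle\langle x^{\otimes k}|\,d\nu(x)$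 (as Bochner integrals in $\mathscr L^1$) for all $k$, with a Borel probability measure $\nu$ on $\mathscr Z_s$ satisfying $\nu(\mathcal A)=1$, and such that for some $R>0$ one has $\|(A^{s/2})^{\otimes k}\gamma^{(k)}(A^{s/2})^{\otimes k}\|_{\mathscr L^1}\le R^{2k}$ for all $k\in\mathbb N$. Then there is a curve $t\in I\mapsto\gamma_t\in\mathscr H(\mathscr Z_0)$ that solves the hierarchy equation, satisfies $\gamma_{t_0}=\gamma$ and (A1), and is given by the push-forward measures $\phi(t,\cdot)_\sharp\nu$: $$\gamma_t^{(k)}=\int_{\mathscr Z_s}|x^{\otimes k}\rangle\langle x^{\otimes k}|\,d\big(\phi(t,\cdot)_\sharp\nu\big)(x),\qquad t\in I,\ k\in\mathbb N.$$ -/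

import Mathlib

open MeasureTheory Set Filter Topology
open scoped ENNReal InnerProductSpace TensorProduct

noncomputable section

namespace Hierarchy

universe u

/-! ### Trace class operators -/

section TraceClass

variable {E : Type u} [NormedAddCommGroup E] [InnerProductSpace ℂ E]

/-- The trace norm `‖T‖₁ = sup ∑ᵢ |⟨fᵢ, T eᵢ⟩| ∈ [0, ∞]`, the supremum being over all pairs of finite
orthonormal families `(eᵢ)`, `(fᵢ)`. -/
def traceNorm (T : E →L[ℂ] E) : ℝ≥0∞ :=
  ⨆ (n : ℕ) (e : Fin n → E) (f : Fin n → E) (_ : Orthonormal ℂ e) (_ : Orthonormal ℂ f),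
    ∑ i, ‖⟪f i, T (e i)⟫_ℂ‖ₑ

theorem sum_le_traceNorm (T : E →L[ℂ] E) {n : ℕ} {e f : Fin n → E}
    (he : Orthonormal ℂ e) (hf : Orthonormal ℂ f) :
    ∑ i, ‖⟪f i, T (e i)⟫_ℂ‖ₑ ≤ traceNorm T :=
  le_iSup_of_le n <| le_iSup_of_le e <| le_iSup_of_le f <| le_iSup_of_le he <|
    le_iSup_of_le hf le_rfl

theorem traceNorm_le {T : E →L[ℂ] E} {C : ℝ≥0∞}
    (h : ∀ (n : ℕ) (e f : Fin n → E), Orthonormal ℂ e → Orthonormal ℂ f →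
      ∑ i, ‖⟪f i, T (e i)⟫_ℂ‖ₑ ≤ C) : traceNorm T ≤ C :=
  iSup_le fun n => iSup_le fun e => iSup_le fun f => iSup_le fun he => iSup_le fun hf =>
    h n e f he hf

theorem traceNorm_zero : traceNorm (0 : E →L[ℂ] E) = 0 :=
  le_antisymm (traceNorm_le fun n e f _ _ => by simp) bot_le

theorem traceNorm_add_le (S T : E →L[ℂ] E) : traceNorm (S + T) ≤ traceNorm S + traceNorm T := by
  refine traceNorm_le fun n e f he hf => ?_
  calc ∑ i, ‖⟪f i, (S + T) (e i)⟫_ℂ‖ₑ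
      ≤ ∑ i, (‖⟪f i, S (e i)⟫_ℂ‖ₑ + ‖⟪f i, T (e i)⟫_ℂ‖ₑ) := by
        refine Finset.sum_le_sum fun i _ => ?_
        rw [add_apply, inner_add_right]
        exact enorm_add_le _ _
    _ = _ := Finset.sum_add_distrib
    _ ≤ _ := add_le_add (sum_le_traceNorm S he hf) (sum_le_traceNorm T he hf)

theorem traceNorm_smul (c : ℂ) (T : E →L[ℂ] E) : traceNorm (c • T) = ‖c‖ₑ * traceNorm T := by
  simp only [traceNorm, ENNReal.mul_iSup, smul_apply, inner_smul_right,
    enorm_mul, Finset.mul_sum]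

theorem enorm_le_traceNorm (T : E →L[ℂ] E) : ‖T‖ₑ ≤ traceNorm T := by
  by_cases htop : traceNorm T = ∞
  · simp [htop]
  rw [← ENNReal.ofReal_toReal htop, ← ofReal_norm]
  refine ENNReal.ofReal_le_ofReal ?_
  refine T.opNorm_le_bound ENNReal.toReal_nonneg fun x => ?_
  by_cases hx : x = 0
  · simp [hx]
  by_cases hTx : T x = 0
  · simp only [hTx, norm_zero]; positivity
  have hx' : (‖x‖ : ℂ) ≠ 0 := by simpa using hx
  have hTx' : (‖T x‖ : ℂ) ≠ 0 := by simpa using hTx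
  have ho : ∀ z : E, z ≠ 0 → Orthonormal ℂ (fun _ : Fin 1 => ((‖z‖ : ℂ)⁻¹ • z)) := by
    intro z hz
    have : ‖z‖ ≠ 0 := by simpa using hz
    refine ⟨fun _ => ?_, fun i j hij => (hij (Subsingleton.elim _ _)).elim⟩
    simp [norm_smul, this]
  have h := sum_le_traceNorm T (ho x hx) (ho (T x) hTx)
  have hval : ⟪(‖T x‖ : ℂ)⁻¹ • T x, T ((‖x‖ : ℂ)⁻¹ • x)⟫_ℂ = (‖x‖ : ℂ)⁻¹ * ‖T x‖ := by
    rw [map_smul, inner_smul_left, inner_smul_right, inner_self_eq_norm_sq_to_K]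
    simp only [map_inv₀, Complex.conj_ofReal, Complex.coe_algebraMap]
    field_simp
  rw [Fin.sum_univ_one, hval, ← ofReal_norm, ENNReal.ofReal_le_iff_le_toReal htop] at h
  have hx0 : 0 < ‖x‖ := by simpa using hx
  simp only [norm_mul, norm_inv, Complex.norm_real, norm_norm] at h
  rw [inv_mul_le_iff₀ hx0] at h
  linarith

theorem traceNorm_eq_zero {T : E →L[ℂ] E} (h : traceNorm T = 0) : T = 0 := by
  have h1 := enorm_le_traceNorm T
  rw [h, nonpos_iff_eq_zero, ← ofReal_norm, ENNReal.ofReal_eq_zero] at h1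
  exact norm_le_zero_iff.1 h1

variable (E) in
/-- The linear space of trace class operators. -/
def traceClassSubmodule : Submodule ℂ (E →L[ℂ] E) where
  carrier := {T | traceNorm T < ∞}
  add_mem' hS hT := lt_of_le_of_lt (traceNorm_add_le _ _) (ENNReal.add_lt_top.2 ⟨hS, hT⟩)
  zero_mem' := by simp [traceNorm_zero]
  smul_mem' c T hT := by
    simp only [mem_ofPred_eq, traceNorm_smul] at hT ⊢
    exact ENNReal.mul_lt_top enorm_lt_top hT

variable (E) in
/-- The space `𝓛¹(E)` of trace class operators on `E`, normed by the trace norm. -/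
def TraceClass : Type u := traceClassSubmodule E

instance : AddCommGroup (TraceClass E) := inferInstanceAs (AddCommGroup (traceClassSubmodule E))

instance : Module ℂ (TraceClass E) := inferInstanceAs (Module ℂ (traceClassSubmodule E))

/-- The bounded operator underlying a trace class operator. -/
def TraceClass.op : TraceClass E →ₗ[ℂ] (E →L[ℂ] E) := (traceClassSubmodule E).subtype

/-- A bounded operator of finite trace norm, as a trace class operator. -/
def TraceClass.ofOp (T : E →L[ℂ] E) (h : traceNorm T < ∞) : TraceClass E := ⟨T, h⟩

theorem TraceClass.op_ofOp (T : E →L[ℂ] E) (h : traceNorm T < ∞) :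
    (TraceClass.ofOp T h).op = T := rfl

theorem TraceClass.op_injective :
    Function.Injective (TraceClass.op : TraceClass E →ₗ[ℂ] (E →L[ℂ] E)) :=
  Subtype.val_injective

theorem TraceClass.traceNorm_lt_top (T : TraceClass E) : traceNorm T.op < ∞ := T.2

instance : Norm (TraceClass E) := ⟨fun T => (traceNorm T.op).toReal⟩

theorem TraceClass.norm_def (T : TraceClass E) : ‖T‖ = (traceNorm T.op).toReal := rfl

theorem TraceClass.normCore : NormedSpace.Core ℂ (TraceClass E) where
  norm_nonneg T := ENNReal.toReal_nonneg
  norm_smul c T := by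
    rw [TraceClass.norm_def, map_smul, traceNorm_smul, ENNReal.toReal_mul, toReal_enorm]; rfl
  norm_triangle S T := by
    simp only [TraceClass.norm_def, map_add]
    rw [← ENNReal.toReal_add S.traceNorm_lt_top.ne T.traceNorm_lt_top.ne]
    exact ENNReal.toReal_mono
      (ENNReal.add_lt_top.2 ⟨S.traceNorm_lt_top, T.traceNorm_lt_top⟩).ne (traceNorm_add_le _ _)
  norm_eq_zero_iff T := by
    constructor
    · intro h
      rw [TraceClass.norm_def, ENNReal.toReal_eq_zero_iff] at h
      apply TraceClass.op_injective
      rw [map_zero]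
      exact traceNorm_eq_zero (h.resolve_right T.traceNorm_lt_top.ne)
    · rintro rfl
      simp [TraceClass.norm_def, traceNorm_zero]

instance : NormedAddCommGroup (TraceClass E) := NormedAddCommGroup.ofCore TraceClass.normCore

instance : NormedSpace ℂ (TraceClass E) := NormedSpace.ofCore TraceClass.normCore

theorem TraceClass.norm_op_le (T : TraceClass E) : ‖T.op‖ ≤ ‖T‖ := by
  have h := ENNReal.toReal_mono T.traceNorm_lt_top.ne (enorm_le_traceNorm T.op)
  rwa [toReal_enorm] at h

/-- If operators of trace norm at most `C` converge weakly to `T`, then `T` has trace norm at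
most `C`. -/
theorem traceNorm_le_of_tendsto {C : ℝ≥0∞} {F : ℕ → E →L[ℂ] E} {T : E →L[ℂ] E}
    (hF : ∀ᶠ n in atTop, traceNorm (F n) ≤ C)
    (h : ∀ x y, Tendsto (fun n => ⟪y, F n x⟫_ℂ) atTop (𝓝 ⟪y, T x⟫_ℂ)) : traceNorm T ≤ C := by
  refine traceNorm_le fun n e f he hf => ?_
  have ht : Tendsto (fun m => ∑ i, ‖⟪f i, F m (e i)⟫_ℂ‖ₑ) atTop
      (𝓝 (∑ i, ‖⟪f i, T (e i)⟫_ℂ‖ₑ)) :=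
    tendsto_finsetSum _ fun i _ => (h (e i) (f i)).enorm
  refine le_of_tendsto ht ?_
  filter_upwards [hF] with m hm
  exact (sum_le_traceNorm _ he hf).trans hm

instance [CompleteSpace E] : CompleteSpace (TraceClass E) := by
  refine Metric.complete_of_cauchySeq_tendsto fun F hF => ?_
  have hop : CauchySeq fun n => (F n).op := by
    rw [Metric.cauchySeq_iff'] at hF ⊢
    intro ε hε
    obtain ⟨N, hN⟩ := hF ε hε
    refine ⟨N, fun n hn => ?_⟩
    have h1 := TraceClass.norm_op_le (F n - F N)
    have h2 := hN n hn
    rw [dist_eq_norm] at h2 ⊢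
    rw [map_sub] at h1
    exact h1.trans_lt h2
  obtain ⟨T, hT⟩ := cauchySeq_tendsto_of_complete hop
  have key : ∀ ε > 0, ∃ N, ∀ n ≥ N, traceNorm ((F n).op - T) ≤ ENNReal.ofReal ε := by
    intro ε hε
    obtain ⟨N, hN⟩ := (Metric.cauchySeq_iff.1 hF) ε hε
    refine ⟨N, fun n hn => ?_⟩
    refine traceNorm_le_of_tendsto (F := fun m => (F n).op - (F m).op) ?_ ?_
    · filter_upwards [eventually_ge_atTop N] with m hm
      have h1 := (hN n hn m hm).le
      rw [dist_eq_norm, TraceClass.norm_def, map_sub] at h1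
      rw [← map_sub] at h1 ⊢
      exact (ENNReal.le_ofReal_iff_toReal_le (F n - F m).traceNorm_lt_top.ne hε.le).2 h1
    · intro x y
      have hx : Tendsto (fun m => (F m).op x) atTop (𝓝 (T x)) :=
        ((ContinuousLinearMap.apply ℂ E x).continuous.tendsto T).comp hT
      simp only [sub_apply]
      exact tendsto_const_nhds.inner (tendsto_const_nhds.sub hx)
  have hmem : traceNorm T < ∞ := by
    obtain ⟨N, hN⟩ := key 1 one_pos
    have h1 := hN N le_rfl
    have h2 : T = (F N).op + (-1 : ℂ) • ((F N).op - T) := by simp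
    rw [h2]
    refine (traceNorm_add_le _ _).trans_lt (ENNReal.add_lt_top.2 ⟨(F N).traceNorm_lt_top, ?_⟩)
    rw [traceNorm_smul]
    exact ENNReal.mul_lt_top enorm_lt_top (h1.trans_lt ENNReal.ofReal_lt_top)
  refine ⟨TraceClass.ofOp T hmem, ?_⟩
  rw [Metric.tendsto_atTop]
  intro ε hε
  obtain ⟨N, hN⟩ := key (ε / 2) (half_pos hε)
  refine ⟨N, fun n hn => ?_⟩
  rw [dist_eq_norm, TraceClass.norm_def, map_sub, TraceClass.op_ofOp]
  refine lt_of_le_of_lt ?_ (half_lt_self hε)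
  exact ENNReal.toReal_le_of_le_ofReal (half_pos hε).le (hN n hn)

theorem traceNorm_rankOne_le (x y : E) :
    traceNorm (InnerProductSpace.rankOne ℂ x y) ≤ ENNReal.ofReal (‖x‖ * ‖y‖) := by
  refine traceNorm_le fun n e f he hf => ?_
  have h1 : ∀ i, ‖⟪f i, InnerProductSpace.rankOne ℂ x y (e i)⟫_ℂ‖ₑ
      = ENNReal.ofReal (‖⟪e i, y⟫_ℂ‖ * ‖⟪f i, x⟫_ℂ‖) := by
    intro i
    rw [← ofReal_norm, InnerProductSpace.rankOne_apply, inner_smul_right, norm_mul,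
      norm_inner_symm y]
  rw [Finset.sum_congr rfl fun i _ => h1 i,
    ← ENNReal.ofReal_sum_of_nonneg fun i _ => by positivity]
  refine ENNReal.ofReal_le_ofReal ?_
  calc ∑ i, ‖⟪e i, y⟫_ℂ‖ * ‖⟪f i, x⟫_ℂ‖
      ≤ √(∑ i, ‖⟪e i, y⟫_ℂ‖ ^ 2) * √(∑ i, ‖⟪f i, x⟫_ℂ‖ ^ 2) :=
        Real.sum_mul_le_sqrt_mul_sqrt _ _ _
    _ ≤ ‖y‖ * ‖x‖ := by
        gcongr
        · exact (Real.sqrt_le_left (norm_nonneg _)).2 (he.sum_inner_products_le y)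
        · exact (Real.sqrt_le_left (norm_nonneg _)).2 (hf.sum_inner_products_le x)
    _ = ‖x‖ * ‖y‖ := mul_comm _ _

/-- The operator `|x⟩⟨y| : z ↦ ⟨y, z⟩ x` as a trace class operator. -/
def ketbra (x y : E) : TraceClass E :=
  .ofOp (InnerProductSpace.rankOne ℂ x y)
    ((traceNorm_rankOne_le x y).trans_lt ENNReal.ofReal_lt_top)

theorem op_ketbra_apply (x y z : E) : (ketbra x y).op z = ⟪y, z⟫_ℂ • x := rfl

/-- The trace `Tr T = ∑ᵢ ⟨eᵢ, T eᵢ⟩` over a Hilbert basis `(eᵢ)`. -/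
def trace [CompleteSpace E] (T : E →L[ℂ] E) : ℂ :=
  ∑' i, ⟪(exists_hilbertBasis ℂ E).choose_spec.choose i,
    T ((exists_hilbertBasis ℂ E).choose_spec.choose i)⟫_ℂ

end TraceClass

/-! ### Tensor powers of a Hilbert space -/

section Tensor

section Binary

variable {E F : Type u} [NormedAddCommGroup E] [InnerProductSpace ℂ E] [NormedAddCommGroup F]
  [InnerProductSpace ℂ F]

/-- `x ⊗ y` in the Hilbert tensor product of `E` and `F`. -/
def completedTmul (x : E) (y : F) : UniformSpace.Completion (E ⊗[ℂ] F) :=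
  ((x ⊗ₜ[ℂ] y : E ⊗[ℂ] F) : UniformSpace.Completion (E ⊗[ℂ] F))

theorem inner_completedTmul (x x' : E) (y y' : F) :
    ⟪completedTmul x y, completedTmul x' y'⟫_ℂ = ⟪x, x'⟫_ℂ * ⟪y, y'⟫_ℂ := by
  rw [completedTmul, completedTmul, UniformSpace.Completion.inner_coe, TensorProduct.inner_tmul]

/-- The bounded operator `S ⊗ T` on the Hilbert tensor product of `E` and `F`. -/
def completedMap (S : E →L[ℂ] E) (T : F →L[ℂ] F) :
    UniformSpace.Completion (E ⊗[ℂ] F) →L[ℂ] UniformSpace.Completion (E ⊗[ℂ] F) :=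
  ContinuousLinearMap.extend
    ((UniformSpace.Completion.toComplL (𝕜 := ℂ) (E := E ⊗[ℂ] F)).comp (TensorProduct.mapL S T))
    (UniformSpace.Completion.toComplL (𝕜 := ℂ) (E := E ⊗[ℂ] F))

theorem completedMap_completedTmul (S : E →L[ℂ] E) (T : F →L[ℂ] F) (x : E) (y : F) :
    completedMap S T (completedTmul x y) = completedTmul (S x) (T y) :=
  ContinuousLinearMap.extend_eq _ UniformSpace.Completion.denseRange_coe
    (UniformSpace.Completion.isUniformInducing_coe _) (x ⊗ₜ[ℂ] y)

end Binary

/-- A complex Hilbert space, bundled. -/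
structure HilbertSpace : Type (u + 1) where
  carrier : Type u
  [instNormed : NormedAddCommGroup carrier]
  [instInner : InnerProductSpace ℂ carrier]
  [instComplete : CompleteSpace carrier]

attribute [instance] HilbertSpace.instNormed HilbertSpace.instInner
  HilbertSpace.instComplete

variable (H : Type u) [NormedAddCommGroup H] [InnerProductSpace ℂ H]

/-- `H^{⊗0} = ℂ` (as a one-dimensional Hilbert space), and `H^{⊗(k+1)}` is the completion of
`H^{⊗k} ⊗ H`. -/
def tensorPowAux : ℕ → HilbertSpace.{u}
  | 0 => ⟨EuclideanSpace ℂ PUnit.{u + 1}⟩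
  | k + 1 => ⟨UniformSpace.Completion ((tensorPowAux k).carrier ⊗[ℂ] H)⟩

/-- The Hilbert tensor power `⊗^k H`. -/
def HTensor (k : ℕ) : Type u := (tensorPowAux H k).carrier

instance (k : ℕ) : NormedAddCommGroup (HTensor H k) :=
  inferInstanceAs (NormedAddCommGroup (tensorPowAux H k).carrier)

instance (k : ℕ) : InnerProductSpace ℂ (HTensor H k) :=
  inferInstanceAs (InnerProductSpace ℂ (tensorPowAux H k).carrier)

instance (k : ℕ) : CompleteSpace (HTensor H k) :=
  inferInstanceAs (CompleteSpace (tensorPowAux H k).carrier)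

variable {H}

/-- The map `⊗^k H × H → ⊗^{k+1} H`, `(ψ, y) ↦ ψ ⊗ y`. -/
def tensorSnoc (k : ℕ) (ψ : HTensor H k) (y : H) : HTensor H (k + 1) :=
  completedTmul ψ y

/-- The elementary tensor `x₁ ⊗ ⋯ ⊗ x_k`. -/
def tensorVec : (k : ℕ) → (Fin k → H) → HTensor H k
  | 0, _ => (EuclideanSpace.single PUnit.unit 1 : EuclideanSpace ℂ PUnit.{u + 1})
  | k + 1, x => tensorSnoc k (tensorVec k (Fin.init x)) (x (Fin.last k))

theorem inner_tensorSnoc (k : ℕ) (ψ ψ' : HTensor H k) (y y' : H) :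
    ⟪tensorSnoc k ψ y, tensorSnoc k ψ' y'⟫_ℂ = ⟪ψ, ψ'⟫_ℂ * ⟪y, y'⟫_ℂ :=
  inner_completedTmul ψ ψ' y y'

theorem inner_tensorVec (k : ℕ) (x y : Fin k → H) :
    ⟪tensorVec k x, tensorVec k y⟫_ℂ = ∏ i, ⟪x i, y i⟫_ℂ := by
  induction k with
  | zero =>
    show ⟪(EuclideanSpace.single PUnit.unit 1 : EuclideanSpace ℂ PUnit.{u + 1}),
      (EuclideanSpace.single PUnit.unit 1 : EuclideanSpace ℂ PUnit.{u + 1})⟫_ℂ = _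
    simp
  | succ k ih =>
    rw [tensorVec, tensorVec, inner_tensorSnoc, ih, Fin.prod_univ_castSucc]
    rfl

/-- For bounded operators `S` on `⊗^k H` and `T` on `H`, the bounded operator `S ⊗ T` on
`⊗^{k+1} H`. -/
def opSnoc (k : ℕ) (S : HTensor H k →L[ℂ] HTensor H k) (T : H →L[ℂ] H) :
    HTensor H (k + 1) →L[ℂ] HTensor H (k + 1) :=
  completedMap S T

theorem opSnoc_tensorSnoc (k : ℕ) (S : HTensor H k →L[ℂ] HTensor H k) (T : H →L[ℂ] H)
    (ψ : HTensor H k) (y : H) :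
    opSnoc k S T (tensorSnoc k ψ y) = tensorSnoc k (S ψ) (T y) :=
  completedMap_completedTmul S T ψ y

/-- The operator `T^{⊗k}` on `⊗^k H`. -/
def opPow (T : H →L[ℂ] H) : (k : ℕ) → HTensor H k →L[ℂ] HTensor H k
  | 0 => ContinuousLinearMap.id ℂ _
  | k + 1 => opSnoc k (opPow T k) T

theorem opPow_tensorVec (T : H →L[ℂ] H) (k : ℕ) (x : Fin k → H) :
    opPow T k (tensorVec k x) = tensorVec k (fun i => T (x i)) := by
  induction k with
  | zero => rfl
  | succ k ih => rw [opPow, tensorVec, opSnoc_tensorSnoc, ih]; rfl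

/-- For `k ≤ n` and a bounded operator `S` on `⊗^k H`, the operator `S ⊗ 1^{⊗(n-k)}` on `⊗^n H`. -/
def ampliation {k n : ℕ} (h : k ≤ n) (S : HTensor H k →L[ℂ] HTensor H k) :
    HTensor H n →L[ℂ] HTensor H n :=
  Nat.leRecOn (C := fun m => HTensor H m →L[ℂ] HTensor H m) h
    (fun {m} R => opSnoc m R (ContinuousLinearMap.id ℂ H)) S

variable (H) in
/-- The symmetric subspace `∨^k H` of `⊗^k H`: the vectors invariant under all permutations of the
tensor factors. -/
def symTensor (k : ℕ) : Submodule ℂ (HTensor H k) where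
  carrier := {ψ | ∀ (π : Equiv.Perm (Fin k)) (x : Fin k → H),
    ⟪tensorVec k (x ∘ π), ψ⟫_ℂ = ⟪tensorVec k x, ψ⟫_ℂ}
  add_mem' h h' π x := by rw [inner_add_right, inner_add_right, h π x, h' π x]
  zero_mem' π x := by simp
  smul_mem' c ψ h π x := by rw [inner_smul_right, inner_smul_right, h π x]

/-- `T` is (the extension by zero of) an operator on `∨^k H`. In this way `𝓛¹(∨^k H)` is regarded as
a subspace of `𝓛¹(⊗^k H)`. -/
def IsSymOp {k : ℕ} (T : HTensor H k →L[ℂ] HTensor H k) : Prop :=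
  (∀ ψ, T ψ ∈ symTensor H k) ∧ ∀ ψ ∈ (symTensor H k)ᗮ, T ψ = 0

end Tensor

/-! ### Symmetric hierarchies -/

section SymmetricHierarchies

variable {H : Type u} [NormedAddCommGroup H] [InnerProductSpace ℂ H]

/-- `ϱ` is a normal state (density matrix) on `∨^n H`. -/
def IsNormalState {n : ℕ} (ϱ : TraceClass (HTensor H n)) : Prop :=
  IsSymOp ϱ.op ∧ ϱ.op.IsPositive ∧ trace ϱ.op = 1

/-- `ϱk` is the `k`-particle reduced density matrix of the normal state `ϱ` on `∨^n H`. -/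
def IsReducedDensity {k n : ℕ} (h : k ≤ n) (ϱ : TraceClass (HTensor H n))
    (ϱk : TraceClass (HTensor H k)) : Prop :=
  IsSymOp ϱk.op ∧ ϱk.op.IsPositive ∧
    ∀ S : HTensor H k →L[ℂ] HTensor H k,
      trace (ϱ.op ∘L ampliation h S) = trace (ϱk.op ∘L S)

/-- The set `𝓗(H)`: `γ = (γ^{(k)})` is a symmetric hierarchy if there is a sequence of normal states
`ϱ_n` on `∨^n H` and a subsequence along which the reduced density matrices `ϱ_n^{(k)}`
converge to `γ^{(k)}` in the weak-* topology of `𝓛¹(∨^k H)`, for all `k`. -/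
def IsSymmetricHierarchy (γ : (k : ℕ) → TraceClass (HTensor H k)) : Prop :=
  (∀ k, IsSymOp (γ k).op) ∧
  ∃ (ϱ : (n : ℕ) → TraceClass (HTensor H n)) (red : (n k : ℕ) → TraceClass (HTensor H k))
    (sub : ℕ → ℕ),
    (∀ n, IsNormalState (ϱ n)) ∧
    (∀ (n k : ℕ) (h : k ≤ n), IsReducedDensity h (ϱ n) (red n k)) ∧
    StrictMono sub ∧
    ∀ (k : ℕ) (K : HTensor H k →L[ℂ] HTensor H k), IsCompactOperator K →
      Tendsto (fun i => trace ((red (sub i) k).op ∘L K)) atTop (𝓝 (trace ((γ k).op ∘L K)))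

/-- The set `𝓜(H)` of Borel probability measures concentrated on the closed unit ball of `H` and
invariant under `x ↦ e^{iθ} x`. -/
def IsInvariantMeasure [MeasurableSpace H] (μ : Measure H) : Prop :=
  IsProbabilityMeasure μ ∧ μ (Metric.closedBall 0 1) = 1 ∧
    ∀ θ : ℝ, μ.map (fun x => Complex.exp (θ * Complex.I) • x) = μ

/-- `x^{⊗k}` -/
def tpow (k : ℕ) (x : H) : HTensor H k := tensorVec k fun _ => x

/-- `μ` is the de Finetti measure of the hierarchy `γ`: `μ ∈ 𝓜(H)` and
`γ^{(k)} = ∫_{‖x‖ ≤ 1} |x^{⊗k}⟩⟨x^{⊗k}| dμ(x)` for all `k`. -/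
def IsDeFinettiMeasure [MeasurableSpace H] (γ : (k : ℕ) → TraceClass (HTensor H k))
    (μ : Measure H) : Prop :=
  IsInvariantMeasure μ ∧
    ∀ k, γ k = ∫ x in Metric.closedBall 0 1, ketbra (tpow k x) (tpow k x) ∂μ

end SymmetricHierarchies

/-! ### The scale of Hilbert spaces of a positive self-adjoint operator -/

section Scale

variable (H : Type u) [NormedAddCommGroup H] [InnerProductSpace ℂ H] [CompleteSpace H]

/-- A (possibly unbounded) self-adjoint operator `A` on `H` with `A ≥ c` for some `c > 0`. -/
structure PosOp where
  toPMap : H →ₗ.[ℂ] H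
  selfAdjoint : IsSelfAdjoint toPMap
  bounded_below : ∃ c : ℝ, 0 < c ∧ ∀ x : toPMap.domain, c * ‖x‖ ^ 2 ≤ (⟪(x : H), toPMap x⟫_ℂ).re

variable {H}

namespace PosOp

variable (A : PosOp H)

theorem symmetric (x y : A.toPMap.domain) : ⟪A.toPMap x, (y : H)⟫_ℂ = ⟪(x : H), A.toPMap y⟫_ℂ := by
  have h := LinearPMap.adjoint_isFormalAdjoint A.selfAdjoint.dense_domain
  rw [LinearPMap.isSelfAdjoint_def.1 A.selfAdjoint] at h
  exact h x y

theorem exists_norm_le : ∃ C : ℝ, 0 < C ∧ ∀ x : A.toPMap.domain, ‖x‖ ≤ C * ‖A.toPMap x‖ := by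
  obtain ⟨c, hc, h⟩ := A.bounded_below
  refine ⟨c⁻¹, inv_pos.2 hc, fun x => ?_⟩
  rw [inv_mul_eq_div, le_div_iff₀ hc]
  by_cases hx : ‖x‖ = 0
  · rw [hx, zero_mul]; positivity
  have h0 : 0 < ‖x‖ := lt_of_le_of_ne (norm_nonneg _) (Ne.symm hx)
  have h1 := (h x).trans ((Complex.re_le_norm _).trans (norm_inner_le_norm _ _))
  have h2 : ‖(x : H)‖ = ‖x‖ := rfl
  rw [h2] at h1
  nlinarith

theorem bijective : Function.Bijective A.toPMap.toFun := by
  obtain ⟨C, hC, h⟩ := A.exists_norm_le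
  constructor
  · rw [injective_iff_map_eq_zero]
    intro x hx
    have h1 := h x
    have h2 : A.toPMap x = 0 := hx
    rw [h2, norm_zero, mul_zero] at h1
    exact norm_le_zero_iff.1 h1
  · have hcl : IsClosed (LinearMap.range A.toPMap.toFun : Set H) := by
      have hg : IsClosed (A.toPMap.graph : Set (H × H)) := A.selfAdjoint.isClosed
      have : CompleteSpace A.toPMap.graph := hg.completeSpace_coe
      let f : A.toPMap.graph →L[ℂ] H :=
        (ContinuousLinearMap.snd ℂ H H).comp A.toPMap.graph.subtypeL
      have hf : AntilipschitzWith (Real.toNNReal (max C 1)) f := by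
        refine AddMonoidHomClass.antilipschitz_of_bound f fun p => ?_
        obtain ⟨x, hx1, hx2⟩ := (LinearPMap.mem_graph_iff _).1 p.2
        rw [Real.coe_toNNReal _ (le_max_of_le_right zero_le_one)]
        have hfp : f p = p.1.2 := rfl
        have hp : ‖p‖ = max ‖p.1.1‖ ‖p.1.2‖ := rfl
        rw [hfp, hp, ← hx1, ← hx2]
        refine max_le ((h x).trans ?_) ?_
        · exact mul_le_mul_of_nonneg_right (le_max_left _ _) (norm_nonneg _)
        · exact le_mul_of_one_le_left (norm_nonneg _) (le_max_right _ _)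
      have hr := hf.isClosed_range f.uniformContinuous
      convert hr using 1
      ext y
      constructor
      · rintro ⟨x, rfl⟩
        exact ⟨⟨(x, A.toPMap x), A.toPMap.mem_graph x⟩, rfl⟩
      · rintro ⟨p, rfl⟩
        obtain ⟨x, -, hx2⟩ := (LinearPMap.mem_graph_iff _).1 p.2
        exact ⟨x, hx2⟩
    rw [← LinearMap.range_eq_top]
    have : CompleteSpace (LinearMap.range A.toPMap.toFun) := hcl.completeSpace_coe
    rw [← Submodule.orthogonal_eq_bot_iff, eq_bot_iff]
    intro y hy
    have hy' : ∀ x : A.toPMap.domain, ⟪A.toPMap x, y⟫_ℂ = 0 := fun x => hy _ ⟨x, rfl⟩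
    have hd : y ∈ A.toPMap.domain := by
      have : y ∈ (A.toPMap.adjoint).domain :=
        LinearPMap.mem_adjoint_domain_of_exists y ⟨0, fun x => by
          rw [inner_zero_left, ← inner_conj_symm, hy' x, map_zero]⟩
      rwa [LinearPMap.isSelfAdjoint_def.1 A.selfAdjoint] at this
    have hAy : A.toPMap ⟨y, hd⟩ = 0 := by
      refine A.selfAdjoint.dense_domain.eq_zero_of_inner_right ℂ fun x hx => ?_
      rw [← A.symmetric ⟨x, hx⟩ ⟨y, hd⟩]
      exact hy' ⟨x, hx⟩
    have h1 := h ⟨y, hd⟩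
    rw [hAy, norm_zero, mul_zero] at h1
    have h2 : ‖y‖ ≤ 0 := h1
    simpa using norm_le_zero_iff.1 h2

/-- The bounded inverse `A⁻¹`. -/
def inv : H →L[ℂ] H :=
  LinearMap.mkContinuousOfExistsBound
    (A.toPMap.domain.subtype ∘ₗ (LinearEquiv.ofBijective A.toPMap.toFun A.bijective).symm) <| by
      obtain ⟨C, -, h⟩ := A.exists_norm_le
      refine ⟨C, fun y => ?_⟩
      obtain ⟨x, rfl⟩ := A.bijective.2 y
      have : (LinearEquiv.ofBijective A.toPMap.toFun A.bijective).symm (A.toPMap.toFun x) = x :=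
        (LinearEquiv.ofBijective A.toPMap.toFun A.bijective).symm_apply_apply x
      simp only [LinearMap.comp_apply, LinearEquiv.coe_coe, this]
      exact h x

theorem inv_apply (x : A.toPMap.domain) : A.inv (A.toPMap x) = x :=
  congrArg Subtype.val
    ((LinearEquiv.ofBijective A.toPMap.toFun A.bijective).symm_apply_apply x)

theorem inv_nonneg : 0 ≤ A.inv := by
  rw [ContinuousLinearMap.nonneg_iff_isPositive, ContinuousLinearMap.isPositive_def]
  constructor
  · intro y z
    obtain ⟨x, rfl⟩ := A.bijective.2 y
    obtain ⟨w, rfl⟩ := A.bijective.2 z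
    have hx : A.inv (A.toPMap.toFun x) = x := A.inv_apply x
    have hw : A.inv (A.toPMap.toFun w) = w := A.inv_apply w
    show ⟪A.inv (A.toPMap.toFun x), _⟫_ℂ = ⟪_, A.inv (A.toPMap.toFun w)⟫_ℂ
    rw [hx, hw]
    exact (A.symmetric x w).symm
  · intro y
    obtain ⟨x, rfl⟩ := A.bijective.2 y
    have hx : A.inv (A.toPMap.toFun x) = x := A.inv_apply x
    obtain ⟨c, hc, h⟩ := A.bounded_below
    rw [ContinuousLinearMap.reApplyInnerSelf_apply, hx]
    exact le_trans (by positivity) (h x)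

/-- The bounded operator `A^{-r} = (A⁻¹)^r` for `r ≥ 0`, by continuous functional calculus. For
`r > 0` the unbounded operator `A^r` is the inverse of `A^{-r}`; in particular its domain is the
range of `A^{-r}`. -/
def negPow (r : ℝ) : H →L[ℂ] H := A.inv ^ r

theorem negPow_zero : A.negPow 0 = ContinuousLinearMap.id ℂ H :=
  CFC.rpow_zero A.inv A.inv_nonneg

theorem negPow_one : A.negPow 1 = A.inv := CFC.rpow_one A.inv A.inv_nonneg

theorem negPow_add {r q : ℝ} (hr : 0 ≤ r) (hq : 0 ≤ q) :
    A.negPow (r + q) = A.negPow r * A.negPow q := by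
  rcases hr.eq_or_lt with rfl | hr
  · rw [zero_add, negPow_zero]; rfl
  rcases hq.eq_or_lt with rfl | hq
  · rw [add_zero, negPow_zero]; rfl
  lift r to NNReal using hr.le
  lift q to NNReal using hq.le
  have hr' : 0 < r := hr
  have hq' : 0 < q := hq
  have := CFC.nnrpow_add (a := A.inv) hr' hq'
  rw [CFC.nnrpow_eq_rpow hr', CFC.nnrpow_eq_rpow hq', CFC.nnrpow_eq_rpow (add_pos hr' hq')] at this
  exact_mod_cast this

theorem inv_injective : Function.Injective A.inv := by
  intro y z h
  obtain ⟨x, rfl⟩ := A.bijective.2 y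
  obtain ⟨w, rfl⟩ := A.bijective.2 z
  have hx : A.inv (A.toPMap.toFun x) = x := A.inv_apply x
  have hw : A.inv (A.toPMap.toFun w) = w := A.inv_apply w
  rw [hx, hw] at h
  rw [Subtype.ext h]

theorem negPow_injective {r : ℝ} (hr : 0 ≤ r) : Function.Injective (A.negPow r) := by
  obtain ⟨n, hn⟩ := exists_nat_ge r
  have h1 : Function.Injective (A.negPow n) := by
    rw [negPow, CFC.rpow_natCast A.inv n A.inv_nonneg, FunLike.coe_pow_eq_iterate]
    exact A.inv_injective.iterate n
  have h2 : A.negPow n = A.negPow (n - r) * A.negPow r := by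
    rw [← A.negPow_add (sub_nonneg.2 hn) hr, sub_add_cancel]
  rw [h2] at h1
  exact Function.Injective.of_comp (f := A.negPow (n - r)) h1

theorem negPow_isSelfAdjoint (r : ℝ) : IsSelfAdjoint (A.negPow r) :=
  IsSelfAdjoint.of_nonneg CFC.rpow_nonneg

theorem negPow_denseRange {r : ℝ} (hr : 0 ≤ r) : DenseRange (A.negPow r) := by
  have h : (LinearMap.range (A.negPow r).toLinearMap).topologicalClosure = ⊤ := by
    rw [Submodule.topologicalClosure_eq_top_iff, eq_bot_iff]
    intro y hy
    have h0 : A.negPow r y = 0 := by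
      refine ext_inner_left ℂ fun z => ?_
      rw [inner_zero_right, ← ContinuousLinearMap.adjoint_inner_left,
        ContinuousLinearMap.isSelfAdjoint_iff'.1 (A.negPow_isSelfAdjoint r)]
      exact hy _ ⟨z, rfl⟩
    simpa using A.negPow_injective hr (h0.trans (map_zero _).symm)
  exact Submodule.dense_iff_topologicalClosure_eq_top.2 h

end PosOp

/-- The Hilbert space `𝒵_τ`, `τ ∈ ℝ`: the completion of `D(A^{τ/2})` for
`⟨x, y⟩_τ = ⟨A^{τ/2} x, A^{τ/2} y⟩`. The operator `A^{τ/2}` extends to a unitary map from this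
completion onto `H = 𝒵_0`, by means of which `𝒵_τ` is realised as a copy of `H`: an element
is stored as its image `A^{τ/2} x ∈ H`, which is `Z.coord x`. -/
def Z (_A : PosOp H) (_τ : ℝ) : Type u := H

section Z

variable (A : PosOp H) (τ : ℝ)

instance : NormedAddCommGroup (Z A τ) := inferInstanceAs (NormedAddCommGroup H)

instance : InnerProductSpace ℂ (Z A τ) := inferInstanceAs (InnerProductSpace ℂ H)

instance : CompleteSpace (Z A τ) := inferInstanceAs (CompleteSpace H)

instance : MeasurableSpace (Z A τ) := borel _

instance : BorelSpace (Z A τ) := ⟨rfl⟩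

/-- The unitary map `A^{τ/2} : 𝒵_τ → H`. -/
def Z.coord : Z A τ ≃ₗᵢ[ℂ] H := LinearIsometryEquiv.refl ℂ H

/-- For `s ≥ 0`, the embedding `𝒵_s ↪ H = 𝒵_0`; its range is `D(A^{s/2})`. -/
def Z.toH (s : ℝ) : Z A s →L[ℂ] H :=
  (A.negPow (s / 2)).comp (Z.coord A s).toContinuousLinearEquiv.toContinuousLinearMap

/-- For `σ ≥ 0`, the embedding `H = 𝒵_0 ↪ 𝒵_{-σ}`. -/
def Z.ofH (σ : ℝ) : H →L[ℂ] Z A (-σ) :=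
  (Z.coord A (-σ)).symm.toContinuousLinearEquiv.toContinuousLinearMap.comp (A.negPow (σ / 2))

/-- For `s, σ ≥ 0`, the embedding `𝒵_s ↪ 𝒵_{-σ}`. -/
def Z.emb (s σ : ℝ) : Z A s →L[ℂ] Z A (-σ) := (Z.ofH A σ).comp (Z.toH A s)

theorem Z.toH_injective {s : ℝ} (hs : 0 ≤ s) : Function.Injective (Z.toH A s) :=
  (A.negPow_injective (by positivity)).comp (Z.coord A s).injective

theorem Z.range_toH (s : ℝ) : range (Z.toH A s) = range (A.negPow (s / 2)) :=
  (Z.coord A s).surjective.range_comp _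

theorem Z.denseRange_toH {s : ℝ} (hs : 0 ≤ s) : DenseRange (Z.toH A s) := by
  rw [DenseRange, Z.range_toH]
  exact A.negPow_denseRange (by positivity)

/-- On `H = D(A^{-σ/2})` the norm of `𝒵_{-σ}` is `‖A^{-σ/2} x‖`. -/
theorem Z.norm_ofH (σ : ℝ) (x : H) : ‖Z.ofH A σ x‖ = ‖A.negPow (σ / 2) x‖ :=
  (Z.coord A (-σ)).symm.norm_map _

theorem Z.denseRange_ofH {σ : ℝ} (hσ : 0 ≤ σ) : DenseRange (Z.ofH A σ) :=
  (Z.coord A (-σ)).symm.surjective.denseRange.comp (A.negPow_denseRange (by positivity))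
    (Z.coord A (-σ)).symm.continuous

end Z

end Scale

/-! ### The initial value problem -/

section InitialValueProblem

variable {H : Type u} [NormedAddCommGroup H] [InnerProductSpace ℂ H] [CompleteSpace H]

/-- The vector field `v : ℝ × 𝒵_s → 𝒵_{-σ}` is Borel, bounded on bounded sets and
`U(1)`-invariant. -/
structure IsAdmissibleField {A : PosOp H} {s σ : ℝ} (v : ℝ → Z A s → Z A (-σ)) : Prop where
  borel : Measurable fun p : ℝ × Z A s => v p.1 p.2
  bounded : ∀ S : Set (ℝ × Z A s), Bornology.IsBounded S →
    Bornology.IsBounded ((fun p : ℝ × Z A s => v p.1 p.2) '' S)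
  invariant : ∀ (t θ : ℝ) (x : Z A s),
    v t (Complex.exp (θ * Complex.I) • x) = Complex.exp (θ * Complex.I) • v t x

/-- `g` is the distributional derivative of `w` on the open interval `(a, b)`. -/
def IsDistribDeriv {F : Type u} [NormedAddCommGroup F] [NormedSpace ℝ F] (a b : ℝ)
    (w g : ℝ → F) : Prop :=
  ∀ χ : ℝ → ℝ, ContDiff ℝ (⊤ : ℕ∞) χ → HasCompactSupport χ → tsupport χ ⊆ Ioo a b →
    ∫ t in Ioo a b, deriv χ t • w t = - ∫ t in Ioo a b, χ t • g t

/-- `u` is a weak solution over `I = (a, b)` of `u' = v(t, u)`, `u(t₀) = x`: it is in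
`L^∞(I, 𝒵_s) ∩ W^{1,∞}(I, 𝒵_{-σ})`, its distributional derivative is `v(t, u(t))` for a.e. `t`,
and `u(t₀) = x`. As an element of `W^{1,∞}(I, 𝒵_{-σ})`, `u` is identified with its continuous
representative. -/
structure IsWeakSolution {A : PosOp H} {s σ : ℝ} (v : ℝ → Z A s → Z A (-σ)) (a b t₀ : ℝ) (x : Z A s)
    (u : ℝ → Z A s) : Prop where
  memLp : MemLp u ∞ (volume.restrict (Ioo a b))
  memLp_emb : MemLp (fun t => Z.emb A s σ (u t)) ∞ (volume.restrict (Ioo a b))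
  continuousOn : ContinuousOn (fun t => Z.emb A s σ (u t)) (Ioo a b)
  deriv : ∃ g : ℝ → Z A (-σ), MemLp g ∞ (volume.restrict (Ioo a b)) ∧
    IsDistribDeriv a b (fun t => Z.emb A s σ (u t)) g ∧
    ∀ᵐ t ∂(volume.restrict (Ioo a b)), g t = v t (u t)
  initial : u t₀ = x

end InitialValueProblem

/-! ### The hierarchy equation -/

section HierarchyEquation

variable {H : Type u} [NormedAddCommGroup H] [InnerProductSpace ℂ H] [CompleteSpace H]

/-- The operator `(A^{-σ/2})^{⊗k} T (A^{-σ/2})^{⊗k}` on `⊗^k H`. -/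
def weighted (A : PosOp H) (σ : ℝ) {k : ℕ} (T : HTensor H k →L[ℂ] HTensor H k) :
    HTensor H k →L[ℂ] HTensor H k :=
  opPow (A.negPow (σ / 2)) k ∘L T ∘L opPow (A.negPow (σ / 2)) k

/-- `‖(A^{s/2})^{⊗k} T (A^{s/2})^{⊗k}‖_{𝓛¹} ≤ C`, where `(A^{s/2})^{⊗k}` is the inverse of
the injective bounded operator `(A^{-s/2})^{⊗k}`. -/
def RegularityBound (A : PosOp H) (s : ℝ) {k : ℕ} (T : TraceClass (HTensor H k)) (C : ℝ) : Prop :=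
  ∃ S : TraceClass (HTensor H k), T.op = weighted A s S.op ∧ ‖S‖ ≤ C

/-- The vector `x^{⊗(j-1)} ⊗ v ⊗ x^{⊗(k-j)}` of `⊗^k 𝒵_{-σ}` for `x ∈ 𝒵_s`, `v ∈ 𝒵_{-σ}`, after
application of the unitary map `(A^{-σ/2})^{⊗k} : ⊗^k 𝒵_{-σ} → ⊗^k H`. -/
def slotTensor {A : PosOp H} {s σ : ℝ} {k : ℕ} (j : Fin k) (x : Z A s) (v : Z A (-σ)) :
    HTensor H k :=
  tensorVec k (Function.update (fun _ => Z.coord A (-σ) (Z.emb A s σ x)) j (Z.coord A (-σ) v))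

/-- The vector `x^{⊗k}` of `⊗^k 𝒵_{-σ}` for `x ∈ 𝒵_s`, after application of the unitary map
`(A^{-σ/2})^{⊗k} : ⊗^k 𝒵_{-σ} → ⊗^k H`. -/
def slotPow (A : PosOp H) (s σ : ℝ) (k : ℕ) (x : Z A s) : HTensor H k :=
  tpow k (Z.coord A (-σ) (Z.emb A s σ x))

/-- The integrand of `C⁺_{j,k}`, as the trace class operator
`(A^{-σ/2})^{⊗k} |x^{⊗k}⟩⟨x^{⊗(j-1)} ⊗ v(t,x) ⊗ x^{⊗(k-j)}| (A^{-σ/2})^{⊗k}`. -/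
def cPlusIntegrand {A : PosOp H} {s σ : ℝ} (v : ℝ → Z A s → Z A (-σ)) (t : ℝ) {k : ℕ} (j : Fin k)
    (x : Z A s) : TraceClass (HTensor H k) :=
  ketbra (slotPow A s σ k x) (slotTensor j x (v t x))

/-- The integrand of `C⁻_{j,k}`, as the trace class operator
`(A^{-σ/2})^{⊗k} |x^{⊗(j-1)} ⊗ v(t,x) ⊗ x^{⊗(k-j)}⟩⟨x^{⊗k}| (A^{-σ/2})^{⊗k}`. -/
def cMinusIntegrand {A : PosOp H} {s σ : ℝ} (v : ℝ → Z A s → Z A (-σ)) (t : ℝ) {k : ℕ} (j : Fin k)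
    (x : Z A s) : TraceClass (HTensor H k) :=
  ketbra (slotTensor j x (v t x)) (slotPow A s σ k x)

variable [MeasurableSpace H]

/-- The restriction to `𝒵_s ∩ {‖x‖_{𝒵_0} ≤ 1}` of a Borel measure on `H = 𝒵_0`, as a measure on
`𝒵_s`. -/
def restrictToZ (A : PosOp H) (s : ℝ) (μ : Measure H) : Measure (Z A s) :=
  (μ.comap (Z.toH A s)).restrict {x | ‖Z.toH A s x‖ ≤ 1}

/-- `(A^{-σ/2})^{⊗k} (C⁺_{j,k} γ) (A^{-σ/2})^{⊗k}` at time `t`, where `μ` is the de Finetti measure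
of `γ`; the Bochner integral defining `C⁺_{j,k} γ` in `𝓛¹_{-σ}` is thereby taken in `𝓛¹(⊗^k H)`. -/
def cPlus {A : PosOp H} {s σ : ℝ} (v : ℝ → Z A s → Z A (-σ)) (μ : Measure H) (t : ℝ) {k : ℕ}
    (j : Fin k) : TraceClass (HTensor H k) :=
  ∫ x, cPlusIntegrand v t j x ∂(restrictToZ A s μ)

/-- `(A^{-σ/2})^{⊗k} (C⁻_{j,k} γ) (A^{-σ/2})^{⊗k}` at time `t`, where `μ` is the de Finetti measure
of `γ`. -/
def cMinus {A : PosOp H} {s σ : ℝ} (v : ℝ → Z A s → Z A (-σ)) (μ : Measure H) (t : ℝ) {k : ℕ}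
    (j : Fin k) : TraceClass (HTensor H k) :=
  ∫ x, cMinusIntegrand v t j x ∂(restrictToZ A s μ)

/-- The curve `t ↦ γ_t`, `t ∈ I = (a, b)`, solves the hierarchy equation
`γ_t^{(k)} = γ_{t₀}^{(k)} + ∫_{t₀}^t ∑_j (C⁺_{j,k} γ_τ + C⁻_{j,k} γ_τ) dτ` for all `t ∈ I` and all `k`.
All integrals are Bochner integrals in `𝓛¹_{-σ}`; this space is identified with `𝓛¹(⊗^k H)` by the
isometry `T ↦ (A^{-σ/2})^{⊗k} T (A^{-σ/2})^{⊗k}`. -/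
def SolvesHierarchy {A : PosOp H} {s σ : ℝ} (v : ℝ → Z A s → Z A (-σ)) (a b t₀ : ℝ)
    (γ : ℝ → (k : ℕ) → TraceClass (HTensor H k)) : Prop :=
  ∃ μ : ℝ → Measure H,
    (∀ t ∈ Ioo a b, IsDeFinettiMeasure (γ t) (μ t)) ∧
    (∀ t ∈ Ioo a b, ∀ (k : ℕ) (j : Fin k),
      Integrable (cPlusIntegrand v t j) (restrictToZ A s (μ t)) ∧
      Integrable (cMinusIntegrand v t j) (restrictToZ A s (μ t))) ∧
    (∀ (k : ℕ) (j : Fin k),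
      IntegrableOn (fun t => cPlus v (μ t) t j) (Ioo a b) ∧
      IntegrableOn (fun t => cMinus v (μ t) t j) (Ioo a b)) ∧
    ∀ t ∈ Ioo a b, ∀ k : ℕ,
      weighted A σ (γ t k).op = weighted A σ (γ t₀ k).op +
        (∫ τ in t₀..t, ∑ j : Fin k, (cPlus v (μ τ) τ j + cMinus v (μ τ) τ j)).op

/-- The regularity assumption on curves of symmetric hierarchies over `I = (a, b)`. -/
structure IsRegularCurve (A : PosOp H) (s σ a b : ℝ)
    (γ : ℝ → (k : ℕ) → TraceClass (HTensor H k)) : Prop where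
  hierarchy : ∀ t ∈ Ioo a b, IsSymmetricHierarchy (γ t)
  bound : ∃ R : ℝ, 0 < R ∧ ∀ t ∈ Ioo a b, ∀ k : ℕ, RegularityBound A s (γ t k) (R ^ (2 * k))
  continuous : ∀ (k : ℕ) (K : HTensor H k →L[ℂ] HTensor H k), IsCompactOperator K →
    ContinuousOn (fun t => trace (weighted A σ (γ t k).op ∘L K)) (Ioo a b)

end HierarchyEquation

end Hierarchy

end

open Hierarchy

/-! The curve is a superposition of trajectories: γ_t is the mixture of |x^{⊗k}⟩⟨x^{⊗k}| under the
law of φ(t,x), with x distributed by ν. Everything follows from statements about single trajectories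
integrated over ν, once ν is known to have bounded support.

Support. The diagonal entry of γ^{(k)} at u^{⊗k} is the 2k-th absolute moment of ⟨u,x⟩. Bounds on
all these moments with a fixed base bound |⟨u,x⟩| almost surely, by Markov's inequality as k → ∞.
Limits of reduced density matrices have quadratic forms at most ‖·‖², so ν lives in the unit ball of
𝒵_0; the regularity bound puts it in the ball of radius R of 𝒵_s (`ae_norm_le_of_moments`). Since φ
is bounded on bounded sets, almost all trajectories stay in one ball of 𝒵_s, and v is bounded along
them.

Membership in 𝓗(𝒵_0). A vector of the unit ball of an infinite-dimensional space is a weak limit of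
unit vectors x + c_n e_n. Mixtures of the product states of these unit vectors have the required
reduced densities, and compact test operators see only the weak limit
(`isSymmetricHierarchy_of_measure`). In finite dimension trace is not lost in the limit, so ν lives
on the unit sphere, and norm conservation keeps the flow there.

Equation. A weak solution satisfies the integral equation in 𝒵_{-σ}
(`IsDistribDeriv.sub_eq_integral`), hence is Lipschitz there. The chain rule for x ↦
|x^{⊗k}⟩⟨x^{⊗k}| gives the integrated hierarchy equation along each trajectory
(`ketbra_slotPow_sub_eq_integral`), and Fubini integrates it over ν
(`solvesHierarchy_pushHierarchy`). A de Finetti measure must be U(1)-invariant, which the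
push-forward of ν need not be. Averaging it over phases repairs this without changing any integral,
because all integrands are phase invariant. -/

noncomputable section

namespace Hierarchy

universe u

/-! ### Rank-one operators, their mixtures, and traces. -/

section TraceClassLemmas

variable {E : Type u} [NormedAddCommGroup E] [InnerProductSpace ℂ E]

/-- The inclusion of the trace class operators into the bounded operators. -/
def TraceClass.opL : TraceClass E →L[ℂ] (E →L[ℂ] E) :=
  LinearMap.mkContinuous TraceClass.op 1 fun T => by
    simpa using T.norm_op_le

theorem TraceClass.op_integral_apply [CompleteSpace E] {X : Type*} [MeasurableSpace X]
    {μ : Measure X} {F : X → TraceClass E} (hF : Integrable F μ) (z : E) :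
    (∫ x, F x ∂μ).op z = ∫ x, (F x).op z ∂μ :=
  (((ContinuousLinearMap.apply ℂ E z).comp TraceClass.opL).integral_comp_comm hF).symm

theorem norm_ketbra_le (x y : E) : ‖ketbra x y‖ ≤ ‖x‖ * ‖y‖ := by
  rw [TraceClass.norm_def]
  exact ENNReal.toReal_le_of_le_ofReal (by positivity) (traceNorm_rankOne_le x y)

theorem ketbra_add_left (x x' y : E) : ketbra (x + x') y = ketbra x y + ketbra x' y := by
  apply TraceClass.op_injective
  ext z
  simp [op_ketbra_apply, smul_add]

theorem ketbra_add_right (x y y' : E) : ketbra x (y + y') = ketbra x y + ketbra x y' := by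
  apply TraceClass.op_injective
  ext z
  simp [op_ketbra_apply, add_smul]

theorem ketbra_smul_left (c : ℂ) (x y : E) : ketbra (c • x) y = c • ketbra x y := by
  apply TraceClass.op_injective
  ext z
  simp [op_ketbra_apply, smul_comm c]

theorem ketbra_smul_right (c : ℂ) (x y : E) :
    ketbra x (c • y) = (starRingEnd ℂ c) • ketbra x y := by
  apply TraceClass.op_injective
  ext z
  simp only [op_ketbra_apply, inner_smul_left, mul_smul, map_smul, smul_apply]

theorem ketbra_sum_left {ι : Type*} (s : Finset ι) (f : ι → E) (y : E) :
    ketbra (∑ i ∈ s, f i) y = ∑ i ∈ s, ketbra (f i) y := by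
  classical
  induction s using Finset.induction_on with
  | empty => simpa using ketbra_smul_left 0 (0 : E) y
  | insert i s hi ih => rw [Finset.sum_insert hi, Finset.sum_insert hi, ketbra_add_left, ih]

theorem ketbra_sum_right {ι : Type*} (s : Finset ι) (x : E) (f : ι → E) :
    ketbra x (∑ i ∈ s, f i) = ∑ i ∈ s, ketbra x (f i) := by
  classical
  induction s using Finset.induction_on with
  | empty => simpa using ketbra_smul_right 0 x (0 : E)
  | insert i s hi ih => rw [Finset.sum_insert hi, Finset.sum_insert hi, ketbra_add_right, ih]

theorem ketbra_unit_smul {c : ℂ} (hc : ‖c‖ = 1) (x y : E) :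
    ketbra (c • x) (c • y) = ketbra x y := by
  rw [ketbra_smul_left, ketbra_smul_right, smul_smul, Complex.mul_conj, Complex.normSq_eq_norm_sq,
    hc]
  simp

/-- The bra enters conjugate-linearly, so the map is bilinear over ℝ only; this is why derivatives
below are taken over real scalars. -/
theorem isBoundedBilinearMap_ketbra :
    IsBoundedBilinearMap ℝ (fun p : E × E => ketbra p.1 p.2) where
  add_left := ketbra_add_left
  smul_left c x y := ketbra_smul_left (c : ℂ) x y
  add_right := ketbra_add_right
  smul_right c x y := by
    have := ketbra_smul_right (c : ℂ) x y
    rwa [Complex.conj_ofReal] at this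
  bound := ⟨1, one_pos, fun x y => by simpa using norm_ketbra_le x y⟩

theorem continuous_ketbra : Continuous (fun p : E × E => ketbra p.1 p.2) :=
  isBoundedBilinearMap_ketbra.continuous

/-- `B |x⟩⟨y| B'` is `|B x⟩⟨B'* y|`. -/
theorem comp_ketbra_comp {B B' : E →L[ℂ] E} {x y y' : E} (h : ∀ z, ⟪y, B' z⟫_ℂ = ⟪y', z⟫_ℂ) :
    B ∘L (ketbra x y).op ∘L B' = (ketbra (B x) y').op := by
  ext z
  simp [op_ketbra_apply, h]

/-- Distinct members are at distance √2 > 1, so the balls of radius 1/2 around them are disjoint. -/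
theorem _root_.Orthonormal.countable [TopologicalSpace.SeparableSpace E] {ι : Type*} {e : ι → E}
    (he : Orthonormal ℂ e) : Countable ι := by
  refine Pairwise.countable_of_isOpen_disjoint (s := fun i => Metric.ball (e i) (1 / 2)) ?_
    (fun _ => Metric.isOpen_ball) fun i => ⟨e i, Metric.mem_ball_self (by norm_num)⟩
  intro i j hij
  refine Metric.ball_disjoint_ball ?_
  have h1 : ‖e i - e j‖ ^ 2 = 2 := by
    rw [@norm_sub_sq ℂ, he.1 i, he.1 j, he.2 hij]
    norm_num
  rw [dist_eq_norm]
  nlinarith [norm_nonneg (e i - e j)]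

theorem integrable_ketbra {X : Type*} [MeasurableSpace X] {μ : Measure X} [IsFiniteMeasure μ]
    {f g : X → E} (hf : AEStronglyMeasurable f μ) (hg : AEStronglyMeasurable g μ) {C D : ℝ}
    (hC : ∀ᵐ x ∂μ, ‖f x‖ ≤ C) (hD : ∀ᵐ x ∂μ, ‖g x‖ ≤ D) :
    Integrable (fun x => ketbra (f x) (g x)) μ := by
  have hm : AEStronglyMeasurable (fun x => ketbra (f x) (g x)) μ :=
    Continuous.comp_aestronglyMeasurable₂ (g := fun x y => ketbra x y) continuous_ketbra hf hg
  refine Integrable.of_bound hm (C * D) ?_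
  filter_upwards [hC, hD] with x h1 h2
  exact (norm_ketbra_le _ _).trans
    (mul_le_mul h1 h2 (norm_nonneg _) ((norm_nonneg _).trans h1))

/-- Parseval sums the diagonal entries pointwise. The sum is exchanged with the integral by
dominated convergence along finite subsets of the basis, with the bound ‖K‖C² from Cauchy–Schwarz
and Bessel. Countability of the basis makes the filter of finite subsets countably generated. -/
theorem trace_integral_ketbra_comp [CompleteSpace E] [TopologicalSpace.SeparableSpace E]
    {X : Type*} [MeasurableSpace X] {μ : Measure X} [IsFiniteMeasure μ] {f : X → E}
    (hf : AEStronglyMeasurable f μ) {C : ℝ} (hC : ∀ᵐ x ∂μ, ‖f x‖ ≤ C) (K : E →L[ℂ] E) :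
    trace ((∫ x, ketbra (f x) (f x) ∂μ).op ∘L K) = ∫ x, ⟪f x, K (f x)⟫_ℂ ∂μ := by
  set b := (exists_hilbertBasis ℂ E).choose_spec.choose with hb
  have : Countable (exists_hilbertBasis ℂ E).choose := b.orthonormal.countable
  have hi := integrable_ketbra hf hf hC hC
  have hterm : ∀ i, ⟪b i, ((∫ x, ketbra (f x) (f x) ∂μ).op ∘L K) (b i)⟫_ℂ
      = ∫ x, ⟪ContinuousLinearMap.adjoint K (f x), b i⟫_ℂ * ⟪b i, f x⟫_ℂ ∂μ := by
    intro i
    rw [ContinuousLinearMap.comp_apply, TraceClass.op_integral_apply hi]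
    have h2 : Integrable (fun x => (ketbra (f x) (f x)).op (K (b i))) μ :=
      ((ContinuousLinearMap.apply ℂ E (K (b i))).comp TraceClass.opL).integrable_comp hi
    rw [← integral_inner h2]
    refine integral_congr_ae (Eventually.of_forall fun x => ?_)
    simp only [op_ketbra_apply, inner_smul_right, ContinuousLinearMap.adjoint_inner_left]
  have hsum : HasSum (fun i => ∫ x, ⟪ContinuousLinearMap.adjoint K (f x), b i⟫_ℂ * ⟪b i, f x⟫_ℂ ∂μ)
      (∫ x, ⟪f x, K (f x)⟫_ℂ ∂μ) := by
    have hmeas : ∀ i, AEStronglyMeasurable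
        (fun x => ⟪ContinuousLinearMap.adjoint K (f x), b i⟫_ℂ * ⟪b i, f x⟫_ℂ) μ := fun i =>
      (((ContinuousLinearMap.adjoint K).continuous.comp_aestronglyMeasurable hf).inner
        aestronglyMeasurable_const).mul (aestronglyMeasurable_const.inner hf)
    have hbd : ∀ x (s : Finset (exists_hilbertBasis ℂ E).choose), ‖f x‖ ≤ C →
        ∑ i ∈ s, ‖⟪ContinuousLinearMap.adjoint K (f x), b i⟫_ℂ * ⟪b i, f x⟫_ℂ‖
          ≤ ‖K‖ * C * C := by
      intro x s hx
      have hC0 : 0 ≤ C := (norm_nonneg _).trans hx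
      simp only [norm_mul]
      refine (Real.sum_mul_le_sqrt_mul_sqrt _ _ _).trans ?_
      refine mul_le_mul ?_ ?_ (Real.sqrt_nonneg _) (by positivity)
      · refine ((Real.sqrt_le_left (norm_nonneg (ContinuousLinearMap.adjoint K (f x)))).2 ?_).trans ?_
        · rw [Finset.sum_congr rfl fun i _ => by
            rw [norm_inner_symm (ContinuousLinearMap.adjoint K (f x)) (b i)]]
          exact b.orthonormal.sum_inner_products_le _
        · refine (ContinuousLinearMap.le_opNorm _ _).trans ?_
          rw [LinearIsometryEquiv.norm_map]
          gcongr
      · exact ((Real.sqrt_le_left (norm_nonneg _)).2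
          (b.orthonormal.sum_inner_products_le _)).trans hx
    have hint : ∀ i, Integrable
        (fun x => ⟪ContinuousLinearMap.adjoint K (f x), b i⟫_ℂ * ⟪b i, f x⟫_ℂ) μ := fun i =>
      Integrable.of_bound (hmeas i) (‖K‖ * C * C) <| by
        filter_upwards [hC] with x hx
        simpa using hbd x {i} hx
    rw [HasSum, SummationFilter.unconditional_filter]
    have := tendsto_integral_filter_of_dominated_convergence (μ := μ)
      (l := (atTop : Filter (Finset (exists_hilbertBasis ℂ E).choose)))
      (F := fun s x => ∑ i ∈ s, ⟪ContinuousLinearMap.adjoint K (f x), b i⟫_ℂ * ⟪b i, f x⟫_ℂ)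
      (f := fun x => ⟪f x, K (f x)⟫_ℂ) (fun _ => ‖K‖ * C * C)
      (Eventually.of_forall fun s => Finset.aestronglyMeasurable_fun_sum s fun i _ => hmeas i)
      (Eventually.of_forall fun s => by
        filter_upwards [hC] with x hx
        exact (norm_sum_le _ _).trans (hbd x s hx))
      (integrable_const _)
      (Eventually.of_forall fun x => by
        rw [← ContinuousLinearMap.adjoint_inner_left]
        exact b.hasSum_inner_mul_inner _ _)
    refine this.congr fun s => ?_
    rw [integral_finsetSum _ fun i _ => hint i]
  rw [trace, ← hsum.tsum_eq]
  exact tsum_congr hterm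

theorem trace_comp_ketbra [CompleteSpace E] (T : E →L[ℂ] E) (x y : E) :
    trace (T ∘L (ketbra x y).op) = ⟪y, T x⟫_ℂ := by
  rw [trace, ← HilbertBasis.tsum_inner_mul_inner (exists_hilbertBasis ℂ E).choose_spec.choose]
  refine tsum_congr fun i => ?_
  rw [ContinuousLinearMap.comp_apply, op_ketbra_apply, map_smul, inner_smul_right]

/-- A positive operator of trace one is a contraction in the sense of quadratic forms. -/
theorem norm_inner_le_of_trace_eq_one [CompleteSpace E] {T : E →L[ℂ] E} (hT : T.IsPositive)
    (h : trace T = 1) (x : E) : ‖⟪x, T x⟫_ℂ‖ ≤ ‖x‖ ^ 2 := by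
  set b := (exists_hilbertBasis ℂ E).choose_spec.choose with hb
  -- With B = √T: ⟨x,Tx⟩ = ‖Bx‖² = ∑|⟨B bᵢ,x⟩|² ≤ ‖x‖² ∑‖B bᵢ‖² = ‖x‖² Tr T.
  set B := CFC.sqrt T
  have hT0 : 0 ≤ T := (ContinuousLinearMap.nonneg_iff_isPositive T).2 hT
  have hBB : B * B = T := CFC.sqrt_mul_sqrt_self T hT0
  have hadj : ∀ y z, ⟪B y, z⟫_ℂ = ⟪y, B z⟫_ℂ := fun y z => by
    have hsa : IsSelfAdjoint B := IsSelfAdjoint.of_nonneg (CFC.sqrt_nonneg T)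
    rw [← ContinuousLinearMap.adjoint_inner_right, ContinuousLinearMap.isSelfAdjoint_iff'.1 hsa]
  have hq : ∀ y, ⟪y, T y⟫_ℂ = ((‖B y‖ ^ 2 : ℝ) : ℂ) := fun y => by
    rw [← hBB, mul_apply_eq_comp, ← hadj, inner_self_eq_norm_sq_to_K]
    norm_cast
  have hs : HasSum (fun i => ((‖B (b i)‖ ^ 2 : ℝ) : ℂ)) ((1 : ℝ) : ℂ) := by
    have h1 : ∑' i, ⟪b i, T (b i)⟫_ℂ = 1 := h
    -- A non-summable family has sum 0 by convention, so trace one already forces summability.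
    have h2 : Summable fun i => ⟪b i, T (b i)⟫_ℂ := by
      by_contra hns
      rw [tsum_eq_zero_of_not_summable hns] at h1
      exact zero_ne_one h1
    have h3 := h2.hasSum
    rw [h1] at h3
    simpa [hq] using h3
  rw [Complex.hasSum_ofReal] at hs
  have hp : HasSum (fun i => ‖⟪b i, B x⟫_ℂ‖ ^ 2) (‖B x‖ ^ 2) := by
    have h3 := b.hasSum_inner_mul_inner (B x) (B x)
    rw [inner_self_eq_norm_sq_to_K] at h3
    rw [← Complex.hasSum_ofReal]
    have h4 : (fun i => ((‖⟪b i, B x⟫_ℂ‖ ^ 2 : ℝ) : ℂ))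
        = fun i => ⟪B x, b i⟫_ℂ * ⟪b i, B x⟫_ℂ := by
      ext i
      rw [← inner_conj_symm (B x), ← Complex.normSq_eq_conj_mul_self, Complex.normSq_eq_norm_sq]
    rw [h4]
    exact_mod_cast h3
  rw [hq, Complex.norm_real, Real.norm_of_nonneg (by positivity), ← one_mul (‖x‖ ^ 2)]
  refine hasSum_le (fun i => ?_) hp (hs.mul_right (‖x‖ ^ 2))
  rw [← hadj, ← mul_pow]
  exact pow_le_pow_left₀ (norm_nonneg _) (norm_inner_le_norm _ _) 2

end TraceClassLemmas

/-! ### Bilinearity and totality in a completed tensor product. -/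

section Binary

variable {E F : Type u} [NormedAddCommGroup E] [InnerProductSpace ℂ E] [NormedAddCommGroup F]
  [InnerProductSpace ℂ F]

theorem completedTmul_add_left (x x' : E) (y : F) :
    completedTmul (x + x') y = completedTmul x y + completedTmul x' y := by
  rw [completedTmul, TensorProduct.add_tmul, UniformSpace.Completion.coe_add]
  rfl

theorem completedTmul_add_right (x : E) (y y' : F) :
    completedTmul x (y + y') = completedTmul x y + completedTmul x y' := by
  rw [completedTmul, TensorProduct.tmul_add, UniformSpace.Completion.coe_add]
  rfl

theorem completedTmul_smul_left (c : ℂ) (x : E) (y : F) :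
    completedTmul (c • x) y = c • completedTmul x y := by
  rw [completedTmul, ← TensorProduct.smul_tmul', UniformSpace.Completion.coe_smul]
  rfl

theorem completedTmul_smul_right (c : ℂ) (x : E) (y : F) :
    completedTmul x (c • y) = c • completedTmul x y := by
  rw [completedTmul, TensorProduct.tmul_smul, UniformSpace.Completion.coe_smul]
  rfl

theorem eq_zero_of_inner_completedTmul {ζ : UniformSpace.Completion (E ⊗[ℂ] F)}
    (h : ∀ x y, ⟪completedTmul x y, ζ⟫_ℂ = 0) : ζ = 0 := by
  have hz : ∀ z : E ⊗[ℂ] F, ⟪(z : UniformSpace.Completion (E ⊗[ℂ] F)), ζ⟫_ℂ = 0 := by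
    intro z
    induction z with
    | zero => rw [UniformSpace.Completion.coe_zero, inner_zero_left]
    | tmul x y => exact h x y
    | add z z' hz hz' => rw [UniformSpace.Completion.coe_add, inner_add_left, hz, hz', add_zero]
  have hall : ∀ ξ : UniformSpace.Completion (E ⊗[ℂ] F), ⟪ξ, ζ⟫_ℂ = 0 := fun ξ =>
    UniformSpace.Completion.induction_on ξ (isClosed_eq (by fun_prop) continuous_const) hz
  exact inner_self_eq_zero.1 (hall ζ)

end Binary

/-! ### Tensor powers: multilinearity, density of elementary tensors, symmetric vectors. -/

section TensorLemmas

variable {H : Type u} [NormedAddCommGroup H] [InnerProductSpace ℂ H]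

theorem tensorSnoc_add_left (k : ℕ) (ψ ψ' : HTensor H k) (y : H) :
    tensorSnoc k (ψ + ψ') y = tensorSnoc k ψ y + tensorSnoc k ψ' y :=
  completedTmul_add_left ψ ψ' y

theorem tensorSnoc_add_right (k : ℕ) (ψ : HTensor H k) (y y' : H) :
    tensorSnoc k ψ (y + y') = tensorSnoc k ψ y + tensorSnoc k ψ y' :=
  completedTmul_add_right ψ y y'

theorem tensorSnoc_smul_left (k : ℕ) (c : ℂ) (ψ : HTensor H k) (y : H) :
    tensorSnoc k (c • ψ) y = c • tensorSnoc k ψ y :=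
  completedTmul_smul_left c ψ y

theorem tensorSnoc_smul_right (k : ℕ) (c : ℂ) (ψ : HTensor H k) (y : H) :
    tensorSnoc k ψ (c • y) = c • tensorSnoc k ψ y :=
  completedTmul_smul_right c ψ y

theorem eq_zero_of_inner_tensorSnoc {k : ℕ} {ζ : HTensor H (k + 1)}
    (h : ∀ ψ y, ⟪tensorSnoc k ψ y, ζ⟫_ℂ = 0) : ζ = 0 :=
  eq_zero_of_inner_completedTmul (E := HTensor H k) (F := H) h

theorem dense_span_tensorSnoc (k : ℕ) :
    Dense (Submodule.span ℂ (range fun p : HTensor H k × H => tensorSnoc k p.1 p.2) :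
      Set (HTensor H (k + 1))) := by
  rw [Submodule.dense_iff_topologicalClosure_eq_top, Submodule.topologicalClosure_eq_top_iff,
    eq_bot_iff]
  intro ζ hζ
  exact eq_zero_of_inner_tensorSnoc fun ψ y => hζ _ (Submodule.subset_span ⟨(ψ, y), rfl⟩)

theorem norm_tensorSnoc (k : ℕ) (ψ : HTensor H k) (y : H) :
    ‖tensorSnoc k ψ y‖ = ‖ψ‖ * ‖y‖ := by
  have h : ((‖tensorSnoc k ψ y‖ ^ 2 : ℝ) : ℂ) = (((‖ψ‖ * ‖y‖) ^ 2 : ℝ) : ℂ) := by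
    have := inner_tensorSnoc k ψ ψ y y
    simp only [inner_self_eq_norm_sq_to_K] at this
    push_cast
    rw [mul_pow]
    exact this
  have h2 := Complex.ofReal_injective h
  exact (pow_left_inj₀ (norm_nonneg _) (by positivity) two_ne_zero).1 h2

theorem norm_tensorVec (k : ℕ) (x : Fin k → H) : ‖tensorVec k x‖ = ∏ i, ‖x i‖ := by
  induction k with
  | zero =>
    show ‖(EuclideanSpace.single PUnit.unit 1 : EuclideanSpace ℂ PUnit.{u + 1})‖ = _
    simp
  | succ k ih =>
    rw [tensorVec, norm_tensorSnoc, ih, Fin.prod_univ_castSucc]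
    rfl

theorem norm_tpow (k : ℕ) (x : H) : ‖tpow k x‖ = ‖x‖ ^ k := by
  simp [tpow, norm_tensorVec]

theorem inner_tpow (k : ℕ) (x y : H) : ⟪tpow k x, tpow k y⟫_ℂ = ⟪x, y⟫_ℂ ^ k := by
  simp [tpow, inner_tensorVec]

/-- `(x₁, …, x_k) ↦ x₁ ⊗ ⋯ ⊗ x_k` as a continuous multilinear map. -/
def tensorVecL (k : ℕ) : ContinuousMultilinearMap ℂ (fun _ : Fin k => H) (HTensor H k) :=
  MultilinearMap.mkContinuous
    { toFun := tensorVec k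
      map_update_add' := by
        intro hdec m i x y
        -- The structure field ranges over arbitrary decidability instances; the canonical one is
        -- needed for the lemmas on `Function.update`.
        obtain rfl : hdec = instDecidableEqFin k := Subsingleton.elim _ _
        induction k with
        | zero => exact i.elim0
        | succ k ih =>
          simp only [tensorVec]
          induction i using Fin.lastCases with
          | last => simp [Fin.init_update_last, tensorSnoc_add_right]
          | cast i => simp [Fin.init_update_castSucc, ih, tensorSnoc_add_left, i.castSucc_ne_last.symm]
      map_update_smul' := by
        intro hdec m i c x
        obtain rfl : hdec = instDecidableEqFin k := Subsingleton.elim _ _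
        induction k with
        | zero => exact i.elim0
        | succ k ih =>
          simp only [tensorVec]
          induction i using Fin.lastCases with
          | last => simp [Fin.init_update_last, tensorSnoc_smul_right]
          | cast i => simp [Fin.init_update_castSucc, ih, tensorSnoc_smul_left, i.castSucc_ne_last.symm] } 1
    fun m => by simpa using (norm_tensorVec k m).le

theorem tensorVecL_apply (k : ℕ) (x : Fin k → H) : tensorVecL k x = tensorVec k x := rfl

theorem continuous_tensorVec (k : ℕ) : Continuous (tensorVec (H := H) k) := (tensorVecL k).cont

theorem continuous_tpow (k : ℕ) : Continuous (tpow (H := H) k) :=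
  (continuous_tensorVec k).comp (continuous_pi fun _ => continuous_id)

theorem tpow_smul (k : ℕ) (c : ℂ) (x : H) : tpow k (c • x) = c ^ k • tpow k x := by
  have := (tensorVecL k).map_smul_univ (fun _ => c) (fun _ => x)
  rwa [Finset.prod_const, Finset.card_univ, Fintype.card_fin] at this

/-- Induction on k: for fixed y the map ψ ↦ ψ ⊗ y is continuous, so the closed span of elementary
tensors contains every ψ ⊗ y, and these are total. -/
theorem dense_span_tensorVec (k : ℕ) :
    Dense (Submodule.span ℂ (range (tensorVec (H := H) k)) : Set (HTensor H k)) := by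
  induction k with
  | zero =>
    have : Submodule.span ℂ (range (tensorVec (H := H) 0)) = ⊤ := by
      rw [eq_top_iff]
      rintro (ψ : EuclideanSpace ℂ PUnit.{u + 1}) -
      have : (ψ : HTensor H 0) = ψ PUnit.unit • tensorVec (H := H) 0 Fin.elim0 := by
        show ψ = ψ PUnit.unit •
          (EuclideanSpace.single PUnit.unit 1 : EuclideanSpace ℂ PUnit.{u + 1})
        ext i
        simp
      rw [this]
      exact Submodule.smul_mem _ _ (Submodule.subset_span ⟨_, rfl⟩)
    rw [this]
    exact dense_univ
  | succ k ih =>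
    set S := Submodule.span ℂ (range (tensorVec (H := H) (k + 1)))
    have h1 : ∀ (ψ : HTensor H k) (y : H), tensorSnoc k ψ y ∈ S.topologicalClosure := by
      intro ψ y
      let f : HTensor H k →L[ℂ] HTensor H (k + 1) :=
        LinearMap.mkContinuous
          { toFun := fun ψ => tensorSnoc k ψ y
            map_add' := fun _ _ => tensorSnoc_add_left k _ _ y
            map_smul' := fun c _ => tensorSnoc_smul_left k c _ y } ‖y‖
          fun ψ => by simp [norm_tensorSnoc, mul_comm]
      have hc : IsClosed (f ⁻¹' (S.topologicalClosure : Set (HTensor H (k + 1)))) :=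
        S.isClosed_topologicalClosure.preimage f.continuous
      have hsub : (Submodule.span ℂ (range (tensorVec (H := H) k)) : Set (HTensor H k)) ⊆
          f ⁻¹' (S.topologicalClosure : Set (HTensor H (k + 1))) := by
        show Submodule.span ℂ (range (tensorVec (H := H) k)) ≤
          S.topologicalClosure.comap f.toLinearMap
        rw [Submodule.span_le]
        rintro _ ⟨x, rfl⟩
        refine S.le_topologicalClosure (Submodule.subset_span ⟨Fin.snoc x y, ?_⟩)
        simp [tensorVec, f]
      have := hc.closure_subset_iff.2 hsub (ih ψ)
      exact this
    have h3 : Dense (S.topologicalClosure : Set (HTensor H (k + 1))) := by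
      refine (dense_span_tensorSnoc k).mono ?_
      rw [SetLike.coe_subset_coe, Submodule.span_le]
      rintro _ ⟨p, rfl⟩
      exact h1 p.1 p.2
    rw [Submodule.topologicalClosure_coe] at h3
    exact dense_closure.1 h3

theorem ext_tensorVec {k : ℕ} {F : Type*} [NormedAddCommGroup F] [NormedSpace ℂ F]
    {f g : HTensor H k →L[ℂ] F} (h : ∀ x, f (tensorVec k x) = g (tensorVec k x)) : f = g :=
  ContinuousLinearMap.ext_on (dense_span_tensorVec k) (by rintro _ ⟨x, rfl⟩; exact h x)

instance [TopologicalSpace.SeparableSpace H] (k : ℕ) :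
    TopologicalSpace.SeparableSpace (HTensor H k) := by
  rw [← TopologicalSpace.isSeparable_univ_iff, ← (dense_span_tensorVec (H := H) k).closure_eq]
  exact (TopologicalSpace.isSeparable_range (continuous_tensorVec k)).span.closure

/-- The image of the algebraic tensor product is dense, and closed because it is finite-dimensional;
completion therefore adds nothing. -/
instance [FiniteDimensional ℂ H] (k : ℕ) : FiniteDimensional ℂ (HTensor H k) := by
  induction k with
  | zero => exact inferInstanceAs (FiniteDimensional ℂ (EuclideanSpace ℂ PUnit.{u + 1}))
  | succ k ih =>
    let B : HTensor H k →ₗ[ℂ] H →ₗ[ℂ] HTensor H (k + 1) :=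
      LinearMap.mk₂ ℂ (tensorSnoc k) (tensorSnoc_add_left k) (tensorSnoc_smul_left k)
        (tensorSnoc_add_right k) (fun c ψ y => tensorSnoc_smul_right k c ψ y)
    have hcl := Submodule.closed_of_finiteDimensional (LinearMap.range (TensorProduct.lift B))
    have hd : Dense (LinearMap.range (TensorProduct.lift B) : Set (HTensor H (k + 1))) := by
      refine (dense_span_tensorSnoc k).mono ?_
      rw [SetLike.coe_subset_coe, Submodule.span_le]
      rintro _ ⟨p, rfl⟩
      exact ⟨p.1 ⊗ₜ p.2, TensorProduct.lift.tmul _ _⟩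
    have htop : LinearMap.range (TensorProduct.lift B) = ⊤ := by
      rw [← Submodule.coe_eq_univ]
      exact hcl.closure_eq.symm.trans hd.closure_eq
    exact Module.Finite.of_surjective _ (LinearMap.range_eq_top.1 htop)

theorem tpow_mem_symTensor (k : ℕ) (x : H) : tpow k x ∈ symTensor H k := by
  intro π y
  rw [tpow, inner_tensorVec, inner_tensorVec]
  exact Equiv.prod_comp π fun i => ⟪y i, x⟫_ℂ

theorem inner_opPow {T : H →L[ℂ] H} (hT : ∀ x y, ⟪T x, y⟫_ℂ = ⟪x, T y⟫_ℂ) (k : ℕ)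
    (x : Fin k → H) (ψ : HTensor H k) :
    ⟪tensorVec k x, opPow T k ψ⟫_ℂ = ⟪tensorVec k (fun i => T (x i)), ψ⟫_ℂ := by
  have h : (innerSL ℂ (tensorVec k x)).comp (opPow T k)
      = innerSL ℂ (tensorVec k (fun i => T (x i))) := by
    refine ext_tensorVec fun y => ?_
    simp [opPow_tensorVec, inner_tensorVec, hT]
  exact DFunLike.congr_fun h ψ

theorem tensorVec_castSucc_const (k : ℕ) (x : H) : tpow (k + 1) x = tensorSnoc k (tpow k x) x := rfl

/-- For a unit vector the extra factor is 1: the reduced density of a product state is the product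
state of the same vector. -/
theorem inner_ampliation_tpow {k n : ℕ} (h : k ≤ n) (S : HTensor H k →L[ℂ] HTensor H k) (x : H) :
    ⟪tpow n x, ampliation h S (tpow n x)⟫_ℂ
      = ⟪tpow k x, S (tpow k x)⟫_ℂ * ⟪x, x⟫_ℂ ^ (n - k) := by
  induction n, h using Nat.le_induction with
  | base => simp [ampliation, Nat.leRecOn_self]
  | succ n h ih =>
    have h1 : ampliation (h.trans n.le_succ) S
        = opSnoc n (ampliation h S) (ContinuousLinearMap.id ℂ H) := by
      rw [ampliation, Nat.leRecOn_succ h]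
      rfl
    rw [h1, tensorVec_castSucc_const, opSnoc_tensorSnoc, inner_tensorSnoc, ih,
      Nat.succ_sub h, pow_succ, ContinuousLinearMap.id_apply]
    ring

/-- Used to see that reduced densities inherit trace one. -/
theorem ampliation_id {k n : ℕ} (h : k ≤ n) :
    ampliation h (ContinuousLinearMap.id ℂ (HTensor H k)) = ContinuousLinearMap.id ℂ _ := by
  induction n, h using Nat.le_induction with
  | base => simp [ampliation, Nat.leRecOn_self]
  | succ n h ih =>
    have h1 : ampliation (h.trans n.le_succ) (ContinuousLinearMap.id ℂ (HTensor H k))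
        = opSnoc n (ampliation h (ContinuousLinearMap.id ℂ (HTensor H k)))
          (ContinuousLinearMap.id ℂ H) := by
      rw [ampliation, Nat.leRecOn_succ h]
      rfl
    rw [h1, ih]
    refine ext_tensorVec fun x => ?_
    rw [tensorVec, opSnoc_tensorSnoc]
    rfl

end TensorLemmas

/-! ### Weak convergence of vectors, of their tensor powers, and under compact operators. -/

section WeakConvergence

variable {E : Type u} [NormedAddCommGroup E] [InnerProductSpace ℂ E]

/-- Weak convergence of a bounded sequence may be tested on a total set. -/
theorem tendsto_inner_of_total {x : ℕ → E} {x₀ : E} {C : ℝ} (hC : ∀ n, ‖x n‖ ≤ C) {D : Set E}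
    (hD : Dense (Submodule.span ℂ D : Set E))
    (h : ∀ y ∈ D, Tendsto (fun n => ⟪y, x n⟫_ℂ) atTop (𝓝 ⟪y, x₀⟫_ℂ)) (y : E) :
    Tendsto (fun n => ⟪y, x n⟫_ℂ) atTop (𝓝 ⟪y, x₀⟫_ℂ) := by
  have hspan : ∀ z ∈ Submodule.span ℂ D, Tendsto (fun n => ⟪z, x n⟫_ℂ) atTop (𝓝 ⟪z, x₀⟫_ℂ) := by
    intro z hz
    induction hz using Submodule.span_induction with
    | mem z hz => exact h z hz
    | zero => simp
    | add z z' _ _ hz hz' => simpa only [inner_add_left] using hz.add hz'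
    | smul c z _ hz => simpa only [inner_smul_left] using hz.const_mul _
  have hC0 : 0 ≤ C := (norm_nonneg _).trans (hC 0)
  rw [Metric.tendsto_atTop]
  intro ε hε
  set M := C + ‖x₀‖ + 1
  have hM : 0 < M := by positivity
  obtain ⟨z, hz, hyz⟩ := Metric.dense_iff.1 hD y (ε / 2 / M) (by positivity)
  rw [Metric.mem_ball, dist_comm, dist_eq_norm] at hz
  obtain ⟨N, hN⟩ := Metric.tendsto_atTop.1 (hspan z hyz) (ε / 2) (by positivity)
  refine ⟨N, fun n hn => ?_⟩
  have h1 := hN n hn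
  rw [dist_eq_norm, ← inner_sub_right] at h1 ⊢
  have h2 : ⟪y, x n - x₀⟫_ℂ = ⟪y - z, x n - x₀⟫_ℂ + ⟪z, x n - x₀⟫_ℂ := by
    rw [← inner_add_left, sub_add_cancel]
  have h3 : ‖⟪y - z, x n - x₀⟫_ℂ‖ ≤ ε / 2 := by
    calc ‖⟪y - z, x n - x₀⟫_ℂ‖ ≤ ‖y - z‖ * ‖x n - x₀‖ := norm_inner_le_norm _ _
      _ ≤ ε / 2 / M * M := by
        gcongr
        linarith [norm_sub_le (x n) x₀, hC n, show M = C + ‖x₀‖ + 1 from rfl]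
      _ = ε / 2 := by field_simp
  rw [h2]
  linarith [norm_add_le ⟪y - z, x n - x₀⟫_ℂ ⟪z, x n - x₀⟫_ℂ]

/-- A compact operator turns weak convergence into norm convergence, and a weakly convergent
sequence may be paired with a norm convergent one. -/
theorem tendsto_inner_compact [CompleteSpace E] {x : ℕ → E} {x₀ : E} {C : ℝ} (hC : ∀ n, ‖x n‖ ≤ C)
    (h : ∀ y, Tendsto (fun n => ⟪y, x n⟫_ℂ) atTop (𝓝 ⟪y, x₀⟫_ℂ)) {K : E →L[ℂ] E}
    (hK : IsCompactOperator K) :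
    Tendsto (fun n => ⟪x n, K (x n)⟫_ℂ) atTop (𝓝 ⟪x₀, K x₀⟫_ℂ) := by
  have hKx : Tendsto (fun n => K (x n)) atTop (𝓝 (K x₀)) := by
    -- Every subsequence has a further one along which K xₙ converges in norm; its limit is
    -- identified with K x₀ by moving K to the test vector as an adjoint.
    refine tendsto_of_subseq_tendsto fun ns hns => ?_
    obtain ⟨S, hS, hsub⟩ := IsCompactOperator.image_closedBall_subset_compact hK C
    obtain ⟨z, -, ms, hms, hz⟩ := hS.tendsto_subseq (x := fun n => K (x (ns n)))
      fun n => hsub ⟨_, by simpa using hC _, rfl⟩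
    refine ⟨ms, ?_⟩
    have : z = K x₀ := by
      refine ext_inner_left ℂ fun y => ?_
      have h1 : Tendsto (fun n => ⟪y, K (x (ns (ms n)))⟫_ℂ) atTop (𝓝 ⟪y, z⟫_ℂ) :=
        tendsto_const_nhds.inner hz
      have h2 := (h (ContinuousLinearMap.adjoint K y)).comp (hns.comp hms.tendsto_atTop)
      simp only [ContinuousLinearMap.adjoint_inner_left] at h2
      exact tendsto_nhds_unique h1 h2
    rw [← this]
    exact hz
  have h1 : Tendsto (fun n => ⟪x n, K x₀⟫_ℂ) atTop (𝓝 ⟪x₀, K x₀⟫_ℂ) := by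
    have := (Complex.continuous_conj.tendsto _).comp (h (K x₀))
    simpa only [Function.comp_def, inner_conj_symm] using this
  have h2 : Tendsto (fun n => ⟪x n, K (x n) - K x₀⟫_ℂ) atTop (𝓝 0) := by
    have h3 : Tendsto (fun n => C * ‖K (x n) - K x₀‖) atTop (𝓝 0) := by
      simpa using (tendsto_iff_norm_sub_tendsto_zero.1 hKx).const_mul C
    refine squeeze_zero_norm (fun n => (norm_inner_le_norm _ _).trans ?_) h3
    gcongr
    exact hC n
  simpa [inner_sub_right] using h2.add h1

variable {H : Type u} [NormedAddCommGroup H] [InnerProductSpace ℂ H]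

theorem tendsto_inner_tpow {x : ℕ → H} {x₀ : H} {C : ℝ} (hC : ∀ n, ‖x n‖ ≤ C)
    (h : ∀ y, Tendsto (fun n => ⟪y, x n⟫_ℂ) atTop (𝓝 ⟪y, x₀⟫_ℂ)) (k : ℕ) (ψ : HTensor H k) :
    Tendsto (fun n => ⟪ψ, tpow k (x n)⟫_ℂ) atTop (𝓝 ⟪ψ, tpow k x₀⟫_ℂ) := by
  refine tendsto_inner_of_total (C := C ^ k)
    (fun n => by rw [norm_tpow]; exact pow_le_pow_left₀ (norm_nonneg _) (hC n) k)
    (dense_span_tensorVec k) ?_ ψ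
  rintro _ ⟨y, rfl⟩
  simp only [tpow, inner_tensorVec]
  exact tendsto_finsetProd _ fun i _ => h (y i)

end WeakConvergence

/-! ### Matrix elements and positivity of mixtures of rank-one operators. -/

section Mixtures

variable {E : Type u} [NormedAddCommGroup E] [InnerProductSpace ℂ E]

theorem inner_mul_inner_self (ψ φ : E) :
    ⟪φ, ψ⟫_ℂ * ⟪ψ, φ⟫_ℂ = ((‖⟪ψ, φ⟫_ℂ‖ ^ 2 : ℝ) : ℂ) := by
  rw [← inner_conj_symm φ, ← Complex.normSq_eq_conj_mul_self, Complex.normSq_eq_norm_sq]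

theorem isCompactOperator_ketbra (x y : E) : IsCompactOperator (ketbra x y).op :=
  ((isCompactOperator_id (E := ℂ)).comp_clm (innerSL ℂ y)).clm_comp
    (ContinuousLinearMap.toSpanSingleton ℂ x)

variable [CompleteSpace E] {X : Type*} [MeasurableSpace X] {μ : Measure X}

theorem inner_integral_ketbra {f : X → E} (hi : Integrable (fun x => ketbra (f x) (f x)) μ)
    (ψ χ : E) :
    ⟪ψ, (∫ x, ketbra (f x) (f x) ∂μ).op χ⟫_ℂ = ∫ x, ⟪f x, χ⟫_ℂ * ⟪ψ, f x⟫_ℂ ∂μ := by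
  rw [TraceClass.op_integral_apply hi, ← integral_inner]
  · simp only [op_ketbra_apply, inner_smul_right]
  · exact ((ContinuousLinearMap.apply ℂ E χ).comp TraceClass.opL).integrable_comp hi

theorem lintegral_enorm_inner_sq {f : X → E}
    (hi : Integrable (fun x => ketbra (f x) (f x)) μ) (ψ : E) :
    ∫⁻ x, ‖⟪ψ, f x⟫_ℂ‖ₑ ^ 2 ∂μ
      = ENNReal.ofReal ‖⟪ψ, (∫ x, ketbra (f x) (f x) ∂μ).op ψ⟫_ℂ‖ := by
  have h1 : Integrable (fun x => ⟪ψ, (ketbra (f x) (f x)).op ψ⟫_ℂ) μ :=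
    ((innerSL ℂ ψ).comp ((ContinuousLinearMap.apply ℂ E ψ).comp TraceClass.opL)).integrable_comp hi
  simp only [op_ketbra_apply, inner_smul_right, inner_mul_inner_self] at h1
  have h2 : Integrable (fun x => ‖⟪ψ, f x⟫_ℂ‖ ^ 2) μ := by
    refine h1.re.congr (Eventually.of_forall fun x => ?_)
    exact Complex.ofReal_re _
  rw [inner_integral_ketbra hi]
  simp only [inner_mul_inner_self]
  rw [integral_complex_ofReal, Complex.norm_real, Real.norm_of_nonneg (integral_nonneg fun x => by positivity),
    ofReal_integral_eq_lintegral_ofReal h2 (Eventually.of_forall fun x => by positivity)]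
  refine lintegral_congr fun x => ?_
  rw [ENNReal.ofReal_pow (norm_nonneg _), ofReal_norm]

theorem isPositive_integral_ketbra {f : X → E}
    (hi : Integrable (fun x => ketbra (f x) (f x)) μ) :
    (∫ x, ketbra (f x) (f x) ∂μ).op.IsPositive := by
  rw [ContinuousLinearMap.isPositive_def]
  constructor
  · intro ψ χ
    show ⟪(∫ x, ketbra (f x) (f x) ∂μ).op ψ, χ⟫_ℂ = ⟪ψ, (∫ x, ketbra (f x) (f x) ∂μ).op χ⟫_ℂ
    rw [← inner_conj_symm, inner_integral_ketbra hi, inner_integral_ketbra hi, ← integral_conj]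
    refine integral_congr_ae (Eventually.of_forall fun x => ?_)
    simp [mul_comm]
  · intro ψ
    rw [ContinuousLinearMap.reApplyInnerSelf_apply, ← inner_re_symm, inner_integral_ketbra hi]
    simp only [inner_mul_inner_self]
    rw [integral_complex_ofReal]
    exact integral_nonneg fun x => by positivity

end Mixtures

/-! ### Mixtures of product states as symmetric hierarchies, and bounds for general hierarchies. -/

section TensorMixtures

variable {H : Type u} [NormedAddCommGroup H] [InnerProductSpace ℂ H]
  {X : Type*} [MeasurableSpace X] {μ : Measure X}

theorem isSymOp_integral_ketbra {k : ℕ} {f : X → HTensor H k}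
    (hi : Integrable (fun x => ketbra (f x) (f x)) μ) (hf : ∀ x, f x ∈ symTensor H k) :
    IsSymOp (∫ x, ketbra (f x) (f x) ∂μ).op := by
  constructor
  · intro ψ π y
    rw [inner_integral_ketbra hi, inner_integral_ketbra hi]
    simp only [hf _ π y]
  · intro ψ hψ
    refine ext_inner_left ℂ fun χ => ?_
    rw [inner_integral_ketbra hi]
    simp [fun x => hψ (f x) (hf x)]

theorem ae_norm_tpow_le {f : X → H} {C : ℝ} (h : ∀ᵐ x ∂μ, ‖f x‖ ≤ C) (k : ℕ) :
    ∀ᵐ x ∂μ, ‖tpow k (f x)‖ ≤ C ^ k := by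
  filter_upwards [h] with x hx
  rw [norm_tpow]
  exact pow_le_pow_left₀ (norm_nonneg _) hx k

theorem integrable_ketbra_tpow [IsFiniteMeasure μ] {f : X → H} (hf : AEStronglyMeasurable f μ)
    {C : ℝ} (h : ∀ᵐ x ∂μ, ‖f x‖ ≤ C) (k : ℕ) :
    Integrable (fun x => ketbra (tpow k (f x)) (tpow k (f x))) μ :=
  integrable_ketbra ((continuous_tpow k).comp_aestronglyMeasurable hf)
    ((continuous_tpow k).comp_aestronglyMeasurable hf) (ae_norm_tpow_le h k) (ae_norm_tpow_le h k)

theorem trace_integral_ketbra_tpow [TopologicalSpace.SeparableSpace H] [IsFiniteMeasure μ]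
    {f : X → H} (hf : AEStronglyMeasurable f μ) {C : ℝ} (h : ∀ᵐ x ∂μ, ‖f x‖ ≤ C) (k : ℕ)
    (K : HTensor H k →L[ℂ] HTensor H k) :
    trace ((∫ x, ketbra (tpow k (f x)) (tpow k (f x)) ∂μ).op ∘L K)
      = ∫ x, ⟪tpow k (f x), K (tpow k (f x))⟫_ℂ ∂μ :=
  trace_integral_ketbra_comp ((continuous_tpow k).comp_aestronglyMeasurable hf)
    (ae_norm_tpow_le h k) K

/-- Mixtures of weak limits of product states are symmetric hierarchies. -/
theorem isSymmetricHierarchy_of_tendsto [TopologicalSpace.SeparableSpace H]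
    [IsProbabilityMeasure μ] {f : X → H} (hf : AEStronglyMeasurable f μ)
    (hf1 : ∀ᵐ x ∂μ, ‖f x‖ ≤ 1) {g : ℕ → X → H} (hg : ∀ n, AEStronglyMeasurable (g n) μ)
    (hg1 : ∀ n, ∀ᵐ x ∂μ, ‖g n x‖ = 1)
    (hfg : ∀ᵐ x ∂μ, ∀ y, Tendsto (fun n => ⟪y, g n x⟫_ℂ) atTop (𝓝 ⟪y, f x⟫_ℂ)) :
    IsSymmetricHierarchy fun k => ∫ x, ketbra (tpow k (f x)) (tpow k (f x)) ∂μ := by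
  have hg1' : ∀ n, ∀ᵐ x ∂μ, ‖g n x‖ ≤ 1 := fun n => (hg1 n).mono fun x hx => hx.le
  have hamp : ∀ {k n : ℕ} (h : k ≤ n) (S : HTensor H k →L[ℂ] HTensor H k) (m : ℕ),
      trace ((∫ x, ketbra (tpow n (g m x)) (tpow n (g m x)) ∂μ).op ∘L ampliation h S)
        = trace ((∫ x, ketbra (tpow k (g m x)) (tpow k (g m x)) ∂μ).op ∘L S) := by
    intro k n h S m
    rw [trace_integral_ketbra_tpow (hg m) (hg1' m), trace_integral_ketbra_tpow (hg m) (hg1' m)]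
    refine integral_congr_ae ?_
    filter_upwards [hg1 m] with x hx
    rw [inner_ampliation_tpow, inner_self_eq_norm_sq_to_K, hx]
    simp
  have hsym : ∀ {F : X → H}, AEStronglyMeasurable F μ → (∀ᵐ x ∂μ, ‖F x‖ ≤ 1) → ∀ k,
      IsSymOp (∫ x, ketbra (tpow k (F x)) (tpow k (F x)) ∂μ).op := fun hF hF1 k =>
    isSymOp_integral_ketbra (integrable_ketbra_tpow hF hF1 k) fun x => tpow_mem_symTensor k _
  -- The n-th state mixes the n-fold powers of gₙ, its k-th marginal mixes the k-fold powers of the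
  -- same gₙ, and no passage to a subsequence is needed.
  refine ⟨fun k => hsym hf hf1 k,
    fun n => ∫ x, ketbra (tpow n (g n x)) (tpow n (g n x)) ∂μ,
    fun n k => ∫ x, ketbra (tpow k (g n x)) (tpow k (g n x)) ∂μ, id, fun n => ⟨?_, ?_, ?_⟩,
    fun n k h => ⟨?_, ?_, ?_⟩, strictMono_id, fun k K hK => ?_⟩
  · exact hsym (hg n) (hg1' n) n
  · exact isPositive_integral_ketbra (integrable_ketbra_tpow (hg n) (hg1' n) n)
  · have h1 := trace_integral_ketbra_tpow (hg n) (hg1' n) n (ContinuousLinearMap.id ℂ _)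
    rw [ContinuousLinearMap.comp_id] at h1
    rw [h1]
    have h2 : ∀ᵐ x ∂μ, ⟪tpow n (g n x), ContinuousLinearMap.id ℂ _ (tpow n (g n x))⟫_ℂ = 1 := by
      filter_upwards [hg1 n] with x hx
      rw [ContinuousLinearMap.id_apply, inner_self_eq_norm_sq_to_K, norm_tpow, hx]
      simp
    rw [integral_congr_ae h2]
    simp
  · exact hsym (hg n) (hg1' n) k
  · exact isPositive_integral_ketbra (integrable_ketbra_tpow (hg n) (hg1' n) k)
  · exact fun S => hamp h S n
  · simp only [id, trace_integral_ketbra_tpow (hg _) (hg1' _), trace_integral_ketbra_tpow hf hf1]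
    refine tendsto_integral_of_dominated_convergence (fun _ => ‖K‖) (fun n => ?_)
      (integrable_const _) (fun n => ?_) ?_
    · have h1 := (continuous_tpow k).comp_aestronglyMeasurable (hg n)
      exact h1.inner (K.continuous.comp_aestronglyMeasurable h1)
    · filter_upwards [hg1 n] with x hx
      have h1 : ‖tpow k (g n x)‖ = 1 := by rw [norm_tpow, hx, one_pow]
      refine (norm_inner_le_norm _ _).trans ?_
      have h2 := K.le_opNorm (tpow k (g n x))
      rw [h1, mul_one] at h2
      rw [h1, one_mul]
      exact h2
    · filter_upwards [hfg, ae_all_iff.2 hg1] with x hx hx1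
      refine tendsto_inner_compact (C := 1) (fun n => ?_) ?_ hK
      · rw [norm_tpow, hx1 n, one_pow]
      · exact tendsto_inner_tpow (C := 1) (fun n => (hx1 n).le) hx k

/-- A finite Hilbert basis would have a span that is both closed and dense, hence the whole space.
-/
theorem exists_orthonormal_sequence {H : Type u} [NormedAddCommGroup H] [InnerProductSpace ℂ H]
    [CompleteSpace H] (h : ¬ FiniteDimensional ℂ H) : ∃ e : ℕ → H, Orthonormal ℂ e := by
  obtain ⟨w, b, -⟩ := exists_hilbertBasis ℂ H
  have hw : Infinite w := by
    by_contra hfin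
    rw [not_infinite_iff_finite] at hfin
    have hfd : FiniteDimensional ℂ (Submodule.span ℂ (range b)) :=
      FiniteDimensional.span_of_finite ℂ (finite_range b)
    have h1 := b.dense_span
    rw [(Submodule.closed_of_finiteDimensional _).submodule_topologicalClosure_eq] at h1
    rw [h1] at hfd
    exact h (Module.Finite.equiv Submodule.topEquiv)
  exact ⟨b ∘ Infinite.natEmbedding w, b.orthonormal.comp _ (Infinite.natEmbedding w).injective⟩

theorem _root_.Orthonormal.tendsto_inner_zero {e : ℕ → H} (he : Orthonormal ℂ e) (y : H) :
    Tendsto (fun n => ⟪y, e n⟫_ℂ) atTop (𝓝 0) := by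
  have h1 := (he.inner_products_summable y).tendsto_atTop_zero
  rw [tendsto_zero_iff_norm_tendsto_zero]
  have h2 := (Real.continuous_sqrt.tendsto 0).comp h1
  simpa [Function.comp_def, norm_inner_symm y] using h2

/-- The coefficient `c ≥ 0` for which `x + c e` is a unit vector, if `‖e‖ = 1` and `‖x‖ ≤ 1`. -/
def unitShift (e x : H) : ℝ :=
  -(⟪e, x⟫_ℂ).re + √((⟪e, x⟫_ℂ).re ^ 2 + (1 - ‖x‖ ^ 2))

theorem continuous_unitShift (e : H) : Continuous (unitShift e) := by
  unfold unitShift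
  fun_prop

/-- The shift c is a root of c² + 2c Re⟨e,x⟩ = 1 − ‖x‖², which has real roots because ‖x‖ ≤ 1. -/
theorem norm_add_unitShift {e x : H} (he : ‖e‖ = 1) (hx : ‖x‖ ≤ 1) :
    ‖x + (unitShift e x : ℂ) • e‖ = 1 := by
  have hx2 : 0 ≤ 1 - ‖x‖ ^ 2 := by nlinarith [norm_nonneg x]
  have h1 : ‖x + (unitShift e x : ℂ) • e‖ ^ 2 = 1 := by
    rw [@norm_add_sq ℂ, inner_smul_right, norm_smul, he, Complex.norm_real, Real.norm_eq_abs,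
      mul_one, sq_abs]
    have h2 : RCLike.re ((unitShift e x : ℂ) * ⟪x, e⟫_ℂ) = unitShift e x * (⟪e, x⟫_ℂ).re := by
      rw [show ∀ z : ℂ, RCLike.re z = z.re from fun _ => rfl, Complex.re_ofReal_mul,
        ← inner_conj_symm x e, Complex.conj_re]
    rw [h2]
    have h3 := Real.sq_sqrt (show 0 ≤ (⟪e, x⟫_ℂ).re ^ 2 + (1 - ‖x‖ ^ 2) by positivity)
    have h4 : √((⟪e, x⟫_ℂ).re ^ 2 + (1 - ‖x‖ ^ 2)) = unitShift e x + (⟪e, x⟫_ℂ).re := by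
      rw [unitShift]; ring
    rw [h4] at h3
    linarith
  exact (pow_eq_one_iff_of_nonneg (norm_nonneg _) two_ne_zero).1 h1

/-- Boundedness of the coefficients makes cₙeₙ tend weakly to zero along an orthonormal sequence. -/
theorem abs_unitShift_le {e x : H} (he : ‖e‖ = 1) (hx : ‖x‖ ≤ 1) : |unitShift e x| ≤ 2 := by
  have h1 := norm_add_unitShift he hx
  have h2 : ‖(unitShift e x : ℂ) • e‖ = |unitShift e x| := by
    rw [norm_smul, he, Complex.norm_real, Real.norm_eq_abs, mul_one]
  have h3 := norm_sub_le (x + (unitShift e x : ℂ) • e) x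
  rw [add_sub_cancel_left, h1, h2] at h3
  linarith

/-- Every probability measure on the closed unit ball is the de Finetti measure of a symmetric
hierarchy; in finite dimensions it has to be carried by the unit sphere. -/
theorem isSymmetricHierarchy_of_measure [CompleteSpace H] [TopologicalSpace.SeparableSpace H]
    [IsProbabilityMeasure μ] {f : X → H} (hf : AEStronglyMeasurable f μ)
    (hf1 : ∀ᵐ x ∂μ, ‖f x‖ ≤ 1) (hfin : FiniteDimensional ℂ H → ∀ᵐ x ∂μ, ‖f x‖ = 1) :
    IsSymmetricHierarchy fun k => ∫ x, ketbra (tpow k (f x)) (tpow k (f x)) ∂μ := by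
  by_cases hd : FiniteDimensional ℂ H
  · exact isSymmetricHierarchy_of_tendsto hf hf1 (g := fun _ => f) (fun _ => hf)
      (fun _ => hfin hd) (Eventually.of_forall fun x y => tendsto_const_nhds)
  · obtain ⟨e, he⟩ := exists_orthonormal_sequence hd
    refine isSymmetricHierarchy_of_tendsto hf hf1
      (g := fun n x => f x + (unitShift (e n) (f x) : ℂ) • e n) (fun n => ?_) (fun n => ?_) ?_
    · have hc : Continuous fun x : H => x + (unitShift (e n) x : ℂ) • e n := by
        have := continuous_unitShift (e n)
        fun_prop
      exact hc.comp_aestronglyMeasurable hf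
    · filter_upwards [hf1] with x hx using norm_add_unitShift (he.1 n) hx
    · filter_upwards [hf1] with x hx y
      simp only [inner_add_right, inner_smul_right]
      have h1 : Tendsto (fun n => (unitShift (e n) (f x) : ℂ) * ⟪y, e n⟫_ℂ) atTop (𝓝 0) := by
        have h2 : Tendsto (fun n => 2 * ‖⟪y, e n⟫_ℂ‖) atTop (𝓝 0) := by
          simpa using (he.tendsto_inner_zero y).norm.const_mul 2
        refine squeeze_zero_norm (fun n => ?_) h2
        rw [norm_mul, Complex.norm_real, Real.norm_eq_abs]
        gcongr
        exact abs_unitShift_le (he.1 n) hx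
      simpa using h1.const_add ⟪y, f x⟫_ℂ

/-- Rank-one operators are compact, so the quadratic form at ψ is a limit of those of reduced
densities, which are positive of trace one. -/
theorem IsSymmetricHierarchy.norm_inner_le {γ : (k : ℕ) → TraceClass (HTensor H k)}
    (hγ : IsSymmetricHierarchy γ) (k : ℕ) (ψ : HTensor H k) :
    ‖⟪ψ, (γ k).op ψ⟫_ℂ‖ ≤ ‖ψ‖ ^ 2 := by
  obtain ⟨-, ϱ, red, sub, hϱ, hred, hsub, hlim⟩ := hγ
  have h1 := hlim k _ (isCompactOperator_ketbra ψ ψ)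
  simp only [trace_comp_ketbra] at h1
  refine le_of_tendsto h1.norm ?_
  filter_upwards [hsub.tendsto_atTop.eventually_ge_atTop k] with i hi
  have h2 := hred (sub i) k hi
  refine norm_inner_le_of_trace_eq_one h2.2.1 ?_ ψ
  have h3 := h2.2.2 (ContinuousLinearMap.id ℂ _)
  rw [ampliation_id, ContinuousLinearMap.comp_id, ContinuousLinearMap.comp_id,
    (hϱ (sub i)).2.2] at h3
  exact h3.symm

/-- In finite dimension the identity is a compact test operator, so the trace passes to the weak-*
limit. -/
theorem IsSymmetricHierarchy.trace_eq_one [FiniteDimensional ℂ H]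
    {γ : (k : ℕ) → TraceClass (HTensor H k)} (hγ : IsSymmetricHierarchy γ) (k : ℕ) :
    trace (γ k).op = 1 := by
  obtain ⟨-, ϱ, red, sub, hϱ, hred, hsub, hlim⟩ := hγ
  have h1 := hlim k (ContinuousLinearMap.id ℂ _) isCompactOperator_id
  simp only [ContinuousLinearMap.comp_id] at h1
  refine tendsto_nhds_unique h1 (tendsto_const_nhds.congr' ?_)
  filter_upwards [hsub.tendsto_atTop.eventually_ge_atTop k] with i hi
  have h3 := (hred (sub i) k hi).2.2 (ContinuousLinearMap.id ℂ _)
  rw [ampliation_id, ContinuousLinearMap.comp_id, ContinuousLinearMap.comp_id,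
    (hϱ (sub i)).2.2] at h3
  exact h3

end TensorMixtures

/-! ### Almost sure bounds from moments of all orders. -/

section Moments

variable {X : Type*} [MeasurableSpace X] {μ : Measure X}

/-- Markov's inequality for the power 2k gives μ{g ≥ d} ≤ (c/d)^{2k}, which tends to 0 for every d >
c. -/
theorem ae_le_of_moments {g : X → ℝ≥0∞} (hg : AEMeasurable g μ) {c : ℝ≥0∞}
    (h : ∀ k : ℕ, ∫⁻ x, g x ^ (2 * k) ∂μ ≤ c ^ (2 * k)) : ∀ᵐ x ∂μ, g x ≤ c := by
  refine (ae_le_const_iff_forall_gt_measure_zero g c).2 fun d hd => ?_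
  have hd0 : d ≠ 0 := (bot_le.trans_lt hd).ne'
  -- The quotient argument needs d finite. For d = ∞, finiteness of the second moment already gives
  -- g < ∞ almost everywhere.
  by_cases hdt : d = ∞
  · subst hdt
    have h1 := h 1
    have h2 : ∫⁻ x, g x ^ (2 * 1) ∂μ ≠ ∞ := (h1.trans_lt (ENNReal.pow_lt_top hd)).ne
    have h3 := ae_lt_top' (hg.pow_const _) h2
    rw [ae_iff] at h3
    convert h3 using 3 with x
    simp
  have hk : ∀ k : ℕ, μ {x | d ≤ g x} ≤ ((c / d) ^ 2) ^ k := by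
    intro k
    have h1 := mul_meas_ge_le_lintegral₀ (hg.pow_const (2 * k)) (d ^ (2 * k))
    have h2 : {x | d ≤ g x} ⊆ {x | d ^ (2 * k) ≤ g x ^ (2 * k)} := by
      intro x (hx : d ≤ g x)
      exact mem_ofPred.2 (pow_le_pow_left₀ bot_le hx (2 * k))
    rw [← pow_mul, div_eq_mul_inv, mul_pow, ← ENNReal.inv_pow, ← div_eq_mul_inv,
      ENNReal.le_div_iff_mul_le (Or.inl (pow_ne_zero _ hd0)) (Or.inl (ENNReal.pow_ne_top hdt)),
      mul_comm]
    exact (mul_le_mul_right (measure_mono h2) _).trans (h1.trans (h k))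
  have hlt : (c / d) ^ 2 < 1 := by
    refine pow_lt_one₀ bot_le ?_ two_ne_zero
    rwa [ENNReal.div_lt_iff (Or.inl hd0) (Or.inl hdt), one_mul]
  exact le_antisymm (ge_of_tendsto' (ENNReal.tendsto_pow_atTop_nhds_zero_of_lt_one hlt) hk) bot_le

/-- Separability reduces the bound |⟨y,f⟩| ≤ M‖y‖ to countably many directions outside one null set;
testing with y = f(x) gives the norm bound. Directions in the range of B suffice, which later allows
B = A^{-s/2} and avoids the unbounded inverse. -/
theorem ae_norm_le_of_moments {H : Type u} [NormedAddCommGroup H] [InnerProductSpace ℂ H]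
    [TopologicalSpace.SeparableSpace H] {B : H →L[ℂ] H} (hB : DenseRange B) {f : X → H}
    (hf : AEStronglyMeasurable f μ) {M : ℝ}
    (h : ∀ (u : H) (k : ℕ),
      ∫⁻ x, ‖⟪B u, f x⟫_ℂ‖ₑ ^ (2 * k) ∂μ ≤ ENNReal.ofReal (M * ‖B u‖) ^ (2 * k)) (hM : 0 ≤ M) :
    ∀ᵐ x ∂μ, ‖f x‖ ≤ M := by
  have h1 : ∀ n : ℕ, ∀ᵐ x ∂μ,
      ‖⟪B (TopologicalSpace.denseSeq H n), f x⟫_ℂ‖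
        ≤ M * ‖B (TopologicalSpace.denseSeq H n)‖ := by
    intro n
    have h2 := ae_le_of_moments (aestronglyMeasurable_const.inner hf).enorm
      (h (TopologicalSpace.denseSeq H n))
    filter_upwards [h2] with x hx
    rwa [← ofReal_norm, ENNReal.ofReal_le_ofReal_iff (by positivity)] at hx
  filter_upwards [ae_all_iff.2 h1] with x hx
  have hall : ∀ y, ‖⟪y, f x⟫_ℂ‖ ≤ M * ‖y‖ := by
    have hd : DenseRange (B ∘ TopologicalSpace.denseSeq H) :=
      hB.comp (TopologicalSpace.denseRange_denseSeq H) B.continuous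
    intro y
    refine hd.induction_on (p := fun y => ‖⟪y, f x⟫_ℂ‖ ≤ M * ‖y‖) y ?_ hx
    exact isClosed_le (by fun_prop) (by fun_prop)
  have h3 := hall (f x)
  rw [inner_self_eq_norm_sq_to_K, norm_pow, RCLike.norm_ofReal, abs_norm] at h3
  by_contra! hlt
  nlinarith [norm_nonneg (f x)]

end Moments

/-! ### From the distributional derivative to the integral equation. -/

section WeakDerivative

variable {F : Type u} [NormedAddCommGroup F] [NormedSpace ℝ F]

theorem tendsto_smoothTransition_mul {r : ℝ} (hr : 0 < r) :
    ∀ᶠ n : ℕ in atTop, Real.smoothTransition (n * r) = 1 := by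
  filter_upwards [eventually_ge_atTop ⌈1 / r⌉₊] with n hn
  refine Real.smoothTransition.one_of_one_le ?_
  have h1 := (Nat.le_ceil (1 / r)).trans (Nat.cast_le.2 hn)
  rwa [div_le_iff₀ hr] at h1

theorem continuous_deriv_smoothTransition : Continuous (deriv Real.smoothTransition) :=
  (Real.smoothTransition.contDiff (n := 1)).continuous_deriv le_rfl

theorem hasDerivAt_smoothTransition (r : ℝ) :
    HasDerivAt Real.smoothTransition (deriv Real.smoothTransition r) r :=
  ((Real.smoothTransition.contDiff (n := 1)).differentiable (by simp) r).hasDerivAt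

theorem deriv_smoothTransition_of_notMem {r : ℝ} (hr : r ∉ Icc (0 : ℝ) 1) :
    deriv Real.smoothTransition r = 0 := by
  rw [mem_Icc, not_and_or, not_le, not_le] at hr
  rcases hr with hr | hr
  · have h1 : Real.smoothTransition =ᶠ[𝓝 r] fun _ => 0 := by
      filter_upwards [Iio_mem_nhds hr] with x hx
      exact Real.smoothTransition.zero_of_nonpos (le_of_lt hx)
    rw [h1.deriv_eq, deriv_const]
  · have h1 : Real.smoothTransition =ᶠ[𝓝 r] fun _ => 1 := by
      filter_upwards [Ioi_mem_nhds hr] with x hx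
      exact Real.smoothTransition.one_of_one_le (le_of_lt hx)
    rw [h1.deriv_eq, deriv_const]

theorem integral_deriv_smoothTransition :
    ∫ r in (0 : ℝ)..1, deriv Real.smoothTransition r = 1 := by
  rw [intervalIntegral.integral_deriv_eq_sub (fun x _ => (hasDerivAt_smoothTransition x).differentiableAt)
    (continuous_deriv_smoothTransition.intervalIntegrable _ _)]
  simp

/-- The smooth approximation of the Heaviside function at `p` of width `1 / n` concentrates its
derivative at `p`. -/
theorem tendsto_integral_deriv_smoothTransition_smul [CompleteSpace F] {a b p : ℝ}
    (hp : p ∈ Ioo a b) {w : ℝ → F} (hw : ContinuousOn w (Ioo a b)) :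
    Tendsto (fun n : ℕ => ∫ t in Ioo a b, (n * deriv Real.smoothTransition (n * (t - p))) • w t)
      atTop (𝓝 (w p)) := by
  -- Within δ of p the function is defined and stays within 1 of w p, so ‖w p‖ + 1 dominates after
  -- rescaling.
  obtain ⟨δ, hδ, hδw⟩ := Metric.eventually_nhds_iff_ball.1
    ((show ∀ᶠ t in 𝓝 p, t ∈ Ioo a b from Ioo_mem_nhds hp.1 hp.2).and ((hw.continuousAt (Ioo_mem_nhds hp.1 hp.2)).eventually
      (Metric.ball_mem_nhds (w p) one_pos)))
  have heq : ∀ᶠ n : ℕ in atTop, 0 < n ∧ (1 / n : ℝ) < δ :=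
    (eventually_gt_atTop 0).and (tendsto_one_div_atTop_nhds_zero_nat.eventually_lt_const hδ)
  have hball : ∀ n : ℕ, (1 / n : ℝ) < δ → ∀ r ∈ Icc (0 : ℝ) 1, 1 / n * r + p ∈ Metric.ball p δ := by
    intro n hn r hr
    have h0 : (0 : ℝ) ≤ 1 / n := by positivity
    rw [Metric.mem_ball, Real.dist_eq, add_sub_cancel_right, abs_of_nonneg (mul_nonneg h0 hr.1)]
    nlinarith [hr.2]
  -- The substitution t = p + r/n moves the n-dependence from the kernel into the argument of w.
  have hchange : ∀ n : ℕ, 0 < n → (1 / n : ℝ) < δ →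
      ∫ t in Ioo a b, (n * deriv Real.smoothTransition (n * (t - p))) • w t
        = ∫ r in (0 : ℝ)..1, deriv Real.smoothTransition r • w (1 / n * r + p) := by
    intro n hn hb
    have hpb : p + 1 / n < b := by
      have := (hδw _ (hball n hb 1 ⟨zero_le_one, le_rfl⟩)).1.2
      linarith
    have hn' : (0 : ℝ) < n := Nat.cast_pos.2 hn
    have h1 : ∫ t in Ioo a b, (n * deriv Real.smoothTransition (n * (t - p))) • w t
        = ∫ t in Ioc p (p + 1 / n), (n * deriv Real.smoothTransition (n * (t - p))) • w t := by
      refine setIntegral_eq_of_subset_of_ae_sdiff_eq_zero measurableSet_Ioo.nullMeasurableSet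
        (fun t ht => ⟨hp.1.trans ht.1, ht.2.trans_lt hpb⟩) ?_
      -- At t = p the rescaled argument is 0, an endpoint of [0,1] where the vanishing lemma does
      -- not apply; this null point is discarded.
      have hne : ∀ᵐ t : ℝ, t ≠ p := by simp [ae_iff]
      filter_upwards [hne] with t htp ht
      rw [deriv_smoothTransition_of_notMem, mul_zero, zero_smul]
      rintro ⟨h2, h3⟩
      refine ht.2 ⟨lt_of_le_of_ne ?_ htp.symm, ?_⟩
      · nlinarith
      · rw [← sub_le_iff_le_add', le_div_iff₀ hn']
        linarith
    rw [h1, ← intervalIntegral.integral_of_le (by simp [hn'.le])]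
    have h2 := intervalIntegral.smul_integral_comp_mul_add (a := 0) (b := 1)
      (f := fun t => (n * deriv Real.smoothTransition (n * (t - p))) • w t) (1 / n : ℝ) p
    rw [mul_zero, zero_add, mul_one, add_comm _ p, ← intervalIntegral.integral_smul] at h2
    rw [← h2]
    refine intervalIntegral.integral_congr fun r _ => ?_
    have h3 : (n : ℝ) * (1 / n * r + p - p) = r := by field_simp; ring
    have h4 : (1 / n : ℝ) * (n * deriv Real.smoothTransition r)
      = deriv Real.smoothTransition r := by field_simp
    simp only [h3, smul_smul, h4]
  have hlim : Tendsto
      (fun n : ℕ => ∫ r in (0 : ℝ)..1, deriv Real.smoothTransition r • w (1 / n * r + p))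
      atTop (𝓝 (∫ r in (0 : ℝ)..1, deriv Real.smoothTransition r • w p)) := by
    refine intervalIntegral.tendsto_integral_filter_of_dominated_convergence
      (fun r => ‖deriv Real.smoothTransition r‖ * (‖w p‖ + 1)) ?_ ?_ ?_ ?_
    · filter_upwards [heq] with n hn
      refine ContinuousOn.aestronglyMeasurable ?_ measurableSet_uIoc
      refine continuous_deriv_smoothTransition.continuousOn.smul
        (hw.comp (by fun_prop) fun r hr => ?_)
      rw [uIoc_of_le zero_le_one] at hr
      exact (hδw _ (hball n hn.2 r ⟨hr.1.le, hr.2⟩)).1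
    · filter_upwards [heq] with n hn
      refine Eventually.of_forall fun r hr => ?_
      rw [uIoc_of_le zero_le_one] at hr
      have h1 := (hδw _ (hball n hn.2 r ⟨hr.1.le, hr.2⟩)).2
      rw [norm_smul]
      gcongr
      have h2 : ‖w (1 / n * r + p)‖ ≤ ‖w p‖ + ‖w (1 / n * r + p) - w p‖ := norm_le_insert' _ _
      rw [dist_eq_norm] at h1
      linarith
    · exact (continuous_deriv_smoothTransition.norm.mul continuous_const).intervalIntegrable _ _
    · refine Eventually.of_forall fun r _ => Tendsto.const_smul ?_ _
      have h1 : Tendsto (fun n : ℕ => 1 / (n : ℝ) * r + p) atTop (𝓝 p) := by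
        simpa using (tendsto_one_div_atTop_nhds_zero_nat.mul_const r).add_const p
      exact (hw.continuousAt (Ioo_mem_nhds hp.1 hp.2)).tendsto.comp h1
  rw [intervalIntegral.integral_smul_const, integral_deriv_smoothTransition, one_smul] at hlim
  refine hlim.congr' ?_
  filter_upwards [heq] with n hn
  exact (hchange n hn.1 hn.2).symm

/-- A continuous function with an integrable distributional derivative is its primitive. -/
theorem IsDistribDeriv.sub_eq_integral [CompleteSpace F] {a b : ℝ} {w g : ℝ → F}
    (h : IsDistribDeriv a b w g) (hw : ContinuousOn w (Ioo a b)) (hg : IntegrableOn g (Ioo a b))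
    (hwi : IntegrableOn w (Ioo a b))
    {p q : ℝ} (hp : p ∈ Ioo a b) (hq : q ∈ Ioo a b) (hpq : p ≤ q) :
    w q - w p = ∫ t in p..q, g t := by
  -- Smooth approximations of the indicator of (p,q]. Both transitions take place to the right of
  -- their points, so the support lies in [p, q + 1/n], inside (a,b) once n is large.
  let χ : ℕ → ℝ → ℝ := fun n t =>
    Real.smoothTransition (n * (t - p)) - Real.smoothTransition (n * (t - q))
  have hχs : ∀ n, ContDiff ℝ (⊤ : ℕ∞) (χ n) := fun n => by
    refine (Real.smoothTransition.contDiff.comp ?_).sub (Real.smoothTransition.contDiff.comp ?_)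
    · fun_prop
    · fun_prop
  have hd : ∀ n t, deriv (χ n) t = n * deriv Real.smoothTransition (n * (t - p))
      - n * deriv Real.smoothTransition (n * (t - q)) := by
    intro n t
    have h1 : ∀ c : ℝ, HasDerivAt (fun t => Real.smoothTransition (n * (t - c)))
        (n * deriv Real.smoothTransition (n * (t - c))) t := by
      intro c
      have h2 : HasDerivAt (fun t : ℝ => (n : ℝ) * (t - c)) (n * 1) t :=
        ((hasDerivAt_id t).sub_const c).const_mul _
      have h3 := (hasDerivAt_smoothTransition (n * (t - c))).comp t h2
      rw [mul_one, mul_comm] at h3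
      exact h3
    exact ((h1 p).sub (h1 q)).deriv
  have hzero : ∀ n : ℕ, ∀ t ∉ Icc p (q + 1 / n), 0 < n → χ n t = 0 := by
    intro n t ht hn
    have hn' : (0 : ℝ) < n := Nat.cast_pos.2 hn
    rw [mem_Icc, not_and_or, not_le, not_le] at ht
    rcases ht with ht | ht
    · simp only [χ]
      rw [Real.smoothTransition.zero_of_nonpos (by nlinarith),
        Real.smoothTransition.zero_of_nonpos (by nlinarith), sub_zero]
    · have h1 : 1 ≤ n * (t - q) := by
        rw [← div_le_iff₀' hn']
        linarith
      simp only [χ]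
      rw [Real.smoothTransition.one_of_one_le h1,
        Real.smoothTransition.one_of_one_le (by nlinarith), sub_self]
  have hL : Tendsto (fun n : ℕ => ∫ t in Ioo a b, deriv (χ n) t • w t) atTop
      (𝓝 (w p - w q)) := by
    have h1 := (tendsto_integral_deriv_smoothTransition_smul hp hw).sub
      (tendsto_integral_deriv_smoothTransition_smul hq hw)
    refine h1.congr fun n => ?_
    have hint : ∀ c : ℝ, IntegrableOn
        (fun t => (n * deriv Real.smoothTransition (n * (t - c))) • w t) (Ioo a b) := by
      intro c
      have hc : Continuous fun t => n * deriv Real.smoothTransition (n * (t - c)) := by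
        have := continuous_deriv_smoothTransition
        fun_prop
      obtain ⟨C, hC⟩ := isCompact_Icc.exists_bound_of_continuousOn (hc.continuousOn (s := Icc a b))
      refine Integrable.bdd_smul hwi C hc.aestronglyMeasurable ?_
      exact (ae_restrict_iff' measurableSet_Ioo).2
        (Eventually.of_forall fun t ht => hC t ⟨ht.1.le, ht.2.le⟩)
    rw [← integral_sub (hint p) (hint q)]
    simp only [hd, sub_smul]
  have hR : Tendsto (fun n : ℕ => ∫ t in Ioo a b, χ n t • g t) atTop
      (𝓝 (∫ t in Ioo a b, (Ioc p q).indicator g t)) := by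
    refine tendsto_integral_of_dominated_convergence (fun t => ‖g t‖)
      (fun n => (hχs n).continuous.aestronglyMeasurable.smul hg.aestronglyMeasurable) hg.norm
      (fun n => Eventually.of_forall fun t => ?_) (Eventually.of_forall fun t => ?_)
    · rw [norm_smul]
      refine mul_le_of_le_one_left (norm_nonneg _) ?_
      rw [Real.norm_eq_abs, abs_le]
      simp only [χ]
      constructor <;> linarith [Real.smoothTransition.nonneg (n * (t - p)),
        Real.smoothTransition.nonneg (n * (t - q)), Real.smoothTransition.le_one (n * (t - p)),
        Real.smoothTransition.le_one (n * (t - q))]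
    · have hval : ∀ᶠ n in atTop, χ n t = (Ioc p q).indicator (fun _ => (1 : ℝ)) t := by
        by_cases h1 : p < t
        · by_cases h2 : q < t
          · filter_upwards [tendsto_smoothTransition_mul (sub_pos.2 h1),
              tendsto_smoothTransition_mul (sub_pos.2 h2)] with n h3 h4
            rw [indicator_of_notMem fun h => absurd h.2 (not_le.2 h2)]
            simp only [χ]
            rw [h3, h4, sub_self]
          · filter_upwards [tendsto_smoothTransition_mul (sub_pos.2 h1)] with n h3
            rw [indicator_of_mem (show t ∈ Ioc p q from ⟨h1, not_lt.1 h2⟩)]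
            simp only [χ]
            rw [h3, Real.smoothTransition.zero_of_nonpos, sub_zero]
            exact mul_nonpos_of_nonneg_of_nonpos n.cast_nonneg (sub_nonpos.2 (not_lt.1 h2))
        · refine Eventually.of_forall fun n => ?_
          rw [indicator_of_notMem fun h => h1 h.1]
          simp only [χ]
          have hn : (0 : ℝ) ≤ n := n.cast_nonneg
          rw [Real.smoothTransition.zero_of_nonpos
              (mul_nonpos_of_nonneg_of_nonpos hn (by linarith)),
            Real.smoothTransition.zero_of_nonpos
              (mul_nonpos_of_nonneg_of_nonpos hn (by linarith)), sub_zero]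
      refine tendsto_const_nhds.congr' ?_
      filter_upwards [hval] with n hn
      rw [hn]
      by_cases ht : t ∈ Ioc p q <;> simp [ht]
  have heq : ∀ᶠ n : ℕ in atTop,
      ∫ t in Ioo a b, deriv (χ n) t • w t = - ∫ t in Ioo a b, χ n t • g t := by
    have h1 : Tendsto (fun n : ℕ => q + 1 / (n : ℝ)) atTop (𝓝 q) := by
      simpa using tendsto_one_div_atTop_nhds_zero_nat.const_add q
    filter_upwards [eventually_gt_atTop 0, h1.eventually_lt_const hq.2] with n hn hnb
    have hts : tsupport (χ n) ⊆ Icc p (q + 1 / n) :=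
      closure_minimal (fun t ht => by
        by_contra hc
        exact ht (hzero n t hc hn)) isClosed_Icc
    exact h (χ n) (hχs n) (HasCompactSupport.of_support_subset_isCompact isCompact_Icc
      (subset_closure.trans hts)) fun t ht =>
        ⟨hp.1.trans_le (hts ht).1, (hts ht).2.trans_lt hnb⟩
  have h1 := tendsto_nhds_unique (hL.congr' heq) hR.neg
  rw [setIntegral_indicator measurableSet_Ioc,
    inter_eq_right.2 (show Ioc p q ⊆ Ioo a b from
      fun t ht => ⟨hp.1.trans ht.1, ht.2.trans_lt hq.2⟩),
    ← intervalIntegral.integral_of_le hpq] at h1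
  rw [← neg_sub, h1, neg_neg]

end WeakDerivative

/-! ### The chain rule along Lipschitz curves. -/

section ChainRule

variable {E F : Type*} [NormedAddCommGroup E] [NormedSpace ℝ E] [NormedAddCommGroup F]
  [NormedSpace ℝ F]

theorem lipschitzOnWith_primitive {g : ℝ → E} {p q C : ℝ} (hpq : p ≤ q)
    (hg : IntervalIntegrable g volume p q) (hC : ∀ t ∈ Icc p q, ‖g t‖ ≤ C) :
    LipschitzOnWith C.toNNReal (fun t => ∫ τ in p..t, g τ) (uIcc p q) := by
  rw [uIcc_of_le hpq]
  have hC0 : 0 ≤ C := (norm_nonneg _).trans (hC p ⟨le_rfl, hpq⟩)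
  have hsub : ∀ t ∈ Icc p q, IntervalIntegrable g volume p t := fun t ht =>
    hg.mono_set (by
      rw [uIcc_of_le ht.1, uIcc_of_le hpq]
      exact Icc_subset_Icc_right ht.2)
  refine LipschitzOnWith.of_dist_le_mul fun t ht s hs => ?_
  rw [dist_eq_norm, intervalIntegral.integral_interval_sub_left (hsub t ht) (hsub s hs),
    Real.coe_toNNReal C hC0, Real.dist_eq]
  refine intervalIntegral.norm_integral_le_of_norm_le_const fun τ hτ => hC τ ?_
  have h1 := uIoc_subset_uIcc hτ
  exact (uIcc_subset_Icc hs ht) h1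

/-- The chain rule for a Lipschitz curve given as a primitive of a bounded function. -/
theorem comp_primitive_sub_eq_integral [CompleteSpace E] [CompleteSpace F] {G : E → F}
    {G' : E → E →L[ℝ] F}
    (hG : ∀ x, HasFDerivAt G (G' x) x) (hGb : ∀ r : ℝ, ∃ D, ∀ x, ‖x‖ ≤ r → ‖G' x‖ ≤ D)
    {g : ℝ → E} {p q C : ℝ} (hpq : p ≤ q) (w₀ : E) (hg : IntervalIntegrable g volume p q)
    (hC : ∀ t ∈ Icc p q, ‖g t‖ ≤ C)
    (hint : IntervalIntegrable (fun t => G' (w₀ + ∫ τ in p..t, g τ) (g t)) volume p q) :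
    G (w₀ + ∫ τ in p..q, g τ) - G w₀ = ∫ t in p..q, G' (w₀ + ∫ τ in p..t, g τ) (g t) := by
  set W : ℝ → E := fun t => w₀ + ∫ τ in p..t, g τ
  have hC0 : 0 ≤ C := (norm_nonneg _).trans (hC p ⟨le_rfl, hpq⟩)
  have hWlip : LipschitzOnWith C.toNNReal W (uIcc p q) := by
    have h1 := lipschitzOnWith_primitive hpq hg hC
    intro t ht s hs
    simpa [W] using h1 ht hs
  have hWp : W p = w₀ := by simp [W]
  -- The Lipschitz curve cannot leave the ball of this radius, on which G is Lipschitz.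
  set r := ‖w₀‖ + C * (q - p)
  have hWr : ∀ t ∈ uIcc p q, ‖W t‖ ≤ r := by
    intro t ht
    have h1 := hWlip.dist_le_mul t ht p left_mem_uIcc
    rw [uIcc_of_le hpq] at ht
    rw [hWp, dist_eq_norm, Real.coe_toNNReal C hC0, Real.dist_eq,
      abs_of_nonneg (sub_nonneg.2 ht.1)] at h1
    have h2 : ‖W t‖ ≤ ‖w₀‖ + ‖W t - w₀‖ := norm_le_insert' _ _
    have h3 : C * (t - p) ≤ C * (q - p) := by
      gcongr
      exact ht.2
    linarith
  obtain ⟨D, hD⟩ := hGb r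
  have hr0 : 0 ≤ r := (norm_nonneg _).trans (hWr p left_mem_uIcc)
  have hD0 : 0 ≤ D := (norm_nonneg _).trans (hD 0 (by simpa using hr0))
  have hGlip : LipschitzOnWith D.toNNReal G (Metric.closedBall 0 r) := by
    refine (convex_closedBall (0 : E) r).lipschitzOnWith_of_nnnorm_hasFDerivWithin_le
      (fun x _ => (hG x).hasFDerivWithinAt) fun x hx => ?_
    rw [← NNReal.coe_le_coe, coe_nnnorm, Real.coe_toNNReal D hD0]
    exact hD x (by simpa using hx)
  have hf1 : AbsolutelyContinuousOnInterval (G ∘ W) p q :=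
    (hGlip.comp hWlip fun t ht => by simpa using hWr t ht).absolutelyContinuousOnInterval
  have hf2 : AbsolutelyContinuousOnInterval (fun t => ∫ τ in p..t, G' (W τ) (g τ)) p q := by
    refine (lipschitzOnWith_primitive (C := D * C) hpq hint
      fun t ht => ?_).absolutelyContinuousOnInterval
    refine ((G' (W t)).le_opNorm _).trans ?_
    exact mul_le_mul (hD _ (hWr t (by rwa [uIcc_of_le hpq]))) (hC t ht) (norm_nonneg _) hD0
  -- Both sides are absolutely continuous, and Lebesgue differentiation gives W' = g almost
  -- everywhere. Their difference has derivative zero almost everywhere, hence is constant.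
  obtain ⟨c, hc⟩ := (hf1.sub hf2).const_of_ae_hasDerivAt_zero (by
    filter_upwards [hg.ae_hasDerivAt_integral, hint.ae_hasDerivAt_integral] with t h1 h2 ht
    have h3 : HasDerivAt W (g t) t := (h1 ht p left_mem_uIcc).const_add w₀
    have h4 : HasDerivAt (G ∘ W) (G' (W t) (g t)) t := (hG (W t)).comp_hasDerivAt t h3
    have h5 := h4.sub (h2 ht p left_mem_uIcc)
    rwa [sub_self] at h5)
  have h1 := (hc p left_mem_uIcc).trans (hc q right_mem_uIcc).symm
  simp only [Pi.sub_apply, Function.comp_apply, intervalIntegral.integral_same, sub_zero,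
    hWp] at h1
  rw [h1]
  abel

end ChainRule

/-! ### Averaging a measure over the circle action. -/

section PhaseAverage

variable {E : Type*} [NormedAddCommGroup E] [NormedSpace ℂ E] [MeasurableSpace E]

/-- The average of the images of a measure under the maps `x ↦ e^{iθ} x`. -/
def phaseAverage (ρ : Measure E) : Measure E :=
  ((AddCircle.haarAddCircle (T := 1)).prod ρ).map
    fun p : AddCircle (1 : ℝ) × E => (AddCircle.toCircle p.1 : ℂ) • p.2

variable [BorelSpace E] [SecondCountableTopology E] {ρ : Measure E}

theorem measurable_toCircle_smul :
    Measurable fun p : AddCircle (1 : ℝ) × E => (AddCircle.toCircle p.1 : ℂ) • p.2 := by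
  have h1 : Continuous fun z : AddCircle (1 : ℝ) => (AddCircle.toCircle z : ℂ) :=
    continuous_subtype_val.comp AddCircle.continuous_toCircle
  have h2 : Continuous fun p : AddCircle (1 : ℝ) × E => (AddCircle.toCircle p.1 : ℂ) • p.2 := by
    fun_prop
  exact h2.measurable

instance [IsProbabilityMeasure ρ] : IsProbabilityMeasure (phaseAverage ρ) :=
  Measure.isProbabilityMeasure_map measurable_toCircle_smul.aemeasurable

/-- A rotation of E becomes a translation of the circle variable, and Haar measure is translation
invariant. -/
theorem map_exp_smul_phaseAverage [SFinite ρ] (θ : ℝ) :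
    (phaseAverage ρ).map (fun x => Complex.exp (θ * Complex.I) • x) = phaseAverage ρ := by
  -- The circle has period 1, so the angle θ corresponds to θ/(2π).
  set c : AddCircle (1 : ℝ) := ((θ / (2 * Real.pi) : ℝ) : AddCircle (1 : ℝ))
  have hc : (AddCircle.toCircle c : ℂ) = Complex.exp (θ * Complex.I) := by
    rw [AddCircle.toCircle_apply_mk, Circle.coe_exp]
    congr 3
    field_simp
  have h1 : (fun x : E => Complex.exp (θ * Complex.I) • x) ∘
      (fun p : AddCircle (1 : ℝ) × E => (AddCircle.toCircle p.1 : ℂ) • p.2)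
      = (fun p : AddCircle (1 : ℝ) × E => (AddCircle.toCircle p.1 : ℂ) • p.2) ∘
        Prod.map (fun z => z + c) id := by
    ext p
    simp only [Function.comp_apply, Prod.map_fst, Prod.map_snd, id, AddCircle.toCircle_add,
      Circle.coe_mul, hc, smul_smul, mul_comm]
  rw [phaseAverage, Measure.map_map (measurable_const_smul _) measurable_toCircle_smul, h1,
    ← Measure.map_map measurable_toCircle_smul
      ((measurable_add_const c).prodMap measurable_id),
    ← Measure.map_prod_map _ _ (measurable_add_const c) measurable_id, Measure.map_id,
    map_add_right_eq_self]

theorem ae_phaseAverage [SFinite ρ] {p : E → Prop} (hm : MeasurableSet {x | p x})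
    (hp : ∀ (c : ℂ) (x : E), ‖c‖ = 1 → p x → p (c • x)) (h : ∀ᵐ x ∂ρ, p x) :
    ∀ᵐ x ∂(phaseAverage ρ), p x := by
  rw [phaseAverage, ae_map_iff measurable_toCircle_smul.aemeasurable hm]
  filter_upwards [Measure.quasiMeasurePreserving_snd.ae h] with z hz
  exact hp _ _ (Circle.norm_coe _) hz

theorem integral_phaseAverage [SFinite ρ] {G : Type*} [NormedAddCommGroup G] [NormedSpace ℝ G]
    {F : E → G} (hm : StronglyMeasurable F) (hF : ∀ (c : ℂ) (x : E), ‖c‖ = 1 → F (c • x) = F x) :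
    ∫ x, F x ∂(phaseAverage ρ) = ∫ x, F x ∂ρ := by
  rw [phaseAverage, integral_map measurable_toCircle_smul.aemeasurable hm.aestronglyMeasurable]
  simp only [fun p : AddCircle (1 : ℝ) × E => hF _ p.2 (Circle.norm_coe (AddCircle.toCircle p.1))]
  rw [← integral_map (φ := Prod.snd) (f := F) measurable_snd.aemeasurable hm.aestronglyMeasurable,
    Measure.map_snd_prod, measure_univ, one_smul]

end PhaseAverage

/-! ### The derivative of the map sending x to the projection-like operator of its tensor power. -/

section Derivative

variable {H : Type u} [NormedAddCommGroup H] [InnerProductSpace ℂ H]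

theorem norm_tensorVec_update {k : ℕ} (j : Fin k) (x y : H) :
    ‖tensorVec k (Function.update (fun _ => x) j y)‖ = ‖y‖ * ‖x‖ ^ (k - 1) := by
  rw [norm_tensorVec, ← Finset.mul_prod_erase Finset.univ _ (Finset.mem_univ j),
    Function.update_self]
  congr 1
  rw [Finset.prod_congr rfl fun i hi => by rw [Function.update_of_ne (Finset.ne_of_mem_erase hi)]]
  simp

/-- The derivative of `x ↦ x^{⊗k}`. -/
def tpowDeriv (k : ℕ) (x : H) : H →L[ℝ] HTensor H k :=
  ((tensorVecL k).linearDeriv (fun _ => x) ∘L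
    ContinuousLinearMap.pi fun _ => ContinuousLinearMap.id ℂ H).restrictScalars ℝ

theorem tpowDeriv_apply (k : ℕ) (x y : H) :
    tpowDeriv k x y = ∑ j, tensorVec k (Function.update (fun _ => x) j y) := by
  simp only [tpowDeriv, ContinuousLinearMap.coe_restrictScalars', ContinuousLinearMap.comp_apply,
    ContinuousMultilinearMap.linearDeriv_apply]
  rfl

theorem hasFDerivAt_tpow (k : ℕ) (x : H) : HasFDerivAt (tpow k) (tpowDeriv k x) x := by
  have h1 : HasFDerivAt (tpow (H := H) k) ((tensorVecL k).linearDeriv (fun _ => x) ∘L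
      ContinuousLinearMap.pi fun _ => ContinuousLinearMap.id ℂ H) x :=
    ((tensorVecL k).hasFDerivAt fun _ => x).comp x
      (ContinuousLinearMap.pi fun _ => ContinuousLinearMap.id ℂ H).hasFDerivAt
  exact h1.restrictScalars ℝ

/-- The derivative of `x ↦ |x^{⊗k}⟩⟨x^{⊗k}|`. -/
def ketbraPowDeriv (k : ℕ) (x : H) : H →L[ℝ] TraceClass (HTensor H k) :=
  isBoundedBilinearMap_ketbra.deriv (tpow k x, tpow k x) ∘L
    (tpowDeriv k x).prod (tpowDeriv k x)

theorem ketbraPowDeriv_apply (k : ℕ) (x y : H) :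
    ketbraPowDeriv k x y = ∑ j,
      (ketbra (tpow k x) (tensorVec k (Function.update (fun _ => x) j y)) +
        ketbra (tensorVec k (Function.update (fun _ => x) j y)) (tpow k x)) := by
  rw [Finset.sum_add_distrib, ← ketbra_sum_right, ← ketbra_sum_left, ← tpowDeriv_apply]
  simp [ketbraPowDeriv]

theorem hasFDerivAt_ketbra_tpow (k : ℕ) (x : H) :
    HasFDerivAt (fun x => ketbra (tpow k x) (tpow k x)) (ketbraPowDeriv k x) x :=
  HasFDerivAt.comp (g := fun p : HTensor H k × HTensor H k => ketbra p.1 p.2)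
    (f := fun x => (tpow k x, tpow k x)) x
    (isBoundedBilinearMap_ketbra.hasFDerivAt (tpow k x, tpow k x))
    ((hasFDerivAt_tpow k x).prodMk (hasFDerivAt_tpow k x))

theorem norm_ketbraPowDeriv_le (k : ℕ) {x : H} {r : ℝ} (hx : ‖x‖ ≤ r) :
    ‖ketbraPowDeriv k x‖ ≤ k * (2 * (r ^ k * r ^ (k - 1))) := by
  have hr : 0 ≤ r := (norm_nonneg _).trans hx
  refine ContinuousLinearMap.opNorm_le_bound _ (by positivity) fun y => ?_
  rw [ketbraPowDeriv_apply]
  refine (norm_sum_le _ _).trans ?_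
  have h1 : ∀ j : Fin k,
      ‖ketbra (tpow k x) (tensorVec k (Function.update (fun _ => x) j y)) +
        ketbra (tensorVec k (Function.update (fun _ => x) j y)) (tpow k x)‖
      ≤ 2 * (r ^ k * r ^ (k - 1)) * ‖y‖ := by
    intro j
    refine (norm_add_le_of_le (norm_ketbra_le _ _) (norm_ketbra_le _ _)).trans ?_
    rw [norm_tensorVec_update, norm_tpow]
    have h2 : ‖x‖ ^ k * ‖x‖ ^ (k - 1) ≤ r ^ k * r ^ (k - 1) := by gcongr
    nlinarith [norm_nonneg y]
  refine (Finset.sum_le_sum fun j _ => h1 j).trans ?_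
  simp [mul_assoc]

end Derivative

/-! ### Weights, weak solutions and slot tensors in the scale of spaces. -/

section Curves

variable {H : Type u} [NormedAddCommGroup H] [InnerProductSpace ℂ H] [CompleteSpace H]
  {A : PosOp H} {s σ : ℝ}

instance [TopologicalSpace.SeparableSpace H] (τ : ℝ) :
    TopologicalSpace.SeparableSpace (Z A τ) :=
  inferInstanceAs (TopologicalSpace.SeparableSpace H)

instance [TopologicalSpace.SeparableSpace H] (τ : ℝ) : SecondCountableTopology (Z A τ) :=
  UniformSpace.secondCountable_of_separable _

instance [TopologicalSpace.SeparableSpace H] (τ : ℝ) : PolishSpace (Z A τ) where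

theorem inner_negPow (r : ℝ) (x y : H) : ⟪A.negPow r x, y⟫_ℂ = ⟪x, A.negPow r y⟫_ℂ := by
  rw [← ContinuousLinearMap.adjoint_inner_right,
    ContinuousLinearMap.isSelfAdjoint_iff'.1 (A.negPow_isSelfAdjoint r)]

theorem weighted_ketbra_tpow (τ : ℝ) (k : ℕ) (x : H) :
    weighted A τ (ketbra (tpow k x) (tpow k x)).op
      = (ketbra (tpow k (A.negPow (τ / 2) x)) (tpow k (A.negPow (τ / 2) x))).op := by
  have h1 : opPow (A.negPow (τ / 2)) k (tpow k x) = tpow k (A.negPow (τ / 2) x) :=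
    opPow_tensorVec _ k _
  rw [← h1]
  nth_rw 2 [h1]
  exact comp_ketbra_comp fun z => inner_opPow (inner_negPow (τ / 2)) k (fun _ => x) z

theorem weighted_integral_ketbra_tpow (τ : ℝ) {X : Type*} [MeasurableSpace X] {μ : Measure X}
    {k : ℕ} {f : X → H} (hi : Integrable (fun x => ketbra (tpow k (f x)) (tpow k (f x))) μ)
    (hi' : Integrable (fun x => ketbra (tpow k (A.negPow (τ / 2) (f x)))
      (tpow k (A.negPow (τ / 2) (f x)))) μ) :
    weighted A τ (∫ x, ketbra (tpow k (f x)) (tpow k (f x)) ∂μ).op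
      = (∫ x, ketbra (tpow k (A.negPow (τ / 2) (f x))) (tpow k (A.negPow (τ / 2) (f x))) ∂μ).op := by
  ext ψ
  rw [TraceClass.op_integral_apply hi']
  simp only [← weighted_ketbra_tpow, weighted, ContinuousLinearMap.comp_apply]
  rw [TraceClass.op_integral_apply hi]
  refine ((opPow (A.negPow (τ / 2)) k).integral_comp_comm ?_).symm
  exact ((ContinuousLinearMap.apply ℂ _ (opPow (A.negPow (τ / 2)) k ψ)).comp
    TraceClass.opL).integrable_comp hi

/-- Essential boundedness on a bounded interval gives the integrability needed to integrate the
distributional derivative; replacing g by v(t,u) is then an almost everywhere change. -/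
theorem IsWeakSolution.sub_eq_integral {v : ℝ → Z A s → Z A (-σ)} {a b t₀ : ℝ} {x : Z A s}
    {u : ℝ → Z A s} (h : IsWeakSolution v a b t₀ x u) {p q : ℝ} (hp : p ∈ Ioo a b)
    (hq : q ∈ Ioo a b) (hpq : p ≤ q) :
    Z.emb A s σ (u q) - Z.emb A s σ (u p) = ∫ t in p..q, v t (u t) := by
  obtain ⟨g, hg, hd, hgv⟩ := h.deriv
  have hsub : Ioc p q ⊆ Ioo a b := fun t ht => ⟨hp.1.trans ht.1, ht.2.trans_lt hq.2⟩
  rw [hd.sub_eq_integral h.continuousOn (hg.integrable le_top) (h.memLp_emb.integrable le_top)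
    hp hq hpq]
  refine intervalIntegral.integral_congr_ae ?_
  rw [uIoc_of_le hpq]
  rw [ae_restrict_iff' measurableSet_Ioo] at hgv
  filter_upwards [hgv] with t ht ht'
  exact ht (hsub ht')

theorem continuous_slotPow (k : ℕ) : Continuous (slotPow A s σ k) :=
  (continuous_tpow k).comp ((Z.coord A (-σ)).continuous.comp (Z.emb A s σ).continuous)

theorem continuous_slotTensor {k : ℕ} (j : Fin k) :
    Continuous fun p : Z A s × Z A (-σ) => slotTensor j p.1 p.2 := by
  refine (continuous_tensorVec k).comp (Continuous.update ?_ j ?_)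
  · exact continuous_pi fun _ => (Z.coord A (-σ)).continuous.comp
      ((Z.emb A s σ).continuous.comp continuous_fst)
  · exact (Z.coord A (-σ)).continuous.comp continuous_snd

theorem slotPow_smul (k : ℕ) (c : ℂ) (x : Z A s) :
    slotPow A s σ k (c • x) = c ^ k • slotPow A s σ k x := by
  rw [slotPow, map_smul, map_smul, tpow_smul]
  rfl

theorem slotTensor_smul {k : ℕ} (j : Fin k) (c : ℂ) (x : Z A s) (y : Z A (-σ)) :
    slotTensor j (c • x) (c • y) = c ^ k • slotTensor j x y := by
  have h1 := (tensorVecL k).map_smul_univ (fun _ => c)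
    (Function.update (fun _ => Z.coord A (-σ) (Z.emb A s σ x)) j (Z.coord A (-σ) y))
  rw [Finset.prod_const, Finset.card_univ, Fintype.card_fin] at h1
  rw [slotTensor, slotTensor, ← tensorVecL_apply, ← tensorVecL_apply, ← h1]
  congr 1
  ext i
  rcases eq_or_ne i j with rfl | hij
  · simp
  · simp [hij]

theorem IsAdmissibleField.unit_smul {v : ℝ → Z A s → Z A (-σ)} (hv : IsAdmissibleField v) (t : ℝ)
    {c : ℂ} (hc : ‖c‖ = 1) (x : Z A s) : v t (c • x) = c • v t x := by
  have h1 := Complex.norm_mul_exp_arg_mul_I c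
  rw [hc, Complex.ofReal_one, one_mul] at h1
  rw [← h1]
  exact hv.invariant t _ x

/-- Equivariance of v makes ket and bra both acquire the factor c^k, and c^k times its conjugate is
1. -/
theorem cPlusIntegrand_smul {v : ℝ → Z A s → Z A (-σ)} (hv : IsAdmissibleField v) (t : ℝ) {k : ℕ}
    (j : Fin k) {c : ℂ} (hc : ‖c‖ = 1) (x : Z A s) :
    cPlusIntegrand v t j (c • x) = cPlusIntegrand v t j x := by
  rw [cPlusIntegrand, hv.unit_smul t hc, slotTensor_smul, slotPow_smul,
    ketbra_unit_smul (by simp [hc])]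
  rfl

theorem cMinusIntegrand_smul {v : ℝ → Z A s → Z A (-σ)} (hv : IsAdmissibleField v) (t : ℝ) {k : ℕ}
    (j : Fin k) {c : ℂ} (hc : ‖c‖ = 1) (x : Z A s) :
    cMinusIntegrand v t j (c • x) = cMinusIntegrand v t j x := by
  rw [cMinusIntegrand, hv.unit_smul t hc, slotTensor_smul, slotPow_smul,
    ketbra_unit_smul (by simp [hc])]
  rfl

theorem continuous_ketbra_slot {k : ℕ} (j : Fin k) :
    Continuous fun p : Z A s × Z A (-σ) => ketbra (slotPow A s σ k p.1) (slotTensor j p.1 p.2) :=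
  continuous_ketbra.comp
    (((continuous_slotPow k).comp continuous_fst).prodMk (continuous_slotTensor j))

theorem continuous_ketbra_slot' {k : ℕ} (j : Fin k) :
    Continuous fun p : Z A s × Z A (-σ) => ketbra (slotTensor j p.1 p.2) (slotPow A s σ k p.1) :=
  continuous_ketbra.comp
    ((continuous_slotTensor j).prodMk ((continuous_slotPow k).comp continuous_fst))

theorem norm_slotPow (k : ℕ) (x : Z A s) : ‖slotPow A s σ k x‖ = ‖Z.emb A s σ x‖ ^ k := by
  rw [slotPow, norm_tpow, LinearIsometryEquiv.norm_map]

theorem norm_slotTensor {k : ℕ} (j : Fin k) (x : Z A s) (y : Z A (-σ)) :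
    ‖slotTensor j x y‖ = ‖y‖ * ‖Z.emb A s σ x‖ ^ (k - 1) := by
  rw [slotTensor, norm_tensorVec_update, LinearIsometryEquiv.norm_map, LinearIsometryEquiv.norm_map]

/-- A bound for the integrands of `C^±_{j,k}`. -/
def slotBound (A : PosOp H) (s σ C D : ℝ) (k : ℕ) : ℝ :=
  (‖Z.emb A s σ‖ * C) ^ k * (D * (‖Z.emb A s σ‖ * C) ^ (k - 1))

theorem norm_slot_mul_le {k : ℕ} (j : Fin k) {x : Z A s} {y : Z A (-σ)} {C D : ℝ} (hx : ‖x‖ ≤ C)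
    (hy : ‖y‖ ≤ D) :
    ‖slotPow A s σ k x‖ * ‖slotTensor j x y‖ ≤ slotBound A s σ C D k := by
  have h1 : ‖Z.emb A s σ x‖ ≤ ‖Z.emb A s σ‖ * C :=
    ((Z.emb A s σ).le_opNorm x).trans (mul_le_mul_of_nonneg_left hx (norm_nonneg _))
  have hC : 0 ≤ C := (norm_nonneg _).trans hx
  have hD : 0 ≤ D := (norm_nonneg _).trans hy
  rw [norm_slotPow, norm_slotTensor, slotBound]
  gcongr

theorem norm_cPlusIntegrand_le {v : ℝ → Z A s → Z A (-σ)} {t : ℝ} {k : ℕ} (j : Fin k) {x : Z A s}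
    {C D : ℝ} (hx : ‖x‖ ≤ C) (hy : ‖v t x‖ ≤ D) :
    ‖cPlusIntegrand v t j x‖ ≤ slotBound A s σ C D k :=
  (norm_ketbra_le _ _).trans (norm_slot_mul_le j hx hy)

theorem norm_cMinusIntegrand_le {v : ℝ → Z A s → Z A (-σ)} {t : ℝ} {k : ℕ} (j : Fin k) {x : Z A s}
    {C D : ℝ} (hx : ‖x‖ ≤ C) (hy : ‖v t x‖ ≤ D) :
    ‖cMinusIntegrand v t j x‖ ≤ slotBound A s σ C D k :=
  (norm_ketbra_le _ _).trans ((mul_comm _ _).trans_le (norm_slot_mul_le j hx hy))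

/-- Along a solution, `|u^{⊗k}⟩⟨u^{⊗k}|` solves the integrated hierarchy equation. -/
theorem ketbra_slotPow_sub_eq_integral {v : ℝ → Z A s → Z A (-σ)} {u : ℝ → Z A s} {p q D : ℝ}
    (hpq : p ≤ q)
    (hu : ∀ t ∈ Icc p q, Z.emb A s σ (u t) - Z.emb A s σ (u p) = ∫ τ in p..t, v τ (u τ))
    (hD : ∀ t ∈ Icc p q, ‖v t (u t)‖ ≤ D)
    (hv : IntervalIntegrable (fun t => v t (u t)) volume p q) (k : ℕ)
    (hint : IntervalIntegrable
      (fun t => ∑ j : Fin k, (cPlusIntegrand v t j (u t) + cMinusIntegrand v t j (u t)))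
      volume p q) :
    ketbra (slotPow A s σ k (u q)) (slotPow A s σ k (u q))
        - ketbra (slotPow A s σ k (u p)) (slotPow A s σ k (u p))
      = ∫ t in p..q, ∑ j : Fin k, (cPlusIntegrand v t j (u t) + cMinusIntegrand v t j (u t)) := by
  have hW : ∀ t ∈ Icc p q, Z.emb A s σ (u p) + ∫ τ in p..t, v τ (u τ) = Z.emb A s σ (u t) :=
    fun t ht => by rw [← hu t ht, add_sub_cancel]
  -- The solution is differentiable only in 𝒵_{-σ}; this isometry carries it to H, where the tensor
  -- powers live.
  let L : Z A (-σ) →L[ℝ] H :=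
    ((Z.coord A (-σ)).toContinuousLinearEquiv.toContinuousLinearMap).restrictScalars ℝ
  have hLn : ∀ x, ‖L x‖ = ‖x‖ := fun x => (Z.coord A (-σ)).norm_map x
  have hL1 : ‖L‖ ≤ 1 := ContinuousLinearMap.opNorm_le_bound _ zero_le_one fun x => by
    rw [hLn, one_mul]
  have hG' : ∀ t ∈ Icc p q,
      ((ketbraPowDeriv k (L (Z.emb A s σ (u p) + ∫ τ in p..t, v τ (u τ)))).comp L) (v t (u t))
        = ∑ j : Fin k, (cPlusIntegrand v t j (u t) + cMinusIntegrand v t j (u t)) := by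
    intro t ht
    rw [hW t ht, ContinuousLinearMap.comp_apply, ketbraPowDeriv_apply]
    rfl
  have h1 := comp_primitive_sub_eq_integral
    (G := fun x => ketbra (tpow k (L x)) (tpow k (L x)))
    (G' := fun x => (ketbraPowDeriv k (L x)).comp L)
    (fun x => HasFDerivAt.comp x (hasFDerivAt_ketbra_tpow k (L x)) L.hasFDerivAt)
    (fun r => ⟨k * (2 * (r ^ k * r ^ (k - 1))), fun x hx => by
      have h2 := norm_ketbraPowDeriv_le k (x := L x) (r := r) (by rwa [hLn])
      refine (ContinuousLinearMap.opNorm_comp_le _ _).trans ?_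
      have h3 := mul_le_mul h2 hL1 (norm_nonneg _) ((norm_nonneg _).trans h2)
      rwa [mul_one] at h3⟩)
    hpq (Z.emb A s σ (u p)) hv hD
    (hint.congr (by
      rw [uIoc_of_le hpq]
      exact fun t ht => (hG' t ⟨ht.1.le, ht.2⟩).symm))
  rw [hW q ⟨hpq, le_rfl⟩] at h1
  refine h1.trans (intervalIntegral.integral_congr fun t ht => ?_)
  rw [uIcc_of_le hpq] at ht
  exact hG' t ht

variable [MeasurableSpace H] [BorelSpace H] [TopologicalSpace.SeparableSpace H]

/-- A continuous injection of a Polish space is a measurable embedding, so pulling back undoes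
pushing forward; the cutoff to the unit ball removes only a null set. -/
theorem restrictToZ_map_toH (hs : 0 ≤ s) {ρ : Measure (Z A s)}
    (h : ∀ᵐ x ∂ρ, ‖Z.toH A s x‖ ≤ 1) : restrictToZ A s (ρ.map (Z.toH A s)) = ρ := by
  have he : MeasurableEmbedding (Z.toH A s) :=
    (Z.toH A s).continuous.measurableEmbedding (Z.toH_injective A hs)
  rw [restrictToZ, he.comap_map]
  exact Measure.restrict_eq_self_of_ae_mem h

theorem isDeFinettiMeasure_phaseAverage {ρ : Measure (Z A s)} [IsProbabilityMeasure ρ]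
    (h : ∀ᵐ x ∂ρ, ‖Z.toH A s x‖ ≤ 1) :
    IsDeFinettiMeasure
      (fun k => ∫ x, ketbra (tpow k (Z.toH A s x)) (tpow k (Z.toH A s x)) ∂ρ)
      ((phaseAverage ρ).map (Z.toH A s)) := by
  have hm : Measurable (Z.toH A s) := (Z.toH A s).continuous.measurable
  have hball : ∀ᵐ x ∂((phaseAverage ρ).map (Z.toH A s)), x ∈ Metric.closedBall (0 : H) 1 := by
    refine (ae_map_iff (p := fun x => x ∈ Metric.closedBall (0 : H) 1) hm.aemeasurable
      measurableSet_closedBall).2 ?_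
    refine ae_phaseAverage (hm measurableSet_closedBall) (fun c x hc hx => ?_) ?_
    · rw [map_smul, mem_closedBall_zero_iff, norm_smul, hc, one_mul]
      exact mem_closedBall_zero_iff.1 hx
    · filter_upwards [h] with x hx using mem_closedBall_zero_iff.2 hx
  have hp : IsProbabilityMeasure ((phaseAverage ρ).map (Z.toH A s)) :=
    Measure.isProbabilityMeasure_map hm.aemeasurable
  refine ⟨⟨hp, ?_, fun θ => ?_⟩, fun k => ?_⟩
  · exact (prob_compl_eq_zero_iff measurableSet_closedBall).1 (ae_iff.1 hball)
  · have h1 : (fun x : H => Complex.exp (θ * Complex.I) • x) ∘ Z.toH A s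
        = Z.toH A s ∘ fun x => Complex.exp (θ * Complex.I) • x := by
      ext x
      simp
    rw [Measure.map_map (measurable_const_smul _) hm, h1,
      ← Measure.map_map hm (measurable_const_smul _), map_exp_smul_phaseAverage]
  · have hc : Continuous fun x : H => ketbra (tpow k x) (tpow k x) :=
      continuous_ketbra.comp ((continuous_tpow k).prodMk (continuous_tpow k))
    rw [Measure.restrict_eq_self_of_ae_mem hball,
      integral_map hm.aemeasurable hc.aestronglyMeasurable]
    refine (integral_phaseAverage (F := fun x => ketbra (tpow k (Z.toH A s x))
      (tpow k (Z.toH A s x))) ?_ fun c x hc => ?_).symm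
    · exact (hc.comp (Z.toH A s).continuous).stronglyMeasurable
    · rw [map_smul, tpow_smul, ketbra_unit_smul (by simp [hc])]

end Curves

/-! ### The push-forward hierarchy: regularity and the hierarchy equation. -/

section Superposition

variable {H : Type u} [NormedAddCommGroup H] [InnerProductSpace ℂ H] [CompleteSpace H]
  {A : PosOp H} {s σ : ℝ}

theorem IsAdmissibleField.exists_bound {v : ℝ → Z A s → Z A (-σ)} (hv : IsAdmissibleField v)
    (a b C : ℝ) : ∃ D : ℝ, ∀ t ∈ Ioo a b, ∀ x, ‖x‖ ≤ C → ‖v t x‖ ≤ D := by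
  have h1 : Bornology.IsBounded (Ioo a b ×ˢ Metric.closedBall (0 : Z A s) C) :=
    (Metric.isBounded_Ioo a b).prod Metric.isBounded_closedBall
  obtain ⟨D, hD⟩ := (hv.bounded _ h1).exists_norm_le
  exact ⟨D, fun t ht x hx => hD _ ⟨(t, x), ⟨ht, mem_closedBall_zero_iff.2 hx⟩, rfl⟩⟩

theorem continuous_ketbra_tpow_toH (k : ℕ) :
    Continuous fun x : Z A s => ketbra (tpow k (Z.toH A s x)) (tpow k (Z.toH A s x)) := by
  have h := (continuous_tpow k).comp (Z.toH A s).continuous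
  exact continuous_ketbra.comp (h.prodMk h)

variable [TopologicalSpace.SeparableSpace H]

theorem stronglyMeasurable_cPlusIntegrand {v : ℝ → Z A s → Z A (-σ)} (hv : IsAdmissibleField v)
    {k : ℕ} (j : Fin k) {X : Type*} [MeasurableSpace X] {f : X → ℝ} {g : X → Z A s}
    (hf : Measurable f) (hg : Measurable g) :
    StronglyMeasurable fun p => cPlusIntegrand v (f p) j (g p) := by
  have h1 : Measurable fun p => (g p, v (f p) (g p)) :=
    hg.prodMk (hv.borel.comp (hf.prodMk hg))
  have h2 := (continuous_ketbra_slot (A := A) (s := s) (σ := σ)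
    j).stronglyMeasurable.comp_measurable h1
  unfold cPlusIntegrand
  exact h2

theorem stronglyMeasurable_cPlusIntegrand_right {v : ℝ → Z A s → Z A (-σ)}
    (hv : IsAdmissibleField v) (t : ℝ) {k : ℕ} (j : Fin k) :
    StronglyMeasurable (cPlusIntegrand v t j) :=
  stronglyMeasurable_cPlusIntegrand hv j (measurable_const (a := t)) measurable_id

theorem stronglyMeasurable_cMinusIntegrand {v : ℝ → Z A s → Z A (-σ)} (hv : IsAdmissibleField v)
    {k : ℕ} (j : Fin k) {X : Type*} [MeasurableSpace X] {f : X → ℝ} {g : X → Z A s}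
    (hf : Measurable f) (hg : Measurable g) :
    StronglyMeasurable fun p => cMinusIntegrand v (f p) j (g p) := by
  have h1 : Measurable fun p => (g p, v (f p) (g p)) :=
    hg.prodMk (hv.borel.comp (hf.prodMk hg))
  have h2 := (continuous_ketbra_slot' (A := A) (s := s) (σ := σ)
    j).stronglyMeasurable.comp_measurable h1
  unfold cMinusIntegrand
  exact h2

theorem stronglyMeasurable_cMinusIntegrand_right {v : ℝ → Z A s → Z A (-σ)}
    (hv : IsAdmissibleField v) (t : ℝ) {k : ℕ} (j : Fin k) :
    StronglyMeasurable (cMinusIntegrand v t j) :=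
  stronglyMeasurable_cMinusIntegrand hv j (measurable_const (a := t)) measurable_id

section Fixed

variable [MeasurableSpace H] [BorelSpace H] {ρ : Measure (Z A s)} [IsProbabilityMeasure ρ]

theorem restrictToZ_phaseAverage (hs : 0 ≤ s) (h : ∀ᵐ x ∂ρ, ‖Z.toH A s x‖ ≤ 1) :
    restrictToZ A s ((phaseAverage ρ).map (Z.toH A s)) = phaseAverage ρ := by
  refine restrictToZ_map_toH hs (ae_phaseAverage ?_ (fun c x hc hx => ?_) h)
  · exact (isClosed_le (Z.toH A s).continuous.norm continuous_const).measurableSet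
  · rwa [map_smul, norm_smul, hc, one_mul]

theorem cPlus_phaseAverage (hs : 0 ≤ s) (h : ∀ᵐ x ∂ρ, ‖Z.toH A s x‖ ≤ 1)
    {v : ℝ → Z A s → Z A (-σ)} (hv : IsAdmissibleField v) (t : ℝ) {k : ℕ} (j : Fin k) :
    cPlus v ((phaseAverage ρ).map (Z.toH A s)) t j = ∫ x, cPlusIntegrand v t j x ∂ρ := by
  rw [cPlus, restrictToZ_phaseAverage hs h]
  exact integral_phaseAverage
    (stronglyMeasurable_cPlusIntegrand_right hv t j)
    fun c x hc => cPlusIntegrand_smul hv t j hc x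

theorem cMinus_phaseAverage (hs : 0 ≤ s) (h : ∀ᵐ x ∂ρ, ‖Z.toH A s x‖ ≤ 1)
    {v : ℝ → Z A s → Z A (-σ)} (hv : IsAdmissibleField v) (t : ℝ) {k : ℕ} (j : Fin k) :
    cMinus v ((phaseAverage ρ).map (Z.toH A s)) t j = ∫ x, cMinusIntegrand v t j x ∂ρ := by
  rw [cMinus, restrictToZ_phaseAverage hs h]
  exact integral_phaseAverage
    (stronglyMeasurable_cMinusIntegrand_right hv t j)
    fun c x hc => cMinusIntegrand_smul hv t j hc x

theorem integrable_integrands_phaseAverage (hs : 0 ≤ s) (h : ∀ᵐ x ∂ρ, ‖Z.toH A s x‖ ≤ 1)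
    {v : ℝ → Z A s → Z A (-σ)} (hv : IsAdmissibleField v) {a b t C : ℝ} (ht : t ∈ Ioo a b)
    (hC : ∀ᵐ x ∂ρ, ‖x‖ ≤ C) {k : ℕ} (j : Fin k) :
    Integrable (cPlusIntegrand v t j) (restrictToZ A s ((phaseAverage ρ).map (Z.toH A s))) ∧
    Integrable (cMinusIntegrand v t j) (restrictToZ A s ((phaseAverage ρ).map (Z.toH A s))) := by
  rw [restrictToZ_phaseAverage hs h]
  obtain ⟨D, hD⟩ := hv.exists_bound a b C
  have hC' : ∀ᵐ x ∂(phaseAverage ρ), ‖x‖ ≤ C := by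
    refine ae_phaseAverage ?_ (fun c x hc hx => ?_) hC
    · exact (isClosed_le continuous_norm continuous_const).measurableSet
    · rwa [norm_smul, hc, one_mul]
  constructor
  · refine Integrable.of_bound
      (stronglyMeasurable_cPlusIntegrand_right hv t j).aestronglyMeasurable (slotBound A s σ C D k) ?_
    filter_upwards [hC'] with x hx using norm_cPlusIntegrand_le j hx (hD t ht x hx)
  · refine Integrable.of_bound
      (stronglyMeasurable_cMinusIntegrand_right hv t j).aestronglyMeasurable (slotBound A s σ C D k) ?_
    filter_upwards [hC'] with x hx using norm_cMinusIntegrand_le j hx (hD t ht x hx)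

end Fixed

variable {ν : Measure (Z A s)} {Φ : ℝ → Z A s → Z A s}

/-- The push-forward hierarchy of a flow at time `t`. -/
def pushHierarchy (ν : Measure (Z A s)) (Φ : ℝ → Z A s → Z A s) (t : ℝ) (k : ℕ) :
    TraceClass (HTensor H k) :=
  ∫ x, ketbra (tpow k (Z.toH A s x)) (tpow k (Z.toH A s x)) ∂(ν.map (Φ t))

theorem pushHierarchy_eq {t : ℝ} (hΦ : AEMeasurable (Φ t) ν) (k : ℕ) :
    pushHierarchy ν Φ t k
      = ∫ x, ketbra (tpow k (Z.toH A s (Φ t x))) (tpow k (Z.toH A s (Φ t x))) ∂ν :=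
  integral_map hΦ (continuous_ketbra_tpow_toH k).aestronglyMeasurable

theorem aestronglyMeasurable_toH {t : ℝ} (hΦ : AEMeasurable (Φ t) ν) :
    AEStronglyMeasurable (fun x => Z.toH A s (Φ t x)) ν :=
  (Z.toH A s).continuous.comp_aestronglyMeasurable hΦ.aestronglyMeasurable

variable [IsProbabilityMeasure ν]

theorem weighted_pushHierarchy {t : ℝ} (hΦ : AEMeasurable (Φ t) ν) {C : ℝ}
    (h1 : ∀ᵐ x ∂ν, ‖Z.toH A s (Φ t x)‖ ≤ C) (k : ℕ) :
    weighted A σ (pushHierarchy ν Φ t k).op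
      = (∫ x, ketbra (slotPow A s σ k (Φ t x)) (slotPow A s σ k (Φ t x)) ∂ν).op := by
  have hm := aestronglyMeasurable_toH hΦ
  rw [pushHierarchy_eq hΦ]
  refine weighted_integral_ketbra_tpow σ (integrable_ketbra_tpow hm h1 k)
    (integrable_ketbra_tpow (C := ‖A.negPow (σ / 2)‖ * C)
      ((A.negPow (σ / 2)).continuous.comp_aestronglyMeasurable hm) ?_ k)
  filter_upwards [h1] with x hx
  exact ((A.negPow (σ / 2)).le_opNorm _).trans (by gcongr)

theorem regularityBound_pushHierarchy {t : ℝ} (hΦ : AEMeasurable (Φ t) ν) {C : ℝ}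
    (hC : ∀ᵐ x ∂ν, ‖Φ t x‖ ≤ C) (k : ℕ) :
    RegularityBound A s (pushHierarchy ν Φ t k) (C ^ (2 * k)) := by
  have hm : AEStronglyMeasurable (fun x => Z.coord A s (Φ t x)) ν :=
    (Z.coord A s).continuous.comp_aestronglyMeasurable hΦ.aestronglyMeasurable
  have hn : ∀ᵐ x ∂ν, ‖Z.coord A s (Φ t x)‖ ≤ C := by
    filter_upwards [hC] with x hx
    rwa [LinearIsometryEquiv.norm_map]
  -- The coordinate of x is A^{s/2}x, so this mixture is what the unbounded weights would produce;
  -- weighting it by A^{-s/2} gives back γ_t.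
  refine ⟨∫ x, ketbra (tpow k (Z.coord A s (Φ t x))) (tpow k (Z.coord A s (Φ t x))) ∂ν, ?_, ?_⟩
  · rw [pushHierarchy_eq hΦ]
    refine (weighted_integral_ketbra_tpow s (integrable_ketbra_tpow hm hn k)
      (integrable_ketbra_tpow (C := ‖A.negPow (s / 2)‖ * C)
      ((A.negPow (s / 2)).continuous.comp_aestronglyMeasurable hm) ?_ k)).symm
    filter_upwards [hn] with x hx
    exact ((A.negPow (s / 2)).le_opNorm _).trans (by gcongr)
  · refine (norm_integral_le_of_norm_le_const (C := C ^ (2 * k)) ?_).trans (by simp)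
    filter_upwards [ae_norm_tpow_le hn k] with x hx
    refine (norm_ketbra_le _ _).trans ?_
    rw [two_mul, pow_add]
    exact mul_le_mul hx hx (norm_nonneg _) ((norm_nonneg _).trans hx)

/-- Each property is the pointwise one integrated over ν; weak-* continuity is dominated convergence
from continuity of almost every trajectory in 𝒵_{-σ}. -/
theorem isRegularCurve_pushHierarchy {a b C : ℝ} (hΦ : ∀ t, AEMeasurable (Φ t) ν)
    (hC0 : 0 < C) (hC : ∀ᵐ x ∂ν, ∀ t ∈ Ioo a b, ‖Φ t x‖ ≤ C)
    (h1 : ∀ᵐ x ∂ν, ∀ t ∈ Ioo a b, ‖Z.toH A s (Φ t x)‖ ≤ 1)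
    (hfin : FiniteDimensional ℂ H → ∀ᵐ x ∂ν, ∀ t ∈ Ioo a b, ‖Z.toH A s (Φ t x)‖ = 1)
    (hcont : ∀ᵐ x ∂ν, ContinuousOn (fun t => Z.emb A s σ (Φ t x)) (Ioo a b)) :
    IsRegularCurve A s σ a b (pushHierarchy ν Φ) where
  hierarchy t ht := by
    have h2 := isSymmetricHierarchy_of_measure (aestronglyMeasurable_toH (hΦ t))
      (h1.mono fun x hx => hx t ht) fun hd => (hfin hd).mono fun x hx => hx t ht
    convert h2 using 1
    exact funext fun k => pushHierarchy_eq (hΦ t) k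
  bound := ⟨C, hC0, fun t ht k =>
    regularityBound_pushHierarchy (hΦ t) (hC.mono fun x hx => hx t ht) k⟩
  continuous k K _ := by
    set M := ‖Z.emb A s σ‖ * C
    have hM : ∀ᵐ x ∂ν, ∀ t ∈ Ioo a b, ‖slotPow A s σ k (Φ t x)‖ ≤ M ^ k := by
      filter_upwards [hC] with x hx t ht
      rw [norm_slotPow]
      refine pow_le_pow_left₀ (norm_nonneg _) ?_ k
      exact ((Z.emb A s σ).le_opNorm _).trans
        (mul_le_mul_of_nonneg_left (hx t ht) (norm_nonneg _))
    have hm : ∀ t, AEStronglyMeasurable (fun x => slotPow A s σ k (Φ t x)) ν := fun t =>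
      (continuous_slotPow k).comp_aestronglyMeasurable (hΦ t).aestronglyMeasurable
    have heq : ∀ t ∈ Ioo a b, trace (weighted A σ (pushHierarchy ν Φ t k).op ∘L K)
        = ∫ x, ⟪slotPow A s σ k (Φ t x), K (slotPow A s σ k (Φ t x))⟫_ℂ ∂ν := by
      intro t ht
      rw [weighted_pushHierarchy (hΦ t) (h1.mono fun x hx => hx t ht)]
      exact trace_integral_ketbra_comp (hm t) (hM.mono fun x hx => hx t ht) K
    refine ContinuousOn.congr ?_ heq
    refine continuousOn_of_dominated (bound := fun _ => M ^ k * (‖K‖ * M ^ k)) (fun t _ => ?_)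
      (fun t ht => ?_) (integrable_const _) ?_
    · exact (hm t).inner (K.continuous.comp_aestronglyMeasurable (hm t))
    · filter_upwards [hM] with x hx
      have h3 := hx t ht
      refine (norm_inner_le_norm _ _).trans
        (mul_le_mul h3 ?_ (norm_nonneg _) ((norm_nonneg _).trans h3))
      exact (K.le_opNorm _).trans (mul_le_mul_of_nonneg_left h3 (norm_nonneg _))
    · filter_upwards [hcont] with x hx
      have h3 : ContinuousOn (fun t => slotPow A s σ k (Φ t x)) (Ioo a b) :=
        ((continuous_tpow k).comp (Z.coord A (-σ)).continuous).comp_continuousOn hx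
      exact h3.inner (K.continuous.comp_continuousOn h3)

theorem solvesHierarchy_pushHierarchy [MeasurableSpace H] [BorelSpace H] (hs : 0 ≤ s)
    {v : ℝ → Z A s → Z A (-σ)} (hv : IsAdmissibleField v) {a b t₀ C : ℝ} (ht₀ : t₀ ∈ Ioo a b)
    (hΦ : Measurable fun p : ℝ × Z A s => Φ p.1 p.2)
    (hC : ∀ᵐ x ∂ν, ∀ t ∈ Ioo a b, ‖Φ t x‖ ≤ C)
    (h1 : ∀ᵐ x ∂ν, ∀ t ∈ Ioo a b, ‖Z.toH A s (Φ t x)‖ ≤ 1)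
    (hsol : ∀ᵐ x ∂ν, ∀ p ∈ Ioo a b, ∀ q ∈ Ioo a b, p ≤ q →
      Z.emb A s σ (Φ q x) - Z.emb A s σ (Φ p x) = ∫ τ in p..q, v τ (Φ τ x)) :
    SolvesHierarchy v a b t₀ (pushHierarchy ν Φ) := by
  obtain ⟨D, hD⟩ := hv.exists_bound a b C
  have hΦt : ∀ t, Measurable (Φ t) := fun t => hΦ.comp measurable_prodMk_left
  have hprob : ∀ t, IsProbabilityMeasure (ν.map (Φ t)) := fun t =>
    Measure.isProbabilityMeasure_map (hΦt t).aemeasurable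
  have h1' : ∀ t ∈ Ioo a b, ∀ᵐ x ∂(ν.map (Φ t)), ‖Z.toH A s x‖ ≤ 1 := fun t ht => by
    rw [ae_map_iff (hΦt t).aemeasurable
      (isClosed_le (Z.toH A s).continuous.norm continuous_const).measurableSet]
    exact h1.mono fun x hx => hx t ht
  have hC' : ∀ t ∈ Ioo a b, ∀ᵐ x ∂(ν.map (Φ t)), ‖x‖ ≤ C := fun t ht => by
    rw [ae_map_iff (hΦt t).aemeasurable
      (isClosed_le continuous_norm continuous_const).measurableSet]
    exact hC.mono fun x hx => hx t ht
  have hmP : ∀ {k : ℕ} (j : Fin k), StronglyMeasurable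
      fun p : ℝ × Z A s => cPlusIntegrand v p.1 j (Φ p.1 p.2) := fun j =>
    stronglyMeasurable_cPlusIntegrand hv j measurable_fst hΦ
  have hmM : ∀ {k : ℕ} (j : Fin k), StronglyMeasurable
      fun p : ℝ × Z A s => cMinusIntegrand v p.1 j (Φ p.1 p.2) := fun j =>
    stronglyMeasurable_cMinusIntegrand hv j measurable_fst hΦ
  have hbP : ∀ᵐ p ∂((volume.restrict (Ioo a b)).prod ν), p.1 ∈ Ioo a b ∧ ‖Φ p.1 p.2‖ ≤ C := by
    filter_upwards [Measure.quasiMeasurePreserving_snd.ae hC,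
      Measure.quasiMeasurePreserving_fst.ae (ae_restrict_mem measurableSet_Ioo)] with p h2 h3
    exact ⟨h3, h2 _ h3⟩
  have hiP : ∀ {k : ℕ} (j : Fin k), Integrable
      (fun p : ℝ × Z A s => cPlusIntegrand v p.1 j (Φ p.1 p.2))
      ((volume.restrict (Ioo a b)).prod ν) := fun {k} j =>
    Integrable.of_bound (hmP j).aestronglyMeasurable (slotBound A s σ C D k) <| by
      filter_upwards [hbP] with p hp
      exact norm_cPlusIntegrand_le j hp.2 (hD _ hp.1 _ hp.2)
  have hiM : ∀ {k : ℕ} (j : Fin k), Integrable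
      (fun p : ℝ × Z A s => cMinusIntegrand v p.1 j (Φ p.1 p.2))
      ((volume.restrict (Ioo a b)).prod ν) := fun {k} j =>
    Integrable.of_bound (hmM j).aestronglyMeasurable (slotBound A s σ C D k) <| by
      filter_upwards [hbP] with p hp
      exact norm_cMinusIntegrand_le j hp.2 (hD _ hp.1 _ hp.2)
  -- The phase average of the law of Φ t serves as de Finetti measure; phase invariance turns its
  -- integrals back into integrals over ν.
  set μ : ℝ → Measure H := fun t => (phaseAverage (ν.map (Φ t))).map (Z.toH A s)
  have hP : ∀ t ∈ Ioo a b, ∀ {k : ℕ} (j : Fin k),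
      cPlus v (μ t) t j = ∫ x, cPlusIntegrand v t j (Φ t x) ∂ν := by
    intro t ht k j
    rw [cPlus_phaseAverage hs (h1' t ht) hv]
    exact integral_map (hΦt t).aemeasurable
      (stronglyMeasurable_cPlusIntegrand_right hv t j).aestronglyMeasurable
  have hM : ∀ t ∈ Ioo a b, ∀ {k : ℕ} (j : Fin k),
      cMinus v (μ t) t j = ∫ x, cMinusIntegrand v t j (Φ t x) ∂ν := by
    intro t ht k j
    rw [cMinus_phaseAverage hs (h1' t ht) hv]
    exact integral_map (hΦt t).aemeasurable
      (stronglyMeasurable_cMinusIntegrand_right hv t j).aestronglyMeasurable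
  have hslice : ∀ t ∈ Ioo a b, ∀ {k : ℕ} (j : Fin k),
      Integrable (fun x => cPlusIntegrand v t j (Φ t x)) ν ∧
      Integrable (fun x => cMinusIntegrand v t j (Φ t x)) ν := fun t ht {k} j => by
    constructor
    · refine Integrable.of_bound
        (stronglyMeasurable_cPlusIntegrand hv j measurable_const
          (hΦt t)).aestronglyMeasurable (slotBound A s σ C D k) ?_
      filter_upwards [hC] with x hx
      exact norm_cPlusIntegrand_le j (hx t ht) (hD t ht _ (hx t ht))
    · refine Integrable.of_bound
        (stronglyMeasurable_cMinusIntegrand hv j measurable_const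
          (hΦt t)).aestronglyMeasurable (slotBound A s σ C D k) ?_
      filter_upwards [hC] with x hx
      exact norm_cMinusIntegrand_le j (hx t ht) (hD t ht _ (hx t ht))
  set S : (k : ℕ) → ℝ → Z A s → TraceClass (HTensor H k) := fun k t x =>
    ∑ j : Fin k, (cPlusIntegrand v t j (Φ t x) + cMinusIntegrand v t j (Φ t x))
  have hS : ∀ t ∈ Ioo a b, ∀ k,
      ∑ j : Fin k, (cPlus v (μ t) t j + cMinus v (μ t) t j) = ∫ x, S k t x ∂ν := by
    intro t ht k
    refine Eq.trans ?_ (integral_finsetSum Finset.univ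
      (f := fun (j : Fin k) x => cPlusIntegrand v t j (Φ t x) + cMinusIntegrand v t j (Φ t x))
      fun j _ => (hslice t ht j).1.add (hslice t ht j).2).symm
    refine Finset.sum_congr rfl fun j _ => ?_
    rw [hP t ht, hM t ht]
    exact (integral_add (hslice t ht j).1 (hslice t ht j).2).symm
  have hSi : ∀ k, Integrable (Function.uncurry (S k)) ((volume.restrict (Ioo a b)).prod ν) :=
    fun k => integrable_finsetSum _ fun j _ => (hiP j).add (hiM j)
  have hSb : ∀ᵐ x ∂ν, ∀ k, IntegrableOn (fun t => S k t x) (Ioo a b) := by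
    rw [ae_all_iff]
    exact fun k => (hSi k).prod_left_ae
  have hsubset : ∀ {p q : ℝ}, p ∈ Ioo a b → q ∈ Ioo a b → Ioc p q ⊆ Ioo a b :=
    fun hp hq t ht => ⟨hp.1.trans ht.1, ht.2.trans_lt hq.2⟩
  have hsl : ∀ t ∈ Ioo a b, ∀ k,
      Integrable (fun x => ketbra (slotPow A s σ k (Φ t x)) (slotPow A s σ k (Φ t x))) ν := by
    intro t ht k
    have hm : AEStronglyMeasurable (fun x => slotPow A s σ k (Φ t x)) ν :=
      (continuous_slotPow k).comp_aestronglyMeasurable (hΦt t).aestronglyMeasurable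
    have hb : ∀ᵐ x ∂ν, ‖slotPow A s σ k (Φ t x)‖ ≤ (‖Z.emb A s σ‖ * C) ^ k := by
      filter_upwards [hC] with x hx
      rw [norm_slotPow]
      refine pow_le_pow_left₀ (norm_nonneg _) ?_ k
      exact ((Z.emb A s σ).le_opNorm _).trans
        (mul_le_mul_of_nonneg_left (hx t ht) (norm_nonneg _))
    exact integrable_ketbra hm hm hb hb
  have key : ∀ p ∈ Ioo a b, ∀ q ∈ Ioo a b, p ≤ q → ∀ k,
      ∫ x, ketbra (slotPow A s σ k (Φ q x)) (slotPow A s σ k (Φ q x)) ∂ν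
        - ∫ x, ketbra (slotPow A s σ k (Φ p x)) (slotPow A s σ k (Φ p x)) ∂ν
      = ∫ t in p..q, ∑ j : Fin k, (cPlus v (μ t) t j + cMinus v (μ t) t j) := by
    intro p hp q hq hpq k
    have hIcc : ∀ t ∈ Icc p q, t ∈ Ioo a b := fun t ht =>
      ⟨hp.1.trans_le ht.1, ht.2.trans_lt hq.2⟩
    rw [← integral_sub (hsl q hq k) (hsl p hp k)]
    have h2 : ∫ t in p..q, ∑ j : Fin k, (cPlus v (μ t) t j + cMinus v (μ t) t j)
        = ∫ t in p..q, ∫ x, S k t x ∂ν := by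
      refine intervalIntegral.integral_congr fun t ht => ?_
      rw [uIcc_of_le hpq] at ht
      exact hS t (hIcc t ht) k
    -- Fubini reduces the identity to a single trajectory.
    rw [h2, intervalIntegral_integral_swap]
    swap
    · rw [uIoc_of_le hpq]
      exact (hSi k).mono_measure (Measure.prod_mono (Measure.restrict_mono (hsubset hp hq) le_rfl)
        le_rfl)
    refine integral_congr_ae ?_
    filter_upwards [hsol, hC, hSb] with x hx hxC hxS
    refine ketbra_slotPow_sub_eq_integral hpq
      (fun t ht => hx p hp t (hIcc t ht) ht.1)
      (fun t ht => hD t (hIcc t ht) _ (hxC t (hIcc t ht))) ?_ k ?_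
    · rw [intervalIntegrable_iff_integrableOn_Ioc_of_le hpq]
      have hmv : Measurable fun t => v t (Φ t x) :=
        hv.borel.comp (measurable_id.prodMk (hΦ.comp measurable_prodMk_right))
      refine Measure.integrableOn_of_bounded (M := D) measure_Ioc_lt_top.ne
        hmv.aestronglyMeasurable ?_
      filter_upwards [ae_restrict_mem measurableSet_Ioc] with t ht
      have h3 := hsubset hp hq ht
      exact hD t h3 _ (hxC t h3)
    · rw [intervalIntegrable_iff_integrableOn_Ioc_of_le hpq]
      exact (hxS k).mono_set (hsubset hp hq)
  refine ⟨μ, fun t ht => ?_, fun t ht k j => ?_, fun k j => ⟨?_, ?_⟩, fun t ht k => ?_⟩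
  · exact isDeFinettiMeasure_phaseAverage (h1' t ht)
  · exact integrable_integrands_phaseAverage hs (h1' t ht) hv ht (hC' t ht) j
  · exact (integrableOn_congr_fun (fun t ht => hP t ht j) measurableSet_Ioo).2
      (hiP j).integral_prod_left
  · exact (integrableOn_congr_fun (fun t ht => hM t ht j) measurableSet_Ioo).2
      (hiM j).integral_prod_left
  · rw [weighted_pushHierarchy (hΦt t).aemeasurable (h1.mono fun x hx => hx t ht),
      weighted_pushHierarchy (hΦt t₀).aemeasurable (h1.mono fun x hx => hx t₀ ht₀), ← map_add]
    congr 1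
    -- `key` needs ordered endpoints; for t < t₀ the oriented integral changes sign.
    rcases le_total t₀ t with h | h
    · rw [← key t₀ ht₀ t ht h k, add_sub_cancel]
    · rw [intervalIntegral.integral_symm, ← key t ht t₀ ht₀ h k]
      abel

end Superposition

/-! ### Where a representing measure is concentrated. -/

section Support

variable {H : Type u} [NormedAddCommGroup H] [InnerProductSpace ℂ H]
  {X : Type*} [MeasurableSpace X] {μ : Measure X}

/-- Since ⟨u^{⊗k}, f^{⊗k}⟩ = ⟨u,f⟩^k, bounds on γ^{(k)} become bounds on moments. -/
theorem lintegral_enorm_inner_pow {f : X → H} (k : ℕ)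
    (hi : Integrable (fun x => ketbra (tpow k (f x)) (tpow k (f x))) μ) (u : H) :
    ∫⁻ x, ‖⟪u, f x⟫_ℂ‖ₑ ^ (2 * k) ∂μ
      = ENNReal.ofReal
        ‖⟪tpow k u, (∫ x, ketbra (tpow k (f x)) (tpow k (f x)) ∂μ).op (tpow k u)⟫_ℂ‖ := by
  rw [← lintegral_enorm_inner_sq hi]
  refine lintegral_congr fun x => ?_
  rw [inner_tpow, enorm_pow, ← pow_mul, mul_comm]

variable [TopologicalSpace.SeparableSpace H] {γ : (k : ℕ) → TraceClass (HTensor H k)}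

/-- A measure representing a symmetric hierarchy is carried by the unit ball. -/
theorem IsSymmetricHierarchy.ae_norm_le_one (hγ : IsSymmetricHierarchy γ) {f : X → H}
    (hf : AEStronglyMeasurable f μ)
    (hi : ∀ k, Integrable (fun x => ketbra (tpow k (f x)) (tpow k (f x))) μ)
    (hγf : ∀ k, γ k = ∫ x, ketbra (tpow k (f x)) (tpow k (f x)) ∂μ) :
    ∀ᵐ x ∂μ, ‖f x‖ ≤ 1 := by
  refine ae_norm_le_of_moments (B := ContinuousLinearMap.id ℂ H) denseRange_id hf
    (fun u k => ?_) zero_le_one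
  rw [ContinuousLinearMap.id_apply, lintegral_enorm_inner_pow k (hi k), ← hγf k, one_mul,
    ← ENNReal.ofReal_pow (norm_nonneg _)]
  refine ENNReal.ofReal_le_ofReal ((hγ.norm_inner_le k _).trans_eq ?_)
  rw [norm_tpow, ← pow_mul, mul_comm]

/-- In finite dimensions, a measure representing a symmetric hierarchy is carried by the unit
sphere. -/
theorem IsSymmetricHierarchy.ae_norm_eq_one [FiniteDimensional ℂ H] [IsProbabilityMeasure μ]
    (hγ : IsSymmetricHierarchy γ) {f : X → H} (hf : AEStronglyMeasurable f μ)
    (hf1 : ∀ᵐ x ∂μ, ‖f x‖ ≤ 1)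
    (hγf : γ 1 = ∫ x, ketbra (tpow 1 (f x)) (tpow 1 (f x)) ∂μ) :
    ∀ᵐ x ∂μ, ‖f x‖ = 1 := by
  have h1 := hγ.trace_eq_one 1
  have h2 := trace_integral_ketbra_tpow hf hf1 1 (ContinuousLinearMap.id ℂ _)
  have h3 : ∀ x, ⟪tpow 1 (f x), ContinuousLinearMap.id ℂ _ (tpow 1 (f x))⟫_ℂ
      = ((‖f x‖ ^ 2 : ℝ) : ℂ) := fun x => by
    rw [ContinuousLinearMap.id_apply, inner_self_eq_norm_sq_to_K, norm_tpow, pow_one]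
    norm_cast
  rw [ContinuousLinearMap.comp_id, ← hγf, h1] at h2
  simp only [h3] at h2
  rw [integral_complex_ofReal] at h2
  -- The one-particle trace is the mean of ‖f‖². A function at most 1 with mean 1 under a
  -- probability measure equals 1 almost everywhere.
  have h4 : ∫ x, ‖f x‖ ^ 2 ∂μ = 1 := by exact_mod_cast h2.symm
  have h5 : Integrable (fun x => ‖f x‖ ^ 2) μ :=
    Integrable.of_bound (hf.norm.pow 2) 1 <| by
      filter_upwards [hf1] with x hx
      rw [Real.norm_of_nonneg (by positivity)]
      exact pow_le_one₀ (norm_nonneg _) hx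
  have h6 : ∫ x, (1 - ‖f x‖ ^ 2) ∂μ = 0 := by
    rw [integral_sub (integrable_const _) h5, h4]
    simp
  have h7 : 0 ≤ᵐ[μ] fun x => 1 - ‖f x‖ ^ 2 := by
    filter_upwards [hf1] with x hx
    exact sub_nonneg.2 (pow_le_one₀ (norm_nonneg _) hx)
  filter_upwards [(integral_eq_zero_iff_of_nonneg_ae h7 ((integrable_const _).sub h5)).1 h6]
    with x hx
  have h8 : ‖f x‖ ^ 2 = 1 := (sub_eq_zero.1 hx).symm
  exact (pow_eq_one_iff_of_nonneg (norm_nonneg _) two_ne_zero).1 h8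

/-- The regularity bound confines a representing measure to a ball of `𝒵_s`. -/
theorem ae_norm_le_of_regularityBound [CompleteSpace H] {A : PosOp H} {s : ℝ} (hs : 0 ≤ s)
    {ν : Measure (Z A s)}
    (hi : ∀ k, Integrable (fun x => ketbra (tpow k (Z.toH A s x)) (tpow k (Z.toH A s x))) ν)
    (hγν : ∀ k, γ k = ∫ x, ketbra (tpow k (Z.toH A s x)) (tpow k (Z.toH A s x)) ∂ν)
    {R : ℝ} (hR : 0 ≤ R) (hb : ∀ k, RegularityBound A s (γ k) (R ^ (2 * k))) :
    ∀ᵐ x ∂ν, ‖x‖ ≤ R := by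
  have hc : Continuous fun x : Z A s => Z.coord A s x := (Z.coord A s).continuous
  have h1 := ae_norm_le_of_moments (μ := ν) (B := A.negPow (s / 2))
    (A.negPow_denseRange (by positivity)) (f := fun x => Z.coord A s x)
    hc.aestronglyMeasurable (M := R) (fun u k => ?_) hR
  · filter_upwards [h1] with x hx
    rwa [LinearIsometryEquiv.norm_map] at hx
  · obtain ⟨S, hS, hSR⟩ := hb k
    -- Testing in the direction A^{-s/2}u turns the 𝒵_s-coordinate into the vector of H that enters
    -- γ.
    have h2 : ∀ x : Z A s, ⟪A.negPow (s / 2) u, Z.coord A s x⟫_ℂ = ⟪u, Z.toH A s x⟫_ℂ :=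
      fun x => inner_negPow _ _ _
    simp only [h2]
    have h3 : opPow (A.negPow (s / 2)) k (tpow k u) = tpow k (A.negPow (s / 2) u) :=
      opPow_tensorVec _ k _
    have h4 : ⟪tpow k u, (γ k).op (tpow k u)⟫_ℂ
        = ⟪tpow k (A.negPow (s / 2) u), S.op (tpow k (A.negPow (s / 2) u))⟫_ℂ := by
      rw [hS, weighted, ContinuousLinearMap.comp_apply, ContinuousLinearMap.comp_apply, h3]
      exact inner_opPow (inner_negPow (s / 2)) k (fun _ => u) _
    rw [lintegral_enorm_inner_pow k (hi k), ← hγν k, h4, ← ENNReal.ofReal_pow (by positivity)]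
    refine ENNReal.ofReal_le_ofReal ?_
    calc _ ≤ ‖tpow k (A.negPow (s / 2) u)‖ * (‖S.op‖ * ‖tpow k (A.negPow (s / 2) u)‖) :=
          (norm_inner_le_norm _ _).trans
            (mul_le_mul_of_nonneg_left (S.op.le_opNorm _) (norm_nonneg _))
      _ ≤ ‖tpow k (A.negPow (s / 2) u)‖ * (R ^ (2 * k) * ‖tpow k (A.negPow (s / 2) u)‖) := by
          gcongr
          exact S.norm_op_le.trans hSR
      _ = (R * ‖A.negPow (s / 2) u‖) ^ (2 * k) := by
          rw [norm_tpow]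
          ring

end Support

/-- Turns a flow that is Borel only on its domain into a globally Borel map, as joint measurability
is needed for Fubini. -/
theorem measurable_indicator_prod {X Y W : Type*} [MeasurableSpace X] [MeasurableSpace Y]
    [MeasurableSpace W] [Zero W] {I : Set X} {S : Set Y} (hI : MeasurableSet I)
    (hS : MeasurableSet S) {φ : X → Y → W} (hφ : Measurable fun p : I × S => φ p.1 p.2) :
    Measurable ((I ×ˢ S).indicator fun p => φ p.1 p.2) := by
  refine measurable_of_restrict_of_restrict_compl (hI.prod hS) ?_ ?_
  · have h1 : Measurable fun p : ↥(I ×ˢ S) => ((⟨p.1.1, p.2.1⟩, ⟨p.1.2, p.2.2⟩) : I × S) :=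
      ((measurable_fst.comp measurable_subtype_coe).subtype_mk).prodMk
        ((measurable_snd.comp measurable_subtype_coe).subtype_mk)
    convert hφ.comp h1 using 1
    ext p
    rw [domRestrict_apply, indicator_of_mem p.2]
    rfl
  · convert measurable_const (a := (0 : W)) using 1
    ext p
    rw [domRestrict_apply, indicator_of_notMem p.2]

end Hierarchy

end

/-! ### The existence principle. -/

theorem mainTheorem4 {H : Type*} [NormedAddCommGroup H] [InnerProductSpace ℂ H] [CompleteSpace H]
    [TopologicalSpace.SeparableSpace H] [MeasurableSpace H] [BorelSpace H]
    (A : PosOp H) (s σ : ℝ) (hs : 0 ≤ s) (hsσ : s ≤ σ)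
    (v : ℝ → Z A s → Z A (-σ)) (hv : IsAdmissibleField v)
    (a b t₀ : ℝ) (ht₀ : t₀ ∈ Ioo a b)
    (𝒜 : Set (Z A s)) (h𝒜 : MeasurableSet 𝒜)
    (h𝒜_phase : ∀ x ∈ 𝒜, ∀ θ : ℝ, Complex.exp (θ * Complex.I) • x ∈ 𝒜)
    (φ : ℝ → Z A s → Z A s)
    (hφ_borel : Measurable fun p : Icc a b × 𝒜 => φ p.1 p.2)
    (hφ_bdd : ∀ S ⊆ Icc a b ×ˢ 𝒜, Bornology.IsBounded S →
      Bornology.IsBounded ((fun p : ℝ × Z A s => φ p.1 p.2) '' S))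
    (hφ_sol : ∀ x ∈ 𝒜, IsWeakSolution v a b t₀ x fun t => φ t x)
    (hφ_norm : ∀ x ∈ 𝒜, ∀ t ∈ Icc a b, ‖Z.toH A s (φ t x)‖ = ‖Z.toH A s x‖)
    (hφ_phase : ∀ x ∈ 𝒜, ∀ t ∈ Icc a b, ∀ θ : ℝ,
      φ t (Complex.exp (θ * Complex.I) • x) = Complex.exp (θ * Complex.I) • φ t x)
    (γ : (k : ℕ) → TraceClass (HTensor H k)) (hγ : IsSymmetricHierarchy γ)
    (ν : Measure (Z A s)) [IsProbabilityMeasure ν] (hν𝒜 : ν 𝒜 = 1)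
    (hν_int : ∀ k, Integrable (fun x => ketbra (tpow k (Z.toH A s x)) (tpow k (Z.toH A s x))) ν)
    (hγν : ∀ k, γ k = ∫ x, ketbra (tpow k (Z.toH A s x)) (tpow k (Z.toH A s x)) ∂ν)
    (R : ℝ) (hR : 0 < R) (hγ_bound : ∀ k : ℕ, RegularityBound A s (γ k) (R ^ (2 * k))) :
    ∃ γt : ℝ → (k : ℕ) → TraceClass (HTensor H k),
      IsRegularCurve A s σ a b γt ∧
      γt t₀ = γ ∧
      SolvesHierarchy v a b t₀ γt ∧
      ∀ t ∈ Ioo a b, ∀ k,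
        γt t k = ∫ x, ketbra (tpow k (Z.toH A s x)) (tpow k (Z.toH A s x)) ∂(ν.map (φ t)) := by
  have h𝒜ae : ∀ᵐ x ∂ν, x ∈ 𝒜 := (prob_compl_eq_zero_iff h𝒜).2 hν𝒜
  have hI : Ioo a b ⊆ Icc a b := Ioo_subset_Icc_self
  have hf : AEStronglyMeasurable (fun x => Z.toH A s x) ν :=
    (Z.toH A s).continuous.aestronglyMeasurable
  have hball := hγ.ae_norm_le_one hf hν_int hγν
  have hRae := ae_norm_le_of_regularityBound hs hν_int hγν hR.le hγ_bound
  -- Extension of φ by zero outside its domain; it agrees with φ for ν-almost every starting point.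
  let Φ : ℝ → Z A s → Z A s := fun t x =>
    (Icc a b ×ˢ 𝒜).indicator (fun p => φ p.1 p.2) (t, x)
  have hΦ : Measurable fun p : ℝ × Z A s => Φ p.1 p.2 :=
    measurable_indicator_prod measurableSet_Icc h𝒜 hφ_borel
  have hΦφ : ∀ t ∈ Icc a b, ∀ x ∈ 𝒜, Φ t x = φ t x := fun t ht x hx =>
    indicator_of_mem (show (t, x) ∈ Icc a b ×ˢ 𝒜 from ⟨ht, hx⟩) _
  have hΦt : ∀ t, AEMeasurable (Φ t) ν := fun t =>
    (hΦ.comp measurable_prodMk_left).aemeasurable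
  -- Almost all starting points lie in the ball of radius R, and φ is bounded on the bounded set of
  -- times and such points. The maximum with 1 secures positivity.
  obtain ⟨C, hC0, hC⟩ : ∃ C : ℝ, 0 < C ∧ ∀ᵐ x ∂ν, ∀ t ∈ Ioo a b, ‖Φ t x‖ ≤ C := by
    have hbdd : Bornology.IsBounded (Icc a b ×ˢ (𝒜 ∩ Metric.closedBall 0 R)) :=
      (Metric.isBounded_Icc a b).prod (Metric.isBounded_closedBall.subset inter_subset_right)
    obtain ⟨C, hC⟩ := (hφ_bdd _ (prod_mono_right inter_subset_left) hbdd).exists_norm_le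
    refine ⟨max C 1, by positivity, ?_⟩
    filter_upwards [h𝒜ae, hRae] with x hx hxR t ht
    rw [hΦφ t (hI ht) x hx]
    exact (hC _ ⟨(t, x), ⟨hI ht, hx, mem_closedBall_zero_iff.2 hxR⟩, rfl⟩).trans (le_max_left _ _)
  have hnorm : ∀ᵐ x ∂ν, ∀ t ∈ Ioo a b, ‖Z.toH A s (Φ t x)‖ = ‖Z.toH A s x‖ := by
    filter_upwards [h𝒜ae] with x hx t ht
    rw [hΦφ t (hI ht) x hx, hφ_norm x hx t (hI ht)]
  have h1 : ∀ᵐ x ∂ν, ∀ t ∈ Ioo a b, ‖Z.toH A s (Φ t x)‖ ≤ 1 := by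
    filter_upwards [hnorm, hball] with x hx hx1 t ht
    exact (hx t ht).trans_le hx1
  refine ⟨pushHierarchy ν Φ,
    isRegularCurve_pushHierarchy hΦt hC0 hC h1 (fun hd => ?_) ?_, ?_,
    solvesHierarchy_pushHierarchy hs hv ht₀ hΦ hC h1 ?_, fun t ht k => ?_⟩
  · filter_upwards [hnorm, hγ.ae_norm_eq_one hf hball (hγν 1)] with x hx hx1 t ht
    exact (hx t ht).trans hx1
  · filter_upwards [h𝒜ae] with x hx
    refine (hφ_sol x hx).continuousOn.congr fun t ht => ?_
    simp only [hΦφ t (hI ht) x hx]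
  · funext k
    rw [pushHierarchy_eq (hΦt t₀), hγν k]
    refine integral_congr_ae ?_
    filter_upwards [h𝒜ae] with x hx
    rw [hΦφ t₀ (hI ht₀) x hx, (hφ_sol x hx).initial]
  · filter_upwards [h𝒜ae] with x hx p hp q hq hpq
    rw [hΦφ p (hI hp) x hx, hΦφ q (hI hq) x hx, (hφ_sol x hx).sub_eq_integral hp hq hpq]
    refine intervalIntegral.integral_congr fun t ht => ?_
    rw [uIcc_of_le hpq] at ht
    simp only [hΦφ t ⟨hp.1.le.trans ht.1, ht.2.trans hq.2.le⟩ x hx]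
  -- Push-forwards depend only on the almost everywhere class, so Φ may be traded for φ.
  · have h2 : Φ t =ᵐ[ν] φ t := by
      filter_upwards [h𝒜ae] with x hx
      exact hΦφ t (hI ht) x hx
    rw [pushHierarchy, Measure.map_congr h2]
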